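/- **Setting.** Let $N\ge 1$ be an integer, $\Gamma\subset \mathrm{SL}_2(\mathbb Z)$ a congruence subgroup, $k\ge 0$ an integer, and write $e(w)=e^{2\pi i w}$. For $\kappa \in\mathbb Z$ let $\Delta_\kappa=-y^2\big(\partial_x^2+\partial_y^2\big)+i\kappa y\big(\partial_x+i\partial_y\big)$ and $\xi_\kappa G=2iy^\kappa\,\overline{\partial_{\bar z}G}$. The space $H_{2k+2}(\Gamma)$ of harmonic Maass forms consists of the smooth functions $G:\mathbb H\to\mathbb C$ with $G|_{2k+2}\gamma=G$ for $\gamma\in\Gamma$ and $\Delta_{2k+2}G=0$, which are of at most linear exponential growth at all cusps, i.e. for each $\sigma\in\mathrm{SL}_2(\mathbb Z)$ one has $(G|_{2k+2}\sigma)(z)=O(e^{Cy})$ as $y\to\infty$, uniformly in $x$, for some $C$. Let $V$ be the space of rational traceless $2\times 2$ matrices with $Q(X)=N\det X$, $(X,Y)=-N\,\mathrm{tr}(XY)$ and the action $\gamma X:=\gamma X\gamma^{-1}$, oriented by the basis $\left(\begin{smallmatrix}0&1\\-1&0\end{smallmatrix}\right),\left(\begin{smallmatrix}0&1\\1&0\end{smallmatrix}\right),\left(\begin{smallmatrix}1&0\\0&-1\end{smallmatrix}\right)$.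 Put $X_\infty=\left(\begin{smallmatrix}0&1\\0&0\end{smallmatrix}\right)$ and $\ell_\infty=\mathbb Q X_\infty$. For an isotropic line $\ell$ pick $\sigma_\ell\in\mathrm{SL}_2(\mathbb Z)$ with $\sigma_\ell\ell_\infty=\ell$; the positive multiples of $\sigma_\ell X_\infty$ are called positively oriented. Let $\alpha_\ell\geq 1$ be the width of the cusp $\ell$, i.e. the least positive integer with $\pm\sigma_\ell\left(\begin{smallmatrix}1&\alpha_\ell\\0&1\end{smallmatrix}\right)\sigma_\ell^{-1}\in\Gamma$ for some choice of sign. Put $G_\ell=G|_{2k+2}\sigma_\ell$, with Fourier expansion $$G_\ell(z)=\sum_{n\gg-\infty}a_\ell^+(n)e(nz)+a_\ell^-(0)y^{-1-2k}+\sum_{n\ll\infty,\,n\ne0}a_\ell^-(n)\,\mathcal E_{2k+2}(4\pi ny)\,e(nz),\qquad n\in\tfrac1{\alpha_\ell}\mathbb Z,$$ where for integers $\kappa\ge1$ and real $y \neq 0$ $$\mathcal E_\kappa(y)=\frac{(-1)^{\kappa+1}}{(\kappa-1)!}\Big(e^y\sum_{j=0}^{\kappa-2}y^{-j-1}j!-\mathrm{Ei}(y)\Big),\qquad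 \mathrm{Ei}(y)=-\mathrm{PV}\!\int_{-y}^\infty e^{-t}\frac{dt}t .$$ Let $a_{\xi_{2k+2}G,\ell}(0)$ be the constant Fourier coefficient of $(\xi_{2k+2}G)|_{-2k}\sigma_\ell$. Write $\Gamma(s,y)=\int_y^\infty e^{-t}t^{s-1}dt$ for integers $s\ge1$ and $y \in \mathbb{R}$, let $B_m$ be the Bernoulli polynomials, $\psi=\Gamma'/\Gamma$, and let $\psi^{(k)}$ be its $k$-th derivative. Let $X\in V$ with $m=Q(X)<0$ such that $|m|/4N$ is a rational square. Then $X$ is orthogonal to exactly two isotropic lines $\ell_X,\ell_{-X}$, labelled such that $(X,Y,\tilde Y)$ is a positively oriented basis for positively oriented $Y\in\ell_X$, $\tilde Y\in\ell_{-X}$. Let $Q_X(z)=N(x_3z^2-2x_2z-x_1)$ for $X=\left(\begin{smallmatrix}x_2&x_1\\x_3&-x_2\end{smallmatrix}\right)$, and define the rational numbers $r_{\ell_{\pm X}}$ by $\sigma_{\ell_{\pm X}}^{-1}(\pm X)=\sqrt{|m|/N}\left(\begin{smallmatrix}-1&2r_{\ell_{\pm X}}\\0&1\end{smallmatrix}\right)$.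 Let $c_+>0$ and $c_-=\mathrm{Im}\big(\sigma_{\ell_{-X}}^{-1}\sigma_{\ell_X}(r_{\ell_X}+ic_+)\big)$. Set $\lambda_k(T)=T^{-k}/k$ for $k>0$ and $\lambda_0(T)=-\log T$. For a line $\ell\in\{\ell_X,\ell_{-X}\}$ and $c,T>0$ put $$\begin{aligned}R_\ell(c,T)=&\int_c^TG_\ell(r_\ell+iy)y^kdy-a_\ell^+(0)\frac{T^{k+1}}{k+1}+\sum_{n\ne0}a_\ell^+(n)e(nr_\ell)\frac{\Gamma(k+1,2\pi nT)}{(2\pi n)^{k+1}}+a_\ell^-(0)\lambda_k(T)\\&+\sum_{n\ne0}a_\ell^-(n)e(nr_\ell)\Big(\mathcal E_{2k+2}(4\pi nT)\frac{\Gamma(k+1,2\pi nT)}{(2\pi n)^{k+1}}-\frac{2^{-2k-1}k!}{(2\pi n)^{k+1}}\sum_{j=0}^k\frac{(-1)^j}{j!}\mathcal E_{2k+2-j}(2\pi nT)\Big).\end{aligned}$$ The regularized cycle integral is defined, with arbitrary $S_+,S_->0$, by $$\frac1{(2\sqrt{|m|N}\,i)^k\,i}\int_{c(X)}^{\mathrm{reg}}G(z)Q_X^k(z)dz=R_{\ell_X}(c_+,S_+)+(-1)^{k+1}R_{\ell_{-X}}(c_-,S_-).$$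 **Proposition.** Let $G\in H_{2k+2}(\Gamma)$ and let $X$, $c_\pm$ be as above. For all $S_+,S_->0$ used in the definition of the regularized cycle integral, and for all $T_+,T_->0$, $$\frac1{(2\sqrt{|m|N}\,i)^k\,i}\int_{c(X)}^{\mathrm{reg}}G(z)Q_X^k(z)dz=A_{\ell_X}(c_+,T_+)+(-1)^{k+1}A_{\ell_{-X}}(c_-,T_-),$$ where, for $\ell\in\{\ell_X,\ell_{-X}\}$ and with $\alpha=\alpha_\ell$, $r=r_\ell$ and $z=x+iy$ in the line integrals over horizontal segments, $$\begin{aligned}A_\ell(c,T)=&\int_c^TG_\ell(r+iy)y^kdy\\ &+(-1)^k\frac{(i\alpha)^{k+1}}{k+1}\int_{iT/\alpha}^{iT/\alpha+1}\big(G_\ell(r+\alpha z)-a_\ell^-(0)(\alpha y)^{-1-2k}\big)B_{k+1}(z)\,dz\\ &-(-1)^k(i\alpha)^{-k}\frac{2^{2k-1}k!}{(2k+1)!}\overline{\int_{iT/\alpha}^{iT/\alpha+1}\big((\xi_{2k+2}G_\ell)(r+\alpha z)-a_{\xi_{2k+2}G,\ell}(0)\big)\big(\psi^{(k)}(z)+(-1)^k\psi^{(k)}(1-z)\big)dz}\\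 &-(-1)^k(i\alpha)^{-k}\frac{k!}{(2k+1)!}\sum_{d=0}^k\frac{(d+k)!}{(d+1)!}\sum_{j=0}^{k-d}\binom{2k+1}j\\ &\qquad\times\overline{\int_{iT/\alpha}^{iT/\alpha+1}\big((\xi_{2k+2}G_\ell)(r+\alpha z)-a_{\xi_{2k+2}G,\ell}(0)\big)B_{d+1}(x)(-iy)^{-k-d-1}dz}\\ &+a_\ell^-(0)\lambda_k(T).\end{aligned}$$ -/

import Mathlib

open scoped MatrixGroups ModularForm UpperHalfPlane ContDiff Topology

noncomputable section

namespace ShintaniCycle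

/-! ### Harmonic Maass forms -/

/-- Partial derivative in the direction of the real axis. -/
def dX (F : ℂ → ℂ) (z : ℂ) : ℂ := fderiv ℝ F z 1

/-- Partial derivative in the direction of the imaginary axis. -/
def dY (F : ℂ → ℂ) (z : ℂ) : ℂ := fderiv ℝ F z Complex.I

/-- The extension of a function on the upper half-plane to `ℂ` (arbitrary outside of it). -/
def ext (G : ℍ → ℂ) : ℂ → ℂ := fun z => G (UpperHalfPlane.ofComplex z)

/-- The weight `κ` Laplace operator
`-y² (∂²/∂x² + ∂²/∂y²) + i κ y (∂/∂x + i ∂/∂y)`. -/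
def laplace (κ : ℤ) (G : ℍ → ℂ) (z : ℍ) : ℂ :=
  -(z.im : ℂ) ^ 2 * (dX (dX (ext G)) z + dY (dY (ext G)) z)
    + Complex.I * κ * z.im * (dX (ext G) z + Complex.I * dY (ext G) z)

/-- The operator `ξ_κ G = 2 i y^κ conj (∂G/∂z̄)`, where `∂/∂z̄ = (∂/∂x + i ∂/∂y) / 2`. -/
def xi (κ : ℤ) (G : ℍ → ℂ) (z : ℍ) : ℂ :=
  2 * Complex.I * (z.im : ℂ) ^ κ *
    (starRingEnd ℂ) ((dX (ext G) z + Complex.I * dY (ext G) z) / 2)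

/-- Harmonic Maass forms of weight `κ` for `Γ`: smooth, modular of weight `κ`, harmonic for the
weight `κ` Laplace operator, and of at most linear exponential growth at all cusps. -/
structure IsHarmonicMaassForm (Γ : Subgroup SL(2, ℤ)) (κ : ℤ) (G : ℍ → ℂ) : Prop where
  smooth : ContDiffOn ℝ ∞ (ext G) {z : ℂ | 0 < z.im}
  slash_eq : ∀ γ ∈ Γ, G ∣[κ] γ = G
  harmonic : ∀ z : ℍ, laplace κ G z = 0
  growth : ∀ γ : SL(2, ℤ), ∃ A B C : ℝ, ∀ z : ℍ, A ≤ z.im →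
    ‖(G ∣[κ] γ) z‖ ≤ B * Real.exp (C * z.im)

/-! ### Special functions -/

/-- The exponential integral `Ei(y) = -∫_{-y}^∞ e^{-t} dt / t` for `y ≠ 0`, with the Cauchy
principal value at `t = 0` (relevant only if `y > 0`). -/
def expInt (y : ℝ) : ℝ :=
  Filter.limUnder (𝓝[>] (0 : ℝ)) fun ε : ℝ =>
    -∫ t in {t : ℝ | -y < t ∧ ε < |t|}, Real.exp (-t) / t

/-- The function `𝓔_κ(y)`, for `κ ≥ 1` and `y ≠ 0`. -/
def calE (κ : ℕ) (y : ℝ) : ℝ :=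
  (-1) ^ (κ + 1) / (κ - 1).factorial *
    (Real.exp y * ∑ j ∈ Finset.range (κ - 1), (y ^ (j + 1))⁻¹ * j.factorial - expInt y)

/-- The incomplete Gamma function `Γ(s, y) = ∫_y^∞ e^{-t} t^{s-1} dt` at integers `s ≥ 1`, for
every real `y`. -/
def incGamma (s : ℕ) (y : ℝ) : ℝ :=
  ∫ t in Set.Ioi y, Real.exp (-t) * t ^ (s - 1)

/-- The polygamma function `ψ^{(k)}`, the `k`-th derivative of `ψ = Γ' / Γ`. -/
def polygamma (k : ℕ) (z : ℂ) : ℂ := iteratedDeriv k Complex.digamma z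

/-- The Bernoulli polynomial `B_m` at a complex number. -/
def bernoulliPoly (m : ℕ) (z : ℂ) : ℂ := Polynomial.aeval z (Polynomial.bernoulli m)

/-- `e(w) = e^{2πiw}`. -/
def e (w : ℂ) : ℂ := Complex.exp (2 * Real.pi * Complex.I * w)

/-! ### Fourier coefficients -/

/-- `a` and `b` are the coefficients `a⁺` and `a⁻` of a Fourier expansion, of the shape which
harmonic Maass forms of weight `2k+2` have at a cusp of width `α`. The integer `n` belongs to the
frequency `n / α`. -/
structure IsFourierExpansion (k α : ℕ) (G : ℍ → ℂ) (a b : ℤ → ℂ) : Prop where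
  plus_eq_zero : ∃ M : ℤ, ∀ n < M, a n = 0
  minus_eq_zero : ∃ M : ℤ, ∀ n > M, b n = 0
  hasSum : ∀ z : ℍ, HasSum (fun n : ℤ =>
    (a n + b n * (if n = 0 then (z.im ^ (2 * k + 1))⁻¹
      else calE (2 * k + 2) (4 * Real.pi * (n / α) * z.im) : ℝ)) * e (n / α * z)) (G z)

open Classical in
/-- The coefficients `(a⁺, a⁻)` of the (unique) Fourier expansion of `G`. -/
def fourierCoeffs (k α : ℕ) (G : ℍ → ℂ) : (ℤ → ℂ) × (ℤ → ℂ) :=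
  if h : ∃ p : (ℤ → ℂ) × (ℤ → ℂ), IsFourierExpansion k α G p.1 p.2 then h.choose else 0

/-- The constant coefficient `(1/α) ∫_i^{i+α} F(z) dz` of an `α`-periodic holomorphic function
on the upper half-plane. -/
def constCoeff (α : ℕ) (F : ℍ → ℂ) : ℂ :=
  (α : ℂ)⁻¹ * ∫ x in (0 : ℝ)..α, ext F (x + Complex.I)

/-! ### The quadratic space of rational traceless `2 × 2` matrices -/

/-- The quadratic form `Q(X) = N det X`. -/
def Q (N : ℕ) (X : Matrix (Fin 2) (Fin 2) ℚ) : ℚ := N * X.det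

/-- The bilinear form `(X, Y) = -N tr(XY)`. -/
def bilin (N : ℕ) (X Y : Matrix (Fin 2) (Fin 2) ℚ) : ℚ := -N * (X * Y).trace

/-- The action `γ X γ⁻¹`. -/
def conj (γ : SL(2, ℤ)) (X : Matrix (Fin 2) (Fin 2) ℚ) : Matrix (Fin 2) (Fin 2) ℚ :=
  γ.1.map (Int.cast : ℤ → ℚ) * X * (γ⁻¹).1.map (Int.cast : ℤ → ℚ)

/-- The spanning vector `X_∞` of the isotropic line `ℓ_∞`. If `ℓ` is the isotropic line
`γ ℓ_∞`, then `γ X_∞` is a positively oriented element of `ℓ`. -/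
def Xinf : Matrix (Fin 2) (Fin 2) ℚ := !![0, 1; 0, 0]

/-- The determinant of three vectors with respect to the coordinates `(x₂, x₁, x₃)` of
`X = (x₂, x₁; x₃, -x₂)`. -/
def orientDet (X Y Z : Matrix (Fin 2) (Fin 2) ℚ) : ℚ :=
  Matrix.det !![X 0 0, X 0 1, X 1 0; Y 0 0, Y 0 1, Y 1 0; Z 0 0, Z 0 1, Z 1 0]

/-- The orienting basis `X₁(i), X₂(i), X₃(i)` of the quadratic space (up to positive scalars) has
a positive determinant, so a basis is positively oriented iff `orientDet` is positive. -/
theorem orientDet_std :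
    0 < orientDet !![0, 1; -1, 0] !![0, 1; 1, 0] !![1, 0; 0, -1] := by
  simp [orientDet, Matrix.det_fin_three]

/-- `σp ℓ_∞ = ℓ_X` and `σm ℓ_∞ = ℓ_{-X}`: both lines are orthogonal to `X`, and `X` together with
positively oriented elements of `ℓ_X` and `ℓ_{-X}` (in this order) is a positively oriented
basis. -/
structure IsCuspPair (N : ℕ) (X : Matrix (Fin 2) (Fin 2) ℚ) (σp σm : SL(2, ℤ)) : Prop where
  orth_plus : bilin N X (conj σp Xinf) = 0
  orth_minus : bilin N X (conj σm Xinf) = 0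
  oriented : 0 < orientDet X (conj σp Xinf) (conj σm Xinf)

/-- The real part `r` of the geodesic, `σ⁻¹ X = √(|Q(X)|/N) (-1, 2r; 0, 1)` where
`σ ℓ_∞ = ℓ_X`. -/
def realPart (N : ℕ) (X : Matrix (Fin 2) (Fin 2) ℚ) (σ : SL(2, ℤ)) : ℝ :=
  (conj σ⁻¹ X 0 1 : ℝ) / (2 * Real.sqrt ((|Q N X| : ℚ) / N))

/-- `c₋ = Im (σm⁻¹ σp (r + i c))`, where `r` is the real part of the geodesic at `ℓ_X`. -/
def cMinus (N : ℕ) (X : Matrix (Fin 2) (Fin 2) ℚ) (σp σm : SL(2, ℤ)) (c : ℝ) : ℝ :=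
  ((σm⁻¹ * σp) • UpperHalfPlane.ofComplex (realPart N X σp + c * Complex.I)).im

/-- The width of the cusp `σ ∞` of `Γ`: the least `n ≥ 1` such that `σ (1, n; 0, 1) σ⁻¹` lies in
`Γ` up to sign. -/
def cuspWidth (Γ : Subgroup SL(2, ℤ)) (σ : SL(2, ℤ)) : ℕ :=
  sInf {n : ℕ | 0 < n ∧ (σ * ModularGroup.T ^ n * σ⁻¹ ∈ Γ ∨ -(σ * ModularGroup.T ^ n * σ⁻¹) ∈ Γ)}

/-! ### Regularized cycle integrals -/

/-- `T^{-k} / k` for `k > 0`, and `-log T` for `k = 0`. -/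
def constGrowth (k : ℕ) (T : ℝ) : ℝ := if k = 0 then -Real.log T else (T ^ k)⁻¹ / k

/-- The contribution of the cusp `σ ∞` to the regularized cycle integral, where `r` is the real
part of the geodesic. -/
def regHalf (Γ : Subgroup SL(2, ℤ)) (k : ℕ) (G : ℍ → ℂ) (σ : SL(2, ℤ)) (r c T : ℝ) : ℂ :=
  let α : ℕ := cuspWidth Γ σ
  let Gσ : ℍ → ℂ := G ∣[(2 * k + 2 : ℤ)] σ
  let a : ℤ → ℂ := (fourierCoeffs k α Gσ).1
  let b : ℤ → ℂ := (fourierCoeffs k α Gσ).2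
  let w : ℤ → ℝ := fun n => 2 * Real.pi * (n / α)
  (∫ y in c..T, ext Gσ (r + y * Complex.I) * (y : ℂ) ^ k)
    - a 0 * (T ^ (k + 1) / (k + 1) : ℝ)
    + (∑' n : {n : ℤ // n ≠ 0}, a n * e (n / α * r) *
        (incGamma (k + 1) (w n * T) / w n ^ (k + 1) : ℝ))
    + b 0 * constGrowth k T
    + ∑' n : {n : ℤ // n ≠ 0}, b n * e (n / α * r) *
        (calE (2 * k + 2) (2 * (w n * T)) * (incGamma (k + 1) (w n * T) / w n ^ (k + 1))
          - k.factorial / (2 ^ (2 * k + 1) * w n ^ (k + 1)) *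
            ∑ j ∈ Finset.range (k + 1),
              (-1) ^ j / j.factorial * calE (2 * k + 2 - j) (w n * T) : ℝ)

/-- The factor `(2 √(|m| N) i)^k i`, where `m = Q(X)`. -/
def normFactor (N k : ℕ) (X : Matrix (Fin 2) (Fin 2) ℚ) : ℂ :=
  (2 * Real.sqrt ((|Q N X| : ℚ) * N) * Complex.I) ^ k * Complex.I

/-- The regularized cycle integral `∫_{c(X)}^{reg} G(z) Q_X(z)^k dz`, defined with auxiliary
positive numbers `c`, `Tp`, `Tm`. -/
def regCycleIntegral (N : ℕ) (Γ : Subgroup SL(2, ℤ)) (k : ℕ) (G : ℍ → ℂ)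
    (X : Matrix (Fin 2) (Fin 2) ℚ) (σp σm : SL(2, ℤ)) (c Tp Tm : ℝ) : ℂ :=
  normFactor N k X *
    (regHalf Γ k G σp (realPart N X σp) c Tp
      + (-1) ^ (k + 1) *
        regHalf Γ k G σm (realPart N (-X) σm) (cMinus N X σp σm c) Tm)

/-- The line integral `∫_{it}^{it+1} f(z) dz` over a horizontal segment. -/
def segInt (t : ℝ) (f : ℂ → ℂ) : ℂ := ∫ x in (0 : ℝ)..1, f (x + t * Complex.I)

/-- The contribution of the cusp `σ ∞` to the alternative formula for the regularized cycle
integral, where `r` is the real part of the geodesic. -/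
def altHalf (Γ : Subgroup SL(2, ℤ)) (k : ℕ) (G : ℍ → ℂ) (σ : SL(2, ℤ)) (r c T : ℝ) : ℂ :=
  let α : ℕ := cuspWidth Γ σ
  let Gσ : ℍ → ℂ := G ∣[(2 * k + 2 : ℤ)] σ
  let b₀ : ℂ := (fourierCoeffs k α Gσ).2 0
  let ξG : ℍ → ℂ := xi (2 * k + 2) Gσ
  let ξa₀ : ℂ := constCoeff α ((xi (2 * k + 2) G) ∣[(-(2 * k) : ℤ)] σ)
  (∫ y in c..T, ext Gσ (r + y * Complex.I) * (y : ℂ) ^ k)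
    + (-1) ^ k * ((Complex.I * α) ^ (k + 1) / (k + 1)) *
        segInt (T / α) (fun z =>
          (ext Gσ (r + α * z) - b₀ * (((α * z.im) ^ (2 * k + 1))⁻¹ : ℝ)) * bernoulliPoly (k + 1) z)
    - (-1) ^ k * ((Complex.I * α) ^ k)⁻¹ *
        ((2 : ℂ) ^ (2 * (k : ℤ) - 1) * k.factorial / (2 * k + 1).factorial) *
        (starRingEnd ℂ) (segInt (T / α) (fun z =>
          (ext ξG (r + α * z) - ξa₀) * (polygamma k z + (-1) ^ k * polygamma k (1 - z))))
    - (-1) ^ k * ((Complex.I * α) ^ k)⁻¹ * ((k.factorial : ℂ) / (2 * k + 1).factorial) *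
        ∑ d ∈ Finset.range (k + 1), ((d + k).factorial : ℂ) / (d + 1).factorial *
          (∑ j ∈ Finset.range (k - d + 1), ((2 * k + 1).choose j : ℂ)) *
          (starRingEnd ℂ) (segInt (T / α) (fun z =>
            (ext ξG (r + α * z) - ξa₀) * bernoulliPoly (d + 1) z.re *
              ((-Complex.I * z.im) ^ (k + d + 1))⁻¹))
    + b₀ * constGrowth k T

end ShintaniCycle

end

namespace ShintaniCycle

open MeasureTheory Filter Set

/-! ### The exponential integral -/

/-! The normalizing factor cancels, so each cusp can be treated alone: `regHalf` at height S equals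
`altHalf` at height T for all positive S and T (`regHalf_eq_altHalf`).

Fourier expansion. Put g = G|σ. Harmonicity makes ξg holomorphic, so its Fourier coefficients do not
depend on the height. Hence the n-th coefficient of g, as a function of the height, solves an
explicit first-order equation with solution a⁺(n) + a⁻(n)·𝓔, and ξg minus its constant term has
coefficients (4πn/α)^(-1-2k) times the conjugate of a⁻(n). The growth condition truncates both
sequences (`isFourierExpansion_fourierCoeffs`).

Independence of the height. For n ≠ 0 the regularizing term `regTerm` is an antiderivative in T of
minus the n-th Fourier term times T^k (`hasDerivAt_regTerm`). It works because Γ(k+1, u) is k!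
e^(-u) times a truncated exponential series, exactly what the sum of the derivatives of the 𝓔
functions produces. The constant terms have their own antiderivatives. Summing over n
(`hasSum_regTerm_sub`), a change of height only moves a piece of the vertical integral into the
regularizing sum.

Evaluation at height T. The sum of the `regTerm` is a combination of horizontal integrals
(`hasSum_regTerm`), obtained by integrating a Fourier series termwise against a non-periodic kernel.
`bernoulliPoly (k + 1)` produces the incomplete Gamma functions (`segInt_e_mul_bernoulliPoly`). The
remaining part `regTail` comes from conjugated integrals of ξg: the symmetrized polygamma function
gives Ei and the first k inverse powers (`segInt_e_mul_symPolygamma`), and Bernoulli polynomials in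
x alone give the higher inverse powers. The finite identity `sum_calE_eq` matches the coefficients,
which yields `regTail_eq`.

The delicate point is the digamma case. Cauchy's theorem on a rectangle gives the integral up to a
constant. For n < 0 the constant is found by letting the height tend to infinity; for n > 0 by
comparing the indices n and -n as the height tends to zero. -/

theorem integrableOn_exp_neg_div {a : ℝ} (ha : 0 < a) :
    IntegrableOn (fun t : ℝ => Real.exp (-t) / t) (Ioi a) := by
  have h1 : IntegrableOn (fun t : ℝ => a⁻¹ * Real.exp (-t)) (Ioi a) :=
    (integrableOn_exp_neg_Ioi a).const_mul _
  refine Integrable.mono' h1 ?_ ?_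
  · refine ContinuousOn.aestronglyMeasurable ?_ measurableSet_Ioi
    exact ContinuousOn.div (by fun_prop) continuousOn_id fun x hx => (ha.trans hx).ne'
  · refine (ae_restrict_iff' measurableSet_Ioi).2 (Eventually.of_forall fun t ht => ?_)
    have ht0 : 0 < t := ha.trans ht
    rw [Real.norm_of_nonneg (by positivity), div_eq_inv_mul]
    gcongr
    exact le_of_lt ht

theorem hasDerivAt_integral_Ioi {φ : ℝ → ℝ} {a b : ℝ} (hb : b < a)
    (hφ : ContinuousOn φ (Ioi b)) (hint : IntegrableOn φ (Ioi b)) :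
    HasDerivAt (fun x => ∫ t in Ioi x, φ t) (-φ a) a := by
  obtain ⟨c, hbc, hca⟩ := exists_between hb
  have hintc : IntegrableOn φ (Ioi c) := hint.mono_set (Ioi_subset_Ioi hbc.le)
  have h1 : ∀ x ∈ Ioi c, ∫ t in Ioi x, φ t = (∫ t in Ioi c, φ t) - ∫ t in c..x, φ t := by
    intro x hx
    rw [← intervalIntegral.integral_interval_add_Ioi
      (a := c) (b := x) hintc (hintc.mono_set (Ioi_subset_Ioi (le_of_lt hx)))]
    ring
  have h2 : HasDerivAt (fun x => ∫ t in c..x, φ t) (φ a) a := by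
    refine intervalIntegral.integral_hasDerivAt_right ?_ ?_ ?_
    · refine ContinuousOn.intervalIntegrable (hφ.mono ?_)
      rw [uIcc_of_le hca.le]
      exact fun t ht => hbc.trans_le ht.1
    · exact hφ.stronglyMeasurableAtFilter isOpen_Ioi a hb
    · exact hφ.continuousAt (Ioi_mem_nhds hb)
  refine (h2.const_sub (∫ t in Ioi c, φ t)).congr_of_eventuallyEq ?_
  filter_upwards [Ioi_mem_nhds hca] with x hx using h1 x hx

/-- Once ε < -y, the excluded neighbourhood of 0 misses the domain of integration, so the principal
value is a limit of an eventually constant function. -/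
theorem expInt_of_neg {y : ℝ} (hy : y < 0) :
    expInt y = -∫ t in Ioi (-y), Real.exp (-t) / t := by
  refine Tendsto.limUnder_eq (tendsto_const_nhds.congr' ?_)
  have : Iio (-y) ∈ 𝓝[>] (0 : ℝ) := mem_nhdsWithin_of_mem_nhds (Iio_mem_nhds (by linarith))
  filter_upwards [this] with ε hε
  congr 3
  ext t
  simp only [mem_ofPred_eq, mem_Ioi, mem_Iio] at *
  exact ⟨fun h => ⟨h, hε.trans (h.trans_le (le_abs_self t))⟩, fun h => h.1⟩

/-- The continuous extension of `(e^s - e^{-s}) / s`. -/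
noncomputable def sinhc (s : ℝ) : ℝ := dslope (fun s => Real.exp s - Real.exp (-s)) 0 s

theorem continuous_sinhc : Continuous sinhc := by
  have hd : Differentiable ℝ (fun s => Real.exp s - Real.exp (-s)) := by fun_prop
  rw [continuous_iff_continuousAt]
  intro x
  rcases eq_or_ne x 0 with rfl | hx
  · exact continuousAt_dslope_same.2 (hd 0)
  · exact (continuousAt_dslope_of_ne hx).2 (hd x).continuousAt

theorem sinhc_of_ne {s : ℝ} (hs : s ≠ 0) : sinhc s = Real.exp s / s - Real.exp (-s) / s := by
  rw [sinhc, dslope_of_ne _ hs, slope_def_field]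
  simp
  ring

/-- Reflecting the part over (-y, -ε) onto (ε, y) pairs the two singular contributions; their
combination (e^s - e^(-s))/s is continuous at 0, so the limit can be taken. -/
theorem expInt_of_pos {y : ℝ} (hy : 0 < y) :
    expInt y = expInt (-y) + ∫ s in (0 : ℝ)..y, sinhc s := by
  have hc : Tendsto (fun ε : ℝ => expInt (-y) + ∫ s in ε..y, sinhc s) (𝓝[>] 0)
      (𝓝 (expInt (-y) + ∫ s in (0 : ℝ)..y, sinhc s)) := by
    refine Tendsto.mono_left (Continuous.tendsto ?_ 0) nhdsWithin_le_nhds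
    refine continuous_const.add ?_
    have : (fun ε : ℝ => ∫ s in ε..y, sinhc s) = fun ε => -∫ s in y..ε, sinhc s := by
      funext ε; exact intervalIntegral.integral_symm _ _
    rw [this]
    exact (intervalIntegral.continuous_primitive (μ := volume)
      (fun a b => continuous_sinhc.intervalIntegrable a b) y).neg
  refine Tendsto.limUnder_eq (hc.congr' ?_)
  have hy' : Iio y ∈ 𝓝[>] (0 : ℝ) := mem_nhdsWithin_of_mem_nhds (Iio_mem_nhds hy)
  filter_upwards [hy', self_mem_nhdsWithin] with ε hε hε0
  simp only [mem_Iio, mem_Ioi] at hε hε0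
  have hset : {t : ℝ | -y < t ∧ ε < |t|} = Ioo (-y) (-ε) ∪ Ioi ε := by
    ext t
    simp only [mem_ofPred_eq, mem_union, mem_Ioo, mem_Ioi, lt_abs]
    constructor
    · rintro ⟨h1, h2 | h2⟩
      · exact Or.inr h2
      · exact Or.inl ⟨h1, by linarith⟩
    · rintro (⟨h1, h2⟩ | h)
      · exact ⟨h1, Or.inr (by linarith)⟩
      · exact ⟨by linarith, Or.inl h⟩
  have hcont : ContinuousOn (fun t : ℝ => Real.exp (-t) / t) (Icc (-y) (-ε)) :=
    ContinuousOn.div (by fun_prop) continuousOn_id fun x hx => by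
      have := hx.2
      linarith
  have hcont2 : ContinuousOn (fun t : ℝ => Real.exp (-t) / t) (uIcc ε y) :=
    ContinuousOn.div (by fun_prop) continuousOn_id fun x hx => by
      rw [uIcc_of_le hε.le] at hx
      exact (hε0.trans_le hx.1).ne'
  have hcont3 : ContinuousOn (fun t : ℝ => Real.exp t / t) (uIcc ε y) :=
    ContinuousOn.div (by fun_prop) continuousOn_id fun x hx => by
      rw [uIcc_of_le hε.le] at hx
      exact (hε0.trans_le hx.1).ne'
  have hcomp := intervalIntegral.integral_comp_neg (a := ε) (b := y)
    (fun t : ℝ => Real.exp (-t) / t)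
  rw [hset, setIntegral_union _ measurableSet_Ioi
      (hcont.integrableOn_Icc.mono_set Ioo_subset_Icc_self) (integrableOn_exp_neg_div hε0),
    ← integral_Ioc_eq_integral_Ioo, ← intervalIntegral.integral_of_le (by linarith), ← hcomp,
    expInt_of_neg (by linarith : -y < 0), neg_neg,
    ← intervalIntegral.integral_interval_add_Ioi (integrableOn_exp_neg_div hε0)
      (integrableOn_exp_neg_div hy)]
  · have : ∫ s in ε..y, sinhc s = (∫ s in ε..y, Real.exp s / s) - ∫ s in ε..y, Real.exp (-s) / s := by
      rw [← intervalIntegral.integral_sub hcont3.intervalIntegrable hcont2.intervalIntegrable]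
      refine intervalIntegral.integral_congr fun s hs => ?_
      rw [uIcc_of_le hε.le] at hs
      exact sinhc_of_ne (hε0.trans_le hs.1).ne'
    rw [this]
    simp only [neg_neg, div_neg, intervalIntegral.integral_neg]
    ring
  · refine Set.disjoint_left.2 fun t h1 h2 => ?_
    have := h1.2
    simp only [mem_Ioi] at h2
    linarith

theorem hasDerivAt_expInt {y : ℝ} (hy : y ≠ 0) : HasDerivAt expInt (Real.exp y / y) y := by
  have key : ∀ y : ℝ, y < 0 → HasDerivAt expInt (Real.exp y / y) y := by
    intro y hy
    have h0 : (0 : ℝ) < -y / 2 := by linarith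
    have h := hasDerivAt_integral_Ioi (φ := fun t => Real.exp (-t) / t) (a := -y) (b := -y / 2)
      (by linarith) (ContinuousOn.div (by fun_prop) continuousOn_id
        fun x hx => (h0.trans hx).ne') (integrableOn_exp_neg_div h0)
    have h2 := (h.scomp y (hasDerivAt_neg y)).neg
    refine (h2.congr_deriv ?_).congr_of_eventuallyEq ?_
    · simp [div_neg]
    · filter_upwards [Iio_mem_nhds hy] with x hx using expInt_of_neg hx
  rcases hy.lt_or_gt with hy | hy
  · exact key y hy
  · have h1 := ((key (-y) (by linarith)).scomp y (hasDerivAt_neg y)).add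
      (continuous_sinhc.integral_hasStrictDerivAt 0 y).hasDerivAt
    refine (h1.congr_deriv ?_).congr_of_eventuallyEq ?_
    · rw [sinhc_of_ne hy.ne']
      simp [div_neg]
    · filter_upwards [Ioi_mem_nhds hy] with x hx using expInt_of_pos hx

theorem tendsto_expInt_atBot : Tendsto expInt atBot (𝓝 0) := by
  have h1 : Tendsto (fun y : ℝ => Real.exp y) atBot (𝓝 0) := Real.tendsto_exp_atBot
  refine squeeze_zero_norm' ?_ h1
  filter_upwards [Iic_mem_atBot (-1 : ℝ)] with y hy
  simp only [mem_Iic] at hy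
  rw [expInt_of_neg (by linarith), norm_neg]
  have h2 : ∫ t in Ioi (-y), Real.exp (-t) = Real.exp y := by
    rw [integral_exp_neg_Ioi, neg_neg]
  rw [← h2]
  refine norm_integral_le_of_norm_le (integrableOn_exp_neg_Ioi _) ?_
  refine (ae_restrict_iff' measurableSet_Ioi).2 (Eventually.of_forall fun t ht => ?_)
  simp only [mem_Ioi] at ht
  have ht0 : 1 ≤ t := by linarith
  rw [Real.norm_of_nonneg (by positivity)]
  exact div_le_self (Real.exp_pos _).le ht0

/-- The logarithmic singularities on the two sides of 0 cancel. This fixes the integration constant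
for positive frequencies in `segInt_e_mul_symPolygamma_zero`. -/
theorem tendsto_expInt_sub_expInt_neg :
    Tendsto (fun y => expInt y - expInt (-y)) (𝓝[>] 0) (𝓝 0) := by
  have hc : Tendsto (fun y : ℝ => ∫ s in (0 : ℝ)..y, sinhc s) (𝓝[>] 0) (𝓝 0) := by
    have := (intervalIntegral.continuous_primitive (μ := volume)
      (fun a b => continuous_sinhc.intervalIntegrable a b) 0).tendsto 0
    rw [intervalIntegral.integral_same] at this
    exact this.mono_left nhdsWithin_le_nhds
  refine hc.congr' ?_
  filter_upwards [self_mem_nhdsWithin] with y hy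
  rw [expInt_of_pos hy]
  ring

/-! ### The function `𝓔_κ` -/

/-- The sum telescopes: differentiating the j-th inverse power cancels the exponential derivative of
the next one. -/
theorem hasDerivAt_exp_mul_sum (n : ℕ) {y : ℝ} (hy : y ≠ 0) :
    HasDerivAt (fun y => Real.exp y * ∑ j ∈ Finset.range n, (y ^ (j + 1))⁻¹ * j.factorial)
      (Real.exp y / y - Real.exp y * n.factorial * (y ^ (n + 1))⁻¹) y := by
  induction n with
  | zero =>
    simp only [Finset.range_zero, Finset.sum_empty, mul_zero]
    refine (hasDerivAt_const y (0 : ℝ)).congr_deriv ?_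
    simp
    ring
  | succ n ih =>
    simp only [Finset.sum_range_succ, mul_add]
    have h1 : HasDerivAt (fun y : ℝ => Real.exp y * ((y ^ (n + 1))⁻¹ * n.factorial)) _ y :=
      (Real.hasDerivAt_exp y).mul
        (((hasDerivAt_pow (n + 1) y).inv (pow_ne_zero _ hy)).mul_const _)
    refine (ih.add h1).congr_deriv ?_
    rw [Nat.factorial_succ]
    push_cast
    field_simp
    ring

/-- The term e^y / y left by the telescoping sum is the derivative of `expInt`, so a single inverse
power survives. -/
theorem hasDerivAt_calE {κ : ℕ} (hκ : 1 ≤ κ) {y : ℝ} (hy : y ≠ 0) :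
    HasDerivAt (calE κ) ((-1) ^ κ * Real.exp y * (y ^ κ)⁻¹) y := by
  obtain ⟨n, rfl⟩ : ∃ n, κ = n + 1 := ⟨κ - 1, by omega⟩
  have h := ((hasDerivAt_exp_mul_sum n hy).sub (hasDerivAt_expInt hy)).const_mul
    ((-1 : ℝ) ^ (n + 1 + 1) / n.factorial)
  have he : calE (n + 1) = fun y : ℝ => (-1 : ℝ) ^ (n + 1 + 1) / n.factorial *
      (Real.exp y * ∑ j ∈ Finset.range n, (y ^ (j + 1))⁻¹ * j.factorial - expInt y) := by
    funext y; simp [calE]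
  rw [he]
  refine h.congr_deriv ?_
  have : (n.factorial : ℝ) ≠ 0 := by positivity
  field_simp
  ring

theorem tendsto_calE_atBot (κ : ℕ) : Tendsto (calE κ) atBot (𝓝 0) := by
  have h1 : Tendsto (fun y : ℝ => Real.exp y * ∑ j ∈ Finset.range (κ - 1),
      (y ^ (j + 1))⁻¹ * (j.factorial : ℝ)) atBot (𝓝 (0 * ∑ j ∈ Finset.range (κ - 1), 0)) := by
    refine Real.tendsto_exp_atBot.mul (tendsto_finsetSum _ fun j _ => ?_)
    have : Tendsto (fun y : ℝ => (y⁻¹) ^ (j + 1) * (j.factorial : ℝ)) atBot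
        (𝓝 (0 ^ (j + 1) * (j.factorial : ℝ))) :=
      ((tendsto_inv_atBot_zero).pow _).mul_const _
    simpa using this
  have h2 := (h1.sub tendsto_expInt_atBot).const_mul ((-1 : ℝ) ^ (κ + 1) / (κ - 1).factorial)
  show Tendsto (fun y => calE κ y) _ _
  simpa [calE] using h2

/-- For an even index `calE` increases on the positive axis, and the mean value theorem on [y - 1,
y] bounds its increment below by e^(y-1) y^(-κ). Thus it outgrows e^(δy) for every δ < 1. -/
theorem tendsto_calE_mul_exp_atTop (m : ℕ) {δ : ℝ} (hδ0 : 0 ≤ δ) (hδ : δ < 1) :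
    Tendsto (fun y => calE (2 * m + 2) y * Real.exp (-(δ * y))) atTop atTop := by
  set κ := 2 * m + 2 with hκ
  have hd : ∀ y : ℝ, 0 < y → HasDerivAt (calE κ) (Real.exp y * (y ^ κ)⁻¹) y := by
    intro y hy
    refine (hasDerivAt_calE (by omega) hy.ne').congr_deriv ?_
    rw [hκ, Even.neg_one_pow ⟨m + 1, by ring⟩, one_mul]
  have hmono : MonotoneOn (calE κ) (Ioi 0) := by
    refine monotoneOn_of_hasDerivWithinAt_nonneg (convex_Ioi 0)
      (fun y hy => (hd y hy).continuousAt.continuousWithinAt)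
      (fun y hy => (hd y (interior_subset hy)).hasDerivWithinAt) fun y hy => ?_
    have : (0 : ℝ) < y := interior_subset hy
    positivity
  have hlow : ∀ y : ℝ, 2 < y →
      -|calE κ 1| + Real.exp (-1) * (Real.exp ((1 - δ) * y) / y ^ (κ : ℝ)) ≤
        calE κ y * Real.exp (-(δ * y)) := by
    intro y hy
    obtain ⟨c, ⟨hc1, hc2⟩, hc⟩ := exists_hasDerivAt_eq_slope (calE κ)
      (fun y => Real.exp y * (y ^ κ)⁻¹) (show y - 1 < y by linarith)
      (fun x hx => (hd x (by linarith [hx.1])).continuousAt.continuousWithinAt)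
      (fun x hx => hd x (by linarith [hx.1]))
    have hc0 : 0 < c := by linarith
    have h1 : calE κ 1 ≤ calE κ (y - 1) :=
      hmono (mem_Ioi.2 one_pos) (mem_Ioi.2 (by linarith)) (by linarith)
    have h2 : Real.exp (y - 1) * (y ^ κ)⁻¹ ≤ Real.exp c * (c ^ κ)⁻¹ := by gcongr
    have h3 : calE κ 1 + Real.exp (y - 1) * (y ^ κ)⁻¹ ≤ calE κ y := by
      have : y - (y - 1) = 1 := by ring
      rw [this, div_one] at hc
      linarith
    have h4 : Real.exp (-(δ * y)) ≤ 1 := by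
      rw [Real.exp_le_one_iff]
      have : 0 ≤ δ * y := mul_nonneg hδ0 (by linarith)
      linarith
    have h5 := mul_le_mul_of_nonneg_right h3 (Real.exp_pos (-(δ * y))).le
    have h6 : -|calE κ 1| ≤ calE κ 1 * Real.exp (-(δ * y)) := by
      rw [← abs_neg, neg_le]
      calc -(calE κ 1 * Real.exp (-(δ * y))) ≤ |calE κ 1 * Real.exp (-(δ * y))| := neg_le_abs _
        _ = |calE κ 1| * Real.exp (-(δ * y)) := by rw [abs_mul, Real.abs_exp]
        _ ≤ |calE κ 1| * 1 := by gcongr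
        _ = |-calE κ 1| := by rw [mul_one, abs_neg]
    have h7 : Real.exp (y - 1) * (y ^ κ)⁻¹ * Real.exp (-(δ * y)) =
        Real.exp (-1) * (Real.exp ((1 - δ) * y) / y ^ (κ : ℝ)) := by
      rw [Real.rpow_natCast, div_eq_mul_inv, ← mul_assoc, ← Real.exp_add, mul_right_comm,
        ← Real.exp_add]
      congr 2
      ring
    rw [← h7]
    linarith
  refine tendsto_atTop_mono' _ (eventually_gt_atTop 2 |>.mono hlow) ?_
  exact tendsto_atTop_add_const_left _ _
    ((tendsto_exp_mul_div_rpow_atTop _ _ (by linarith)).const_mul_atTop (Real.exp_pos _))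

/-! ### The incomplete Gamma function -/

theorem hasDerivAt_exp_neg_mul_sum (s : ℕ) (t : ℝ) :
    HasDerivAt (fun t : ℝ =>
      -(s.factorial * Real.exp (-t) * ∑ j ∈ Finset.range (s + 1), t ^ j / j.factorial))
      (Real.exp (-t) * t ^ s) t := by
  have key : ∀ s : ℕ, HasDerivAt (fun t : ℝ =>
      Real.exp (-t) * ∑ j ∈ Finset.range (s + 1), t ^ j / j.factorial)
      (-(Real.exp (-t) * t ^ s / s.factorial)) t := by
    intro s
    have he : HasDerivAt (fun t : ℝ => Real.exp (-t)) (-Real.exp (-t)) t := by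
      simpa using (hasDerivAt_neg t).exp
    induction s with
    | zero => simpa using he
    | succ s ih =>
      simp only [Finset.sum_range_succ _ (s + 1), mul_add]
      refine (ih.add (he.mul ((hasDerivAt_pow (s + 1) t).div_const _))).congr_deriv ?_
      rw [Nat.factorial_succ]
      push_cast
      have : (s.factorial : ℝ) ≠ 0 := by positivity
      field_simp
      ring
  have h := ((key s).const_mul (s.factorial : ℝ)).neg
  have h0 : (s.factorial : ℝ) ≠ 0 := by positivity
  refine (h.congr_deriv ?_).congr_of_eventuallyEq (Eventually.of_forall fun t => ?_)
  · field_simp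
  · simp only [Pi.neg_apply]; ring

theorem integrableOn_exp_neg_mul_pow (s : ℕ) (y : ℝ) :
    IntegrableOn (fun t : ℝ => Real.exp (-t) * t ^ s) (Ioi y) := by
  refine integrable_of_isBigO_exp_neg (b := 1 / 2) (by norm_num) (by fun_prop) ?_
  have h := (isLittleO_pow_exp_pos_mul_atTop s (b := 1 / 2) (by norm_num)).isBigO
  refine ((Asymptotics.isBigO_refl (fun t : ℝ => Real.exp (-t)) atTop).mul h).congr_right
    fun t => ?_
  rw [← Real.exp_add]
  congr 1
  ring

/-- The integrand has an elementary antiderivative on all of ℝ, so the closed form also covers the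
negative arguments that occur for negative frequencies. -/
theorem incGamma_succ_eq (s : ℕ) (y : ℝ) :
    incGamma (s + 1) y =
      s.factorial * Real.exp (-y) * ∑ j ∈ Finset.range (s + 1), y ^ j / j.factorial := by
  have ht : Tendsto (fun t : ℝ =>
      -(s.factorial * Real.exp (-t) * ∑ j ∈ Finset.range (s + 1), t ^ j / j.factorial)) atTop
      (𝓝 (-(s.factorial * ∑ j ∈ Finset.range (s + 1), 0 / (j.factorial : ℝ)))) := by
    have : (fun t : ℝ =>
        -(s.factorial * Real.exp (-t) * ∑ j ∈ Finset.range (s + 1), t ^ j / j.factorial)) =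
        fun t : ℝ => -(s.factorial *
          ∑ j ∈ Finset.range (s + 1), t ^ j * Real.exp (-t) / j.factorial) := by
      funext t
      rw [mul_assoc, Finset.mul_sum]
      congr 2
      refine Finset.sum_congr rfl fun j _ => ?_
      ring
    rw [this]
    exact ((tendsto_finsetSum _ fun j _ =>
      (Real.tendsto_pow_mul_exp_neg_atTop_nhds_zero j).div_const _).const_mul _).neg
  have h := integral_Ioi_of_hasDerivAt_of_tendsto (a := y)
    (hasDerivAt_exp_neg_mul_sum s y).continuousAt.continuousWithinAt
    (fun t _ => hasDerivAt_exp_neg_mul_sum s t) (integrableOn_exp_neg_mul_pow s y) ht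
  simp only [incGamma, Nat.add_sub_cancel]
  rw [h]
  simp

theorem hasDerivAt_incGamma_succ (s : ℕ) (y : ℝ) :
    HasDerivAt (incGamma (s + 1)) (-(Real.exp (-y) * y ^ s)) y := by
  refine (hasDerivAt_exp_neg_mul_sum s y).neg.congr_of_eventuallyEq
    (Eventually.of_forall fun t => ?_)
  simp only [Pi.neg_apply, neg_neg]
  exact incGamma_succ_eq s t

/-! ### The polygamma functions -/

theorem Gamma_inv_ne_zero {z : ℂ} (hz : ∀ m : ℕ, z ≠ -m) : (Complex.Gamma z)⁻¹ ≠ 0 :=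
  inv_ne_zero (Complex.Gamma_ne_zero hz)

theorem eventually_ne_neg_natCast {z : ℂ} (hz : ∀ m : ℕ, z ≠ -m) :
    ∀ᶠ w : ℂ in 𝓝 z, ∀ m : ℕ, w ≠ -m := by
  have h := Complex.differentiable_one_div_Gamma.continuous.continuousAt.eventually_ne
    (Gamma_inv_ne_zero hz)
  filter_upwards [h] with w hw m hm
  exact hw (by rw [hm, Complex.Gamma_neg_nat_eq_zero, inv_zero])

/-- Analyticity of Γ is read off from the entire function 1/Γ, which does not vanish at `z`. -/
theorem analyticAt_digamma {z : ℂ} (hz : ∀ m : ℕ, z ≠ -m) :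
    AnalyticAt ℂ Complex.digamma z := by
  have hg : AnalyticAt ℂ Complex.Gamma z := by
    have h := (Complex.differentiable_one_div_Gamma.analyticAt z).inv (Gamma_inv_ne_zero hz)
    exact h.congr (Eventually.of_forall fun w => inv_inv _)
  exact hg.deriv.div hg (Complex.Gamma_ne_zero hz)

theorem analyticAt_polygamma (k : ℕ) {z : ℂ} (hz : ∀ m : ℕ, z ≠ -m) :
    AnalyticAt ℂ (polygamma k) z :=
  (analyticAt_digamma hz).iterated_deriv k |>.congr
    (Eventually.of_forall fun w => by rw [← iteratedDeriv_eq_iterate, polygamma])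

theorem hasDerivAt_polygamma (k : ℕ) {z : ℂ} (hz : ∀ m : ℕ, z ≠ -m) :
    HasDerivAt (polygamma k) (polygamma (k + 1) z) z := by
  have h := (analyticAt_polygamma k hz).differentiableAt.hasDerivAt
  rwa [show deriv (polygamma k) z = polygamma (k + 1) z by
    simp only [polygamma, iteratedDeriv_succ]; rfl] at h

theorem polygamma_zero : polygamma 0 = Complex.digamma := by
  funext z; simp [polygamma]

theorem polygamma_add_one (k : ℕ) {z : ℂ} (hz : ∀ m : ℕ, z ≠ -m) :
    polygamma k (z + 1) = polygamma k z + (-1) ^ k * k.factorial * (z ^ (k + 1))⁻¹ := by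
  have hz1 : ∀ {z : ℂ}, (∀ m : ℕ, z ≠ -m) → ∀ m : ℕ, z + 1 ≠ -m := by
    intro z hz m hm
    refine hz (m + 1) ?_
    push_cast
    linear_combination hm
  induction k generalizing z with
  | zero =>
    rw [polygamma_zero, Complex.digamma_apply_add_one z hz]
    simp
  | succ k ih =>
    have hz0 : z ≠ 0 := by simpa using hz 0
    have h1 : HasDerivAt (fun w => polygamma k (w + 1)) (polygamma (k + 1) (z + 1)) z :=
      (hasDerivAt_polygamma k (hz1 hz)).comp_add_const z 1
    have h2 := (hasDerivAt_polygamma k hz).add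
      (((hasDerivAt_pow (k + 1) z).inv (pow_ne_zero _ hz0)).const_mul
        ((-1 : ℂ) ^ k * k.factorial))
    have h3 := h2.congr_of_eventuallyEq
      ((eventually_ne_neg_natCast hz).mono fun w hw => ih hw)
    rw [h1.unique h3, Nat.factorial_succ]
    push_cast
    field_simp
    ring

theorem ne_neg_natCast_of_im_ne_zero {z : ℂ} (hz : z.im ≠ 0) (m : ℕ) : z ≠ -m := by
  rintro rfl; simp at hz

theorem ne_neg_natCast_of_re_pos {z : ℂ} (hz : 0 < z.re) (m : ℕ) : z ≠ -m := by
  rintro rfl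
  simp at hz
  have : (0 : ℝ) ≤ m := m.cast_nonneg
  linarith

/-- The function `ψ^{(k)}(z) + (-1)^k ψ^{(k)}(1 - z)`. -/
noncomputable def symPolygamma (k : ℕ) (z : ℂ) : ℂ :=
  polygamma k z + (-1) ^ k * polygamma k (1 - z)

theorem hasDerivAt_symPolygamma (k : ℕ) {z : ℂ} (hz : z.im ≠ 0) :
    HasDerivAt (symPolygamma k) (symPolygamma (k + 1) z) z := by
  have h1 := hasDerivAt_polygamma k (ne_neg_natCast_of_im_ne_zero hz)
  have hz' : (1 - z).im ≠ 0 := by simpa using hz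
  have h2 : HasDerivAt (fun z => polygamma k (1 - z)) _ z :=
    HasDerivAt.comp_const_sub 1 z (hasDerivAt_polygamma k (ne_neg_natCast_of_im_ne_zero hz'))
  refine (h1.add (h2.const_mul ((-1) ^ k))).congr_deriv ?_
  rw [symPolygamma]
  ring

/-- The functional equation at z and at -z gives the same jump for both summands, the sign (-1)^k
compensating the reflection; hence the factor 2. -/
theorem symPolygamma_add_one (k : ℕ) {z : ℂ} (hz : z.im ≠ 0) :
    symPolygamma k (z + 1) =
      symPolygamma k z + 2 * ((-1) ^ k * k.factorial * (z ^ (k + 1))⁻¹) := by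
  have hz' : (-z).im ≠ 0 := by simpa using hz
  have h1 := polygamma_add_one k (ne_neg_natCast_of_im_ne_zero hz)
  have h2 := polygamma_add_one k (ne_neg_natCast_of_im_ne_zero hz')
  rw [show -z + 1 = 1 - z by ring] at h2
  rw [symPolygamma, symPolygamma, h1, show 1 - (z + 1) = -z by ring, h2,
    neg_pow z (k + 1), mul_inv, ← inv_pow (-1 : ℂ), show ((-1 : ℂ)⁻¹) = -1 by norm_num]
  have : ((-1 : ℂ) ^ k) * (-1) ^ k = 1 := by rw [← mul_pow]; simp
  linear_combination (2 * (-1 : ℂ) ^ k * k.factorial * (z ^ (k + 1))⁻¹ -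
    (-1 : ℂ) ^ k * k.factorial * (z ^ (k + 1))⁻¹) * this

/-! ### Growth of the digamma function -/

theorem norm_Gamma_le {z : ℂ} (hz : 0 < z.re) : ‖Complex.Gamma z‖ ≤ Real.Gamma z.re := by
  rw [Complex.Gamma_eq_integral hz, Real.Gamma_eq_integral hz, Complex.GammaIntegral]
  refine norm_integral_le_of_norm_le (Real.GammaIntegral_convergent hz) ?_
  refine (ae_restrict_iff' measurableSet_Ioi).2 (Eventually.of_forall fun x hx => ?_)
  rw [norm_mul, Complex.norm_cpow_eq_rpow_re_of_pos hx, Complex.norm_real,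
    Real.norm_of_nonneg (Real.exp_pos _).le]
  simp

theorem exists_norm_Gamma_le :
    ∃ M : ℝ, 0 < M ∧ ∀ z : ℂ, 1 / 2 ≤ z.re → z.re ≤ 5 / 2 → ‖Complex.Gamma z‖ ≤ M := by
  have hc : ContinuousOn Real.Gamma (Icc (1 / 2 : ℝ) (5 / 2)) := fun x hx =>
    (Real.differentiableAt_Gamma fun m => by
      have : (0 : ℝ) ≤ m := m.cast_nonneg
      have := hx.1
      intro h
      linarith).continuousAt.continuousWithinAt
  obtain ⟨M, hM⟩ := isCompact_Icc.exists_bound_of_continuousOn hc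
  refine ⟨max M 1, by positivity, fun z h1 h2 => ?_⟩
  refine (norm_Gamma_le (by linarith)).trans (le_max_of_le_left ?_)
  exact (le_abs_self _).trans (hM z.re ⟨h1, h2⟩)

theorem norm_sin_le (z : ℂ) : ‖Complex.sin z‖ ≤ Real.exp |z.im| := by
  have h1 : ‖Complex.exp (-z * Complex.I)‖ ≤ Real.exp |z.im| := by
    rw [Complex.norm_exp]; simp [le_abs_self]
  have h2 : ‖Complex.exp (z * Complex.I)‖ ≤ Real.exp |z.im| := by
    rw [Complex.norm_exp]; simp [neg_le_abs]
  rw [Complex.sin, norm_div, norm_mul, Complex.norm_I, mul_one, Complex.norm_two,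
    div_le_iff₀ two_pos]
  calc _ ≤ ‖Complex.exp (-z * Complex.I)‖ + ‖Complex.exp (z * Complex.I)‖ := norm_sub_le _ _
    _ ≤ _ := by linarith

/-- In ψ = Γ'/Γ, the numerator is bounded by Cauchy's estimate on discs of radius 1/2, and 1/Γ by
the reflection formula. The crude rate π is enough, because it will be played off against a decay of
rate at least 2π. -/
theorem exists_norm_digamma_le_of_one_le_re :
    ∃ C : ℝ, 0 < C ∧ ∀ z : ℂ, 1 ≤ z.re → z.re ≤ 2 → 1 ≤ |z.im| →
      ‖Complex.digamma z‖ ≤ C * Real.exp (Real.pi * |z.im|) := by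
  obtain ⟨M, hM0, hM⟩ := exists_norm_Gamma_le
  refine ⟨M / (1 / 2) * (M / Real.pi), by positivity, fun z h1 h2 h3 => ?_⟩
  have him : z.im ≠ 0 := by
    intro h; rw [h] at h3; simp at h3; linarith
  have hz := ne_neg_natCast_of_im_ne_zero him
  have hd : ‖deriv Complex.Gamma z‖ ≤ M / (1 / 2) := by
    have hre : ∀ w ∈ Metric.closedBall z (1 / 2), 1 / 2 ≤ w.re ∧ w.re ≤ 5 / 2 := by
      intro w hw
      have := (Complex.abs_re_le_norm (w - z)).trans (mem_closedBall_iff_norm.1 hw)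
      rw [Complex.sub_re, abs_le] at this
      constructor <;> linarith [this.1, this.2]
    refine Complex.norm_deriv_le_of_forall_mem_sphere_norm_le (by norm_num) ?_ fun w hw =>
      hM w (hre w (Metric.sphere_subset_closedBall hw)).1
        (hre w (Metric.sphere_subset_closedBall hw)).2
    refine DifferentiableOn.diffContOnCl_ball (U := Metric.closedBall z (1 / 2))
      (fun w hw => ?_) subset_rfl
    exact (Complex.differentiableAt_Gamma w (ne_neg_natCast_of_re_pos
      (by linarith [(hre w hw).1]))).differentiableWithinAt
  have hG : (‖Complex.Gamma z‖)⁻¹ ≤ M / Real.pi * Real.exp (Real.pi * |z.im|) := by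
    have hne : ∀ w : ℂ, w.im = -z.im → w ≠ 0 := by
      rintro w hw rfl; simp at hw; exact him hw
    have hone : ∀ w : ℂ, w.im = -z.im → 1 ≤ ‖w‖ := by
      intro w hw
      refine h3.trans ?_
      rw [← abs_neg, ← hw]
      exact Complex.abs_im_le_norm w
    -- A shift by 2 brings 1 - z into the strip where Γ is bounded by M, and both new factors have
    -- norm at least |Im z| ≥ 1.
    have e1 : Complex.Gamma (3 - z) = (2 - z) * ((1 - z) * Complex.Gamma (1 - z)) := by
      rw [← Complex.Gamma_add_one (1 - z) (hne _ (by simp)),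
        show 1 - z + 1 = 2 - z by ring, ← Complex.Gamma_add_one (2 - z) (hne _ (by simp))]
      congr 1
      ring
    have e2 : ‖Complex.Gamma (1 - z)‖ ≤ M := by
      have h := hM (3 - z) (by simp; linarith) (by simp; linarith)
      rw [e1, norm_mul, norm_mul, ← mul_assoc] at h
      refine le_trans ?_ h
      refine le_mul_of_one_le_left (norm_nonneg _) ?_
      exact one_le_mul_of_one_le_of_one_le (hone _ (by simp)) (hone _ (by simp))
    have e3 := congrArg norm (Complex.Gamma_mul_Gamma_one_sub z)
    have hsin : ‖Complex.sin (Real.pi * z)‖ ≤ Real.exp (Real.pi * |z.im|) := by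
      refine (norm_sin_le _).trans_eq ?_
      rw [Complex.im_ofReal_mul, abs_mul, abs_of_pos Real.pi_pos]
    have hsin0 : Complex.sin (Real.pi * z) ≠ 0 := by
      intro h0
      have h := Complex.Gamma_mul_Gamma_one_sub z
      rw [h0, div_zero] at h
      refine mul_ne_zero (Complex.Gamma_ne_zero hz) (Complex.Gamma_ne_zero
        (ne_neg_natCast_of_im_ne_zero (by simpa using him))) h
    rw [norm_mul, norm_div, Complex.norm_real, Real.norm_of_nonneg Real.pi_pos.le] at e3
    have hG0 : 0 < ‖Complex.Gamma z‖ := norm_pos_iff.2 (Complex.Gamma_ne_zero hz)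
    have hs0 : 0 < ‖Complex.sin (Real.pi * z)‖ := norm_pos_iff.2 hsin0
    rw [eq_div_iff hs0.ne'] at e3
    have e4 : Real.pi ≤ ‖Complex.Gamma z‖ * M * Real.exp (Real.pi * |z.im|) := by
      refine e3.symm.trans_le ?_
      gcongr
    rw [inv_le_iff_one_le_mul₀ hG0, div_mul_eq_mul_div, div_mul_eq_mul_div, le_div_iff₀ Real.pi_pos,
      one_mul]
    exact e4.trans_eq (by ring)
  rw [Complex.digamma_def, logDeriv_apply, norm_div, div_eq_mul_inv, mul_assoc]
  gcongr

theorem exists_norm_digamma_le :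
    ∃ C : ℝ, 0 < C ∧ ∀ z : ℂ, 0 ≤ z.re → z.re ≤ 1 → 1 ≤ |z.im| →
      ‖Complex.digamma z‖ ≤ C * Real.exp (Real.pi * |z.im|) := by
  obtain ⟨C, hC0, hC⟩ := exists_norm_digamma_le_of_one_le_re
  refine ⟨C + 1, by positivity, fun z h1 h2 h3 => ?_⟩
  have him : z.im ≠ 0 := by
    intro h; rw [h] at h3; simp at h3; linarith
  have h := Complex.digamma_apply_add_one z (ne_neg_natCast_of_im_ne_zero him)
  have hz1 : 1 ≤ ‖z‖ := h3.trans (Complex.abs_im_le_norm z)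
  have h4 := hC (z + 1) (by simpa using h1) (by simp; linarith) (by simpa using h3)
  rw [eq_sub_of_add_eq h.symm]
  refine (norm_sub_le _ _).trans ?_
  rw [add_mul]
  refine add_le_add (by simpa using h4) ?_
  rw [norm_inv, one_mul]
  exact (inv_le_one_of_one_le₀ hz1).trans (Real.one_le_exp (by positivity))

/-! ### The exponential function `e` -/

theorem e_add (z w : ℂ) : e (z + w) = e z * e w := by
  rw [e, e, e, ← Complex.exp_add]; congr 1; ring

theorem e_intCast (n : ℤ) : e n = 1 := by
  rw [e, mul_comm, Complex.exp_int_mul_two_pi_mul_I]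

theorem e_zero : e 0 = 1 := by simpa using e_intCast 0

theorem e_mul_add_one (n : ℤ) (z : ℂ) : e (n * (z + 1)) = e (n * z) := by
  rw [mul_add, mul_one, e_add, e_intCast, mul_one]

theorem norm_e (z : ℂ) : ‖e z‖ = Real.exp (-(2 * Real.pi * z.im)) := by
  rw [e, Complex.norm_exp]
  congr 1
  simp [Complex.mul_re, Complex.mul_im]

theorem hasDerivAt_e_mul (c z : ℂ) :
    HasDerivAt (fun z => e (c * z)) (2 * Real.pi * Complex.I * c * e (c * z)) z := by
  have h := ((hasDerivAt_id z).const_mul (2 * Real.pi * Complex.I * c)).cexp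
  refine (h.congr_deriv ?_).congr_of_eventuallyEq (Eventually.of_forall fun w => ?_)
  · simp only [id, e, mul_one, mul_assoc]; ring
  · simp only [id, e, mul_assoc]

theorem continuous_e : Continuous e := by unfold e; fun_prop

theorem conj_e (z : ℂ) : (starRingEnd ℂ) (e z) = e (-(starRingEnd ℂ) z) := by
  rw [e, e, ← Complex.exp_conj]
  congr 1
  simp only [map_mul, Complex.conj_ofReal, Complex.conj_I, map_ofNat]
  ring

theorem e_ofReal_mul_I (y : ℝ) : e (y * Complex.I) = (Real.exp (-(2 * Real.pi * y)) : ℝ) := by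
  rw [e, Complex.ofReal_exp]
  congr 1
  push_cast
  linear_combination (2 * Real.pi * y : ℂ) * Complex.I_mul_I

/-! ### Integrals over horizontal segments -/

theorem re_ofReal_add_mul_I (x t : ℝ) : ((x : ℂ) + t * Complex.I).re = x := by simp

theorem im_ofReal_add_mul_I (x t : ℝ) : ((x : ℂ) + t * Complex.I).im = t := by simp

theorem continuous_comp_horizontal {t : ℝ} {f : ℂ → ℂ} (hf : ContinuousOn f {z | z.im = t}) :
    Continuous fun x : ℝ => f (x + t * Complex.I) :=
  hf.comp_continuous (by fun_prop) fun x => by simp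

theorem segInt_congr {t : ℝ} {f g : ℂ → ℂ} (h : ∀ z, z.im = t → f z = g z) :
    segInt t f = segInt t g := by
  refine intervalIntegral.integral_congr fun x _ => h _ (im_ofReal_add_mul_I x t)

theorem segInt_const_mul (t : ℝ) (c : ℂ) (f : ℂ → ℂ) :
    segInt t (fun z => c * f z) = c * segInt t f :=
  intervalIntegral.integral_const_mul _ _

/-- Cauchy's theorem on a rectangle: the dependence on the height is governed by the failure of `F`
to be 1-periodic along the imaginary axis. -/
theorem segInt_sub {s t : ℝ} (hs : 0 < s) (ht : 0 < t) {F : ℂ → ℂ}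
    (hF : DifferentiableOn ℂ F {z | 0 < z.im}) :
    segInt t F - segInt s F =
      Complex.I * ∫ y in s..t, (F (1 + y * Complex.I) - F (y * Complex.I)) := by
  have h := Complex.integral_boundary_rect_eq_zero_of_differentiableOn F (s * Complex.I)
    (1 + t * Complex.I) (hF.mono fun z hz => by
      have h2 : z.im ∈ uIcc s t := by simpa using hz.2
      exact (lt_min hs ht).trans_le h2.1)
  have hc : ∀ x : ℝ, ContinuousOn (fun y : ℝ => F (x + y * Complex.I)) (uIcc s t) := by
    intro x
    refine hF.continuousOn.comp (by fun_prop) fun y hy => ?_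
    simp only [mem_ofPred_eq, im_ofReal_add_mul_I]
    exact (lt_min hs ht).trans_le hy.1
  have h1 := (hc 1).intervalIntegrable (μ := volume)
  have h0 := (hc 0).intervalIntegrable (μ := volume)
  simp only [Complex.ofReal_one, Complex.ofReal_zero, zero_add] at h0 h1
  rw [intervalIntegral.integral_sub h1 h0]
  simp only [segInt, Complex.mul_re, Complex.ofReal_re, Complex.I_re, mul_zero, Complex.ofReal_im,
    Complex.I_im, mul_one, sub_self, Complex.add_re, Complex.one_re, add_zero, Complex.mul_im,
    Complex.add_im, Complex.one_im, zero_add, smul_eq_mul, Complex.ofReal_one,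
    Complex.ofReal_zero] at h ⊢
  linear_combination -h

theorem segInt_of_hasDerivAt {t : ℝ} {F F' : ℂ → ℂ}
    (hF : ∀ z, z.im = t → HasDerivAt F (F' z) z) (hF' : ContinuousOn F' {z | z.im = t}) :
    segInt t F' = F (1 + t * Complex.I) - F (t * Complex.I) := by
  have h : ∀ x : ℝ, HasDerivAt (fun x : ℝ => F (x + t * Complex.I)) (F' (x + t * Complex.I)) x := by
    intro x
    have h1 := (hF (x + t * Complex.I) (im_ofReal_add_mul_I x t)).comp_add_const
      (x : ℂ) (t * Complex.I)
    exact h1.comp_ofReal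
  have := intervalIntegral.integral_eq_sub_of_hasDerivAt (a := 0) (b := 1) (fun x _ => h x)
    ((continuous_comp_horizontal hF').intervalIntegrable _ _)
  simpa [segInt] using this

/-! ### Fourier coefficients of the symmetrized digamma function -/

theorem differentiableOn_e_mul_symPolygamma (n : ℤ) (k : ℕ) :
    DifferentiableOn ℂ (fun z => e (n * z) * symPolygamma k z) {z | 0 < z.im} := fun z hz =>
  ((hasDerivAt_e_mul n z).mul
    (hasDerivAt_symPolygamma k (ne_of_gt hz))).differentiableAt.differentiableWithinAt

theorem continuousOn_symPolygamma (k : ℕ) {t : ℝ} (ht : t ≠ 0) :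
    ContinuousOn (symPolygamma k) {z | z.im = t} := fun z hz =>
  (hasDerivAt_symPolygamma k (by rw [show z.im = t from hz]; exact ht)).continuousAt.continuousWithinAt

/-- The exponential is periodic and `symPolygamma 0` jumps by 2/z, so the vertical sides contribute
the integral of 2 e^(2πny)/y, whose antiderivative is 2 Ei(2πny). -/
theorem segInt_e_mul_symPolygamma_sub {n : ℤ} (hn : n ≠ 0) {s t : ℝ} (hs : 0 < s) (ht : 0 < t) :
    segInt t (fun z => e (((-n : ℤ) : ℂ) * z) * symPolygamma 0 z) -
        segInt s (fun z => e (((-n : ℤ) : ℂ) * z) * symPolygamma 0 z) =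
      2 * (expInt (2 * Real.pi * n * t) : ℂ) - 2 * (expInt (2 * Real.pi * n * s) : ℂ) := by
  have hpos : ∀ y ∈ uIcc s t, 0 < y := fun y hy => (lt_min hs ht).trans_le hy.1
  have hn' : (n : ℝ) ≠ 0 := by exact_mod_cast hn
  have hne : ∀ y ∈ uIcc s t, 2 * Real.pi * n * y ≠ 0 := fun y hy => by
    have := hpos y hy
    have := Real.pi_pos
    positivity
  have h1 : ∀ y ∈ uIcc s t, HasDerivAt (fun y : ℝ => 2 * expInt (2 * Real.pi * n * y))
      (2 * (Real.exp (2 * Real.pi * n * y) / y)) y := by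
    intro y hy
    have h := ((hasDerivAt_expInt (hne y hy)).comp y
      ((hasDerivAt_id y).const_mul (2 * Real.pi * n))).const_mul 2
    refine h.congr_deriv ?_
    have := (hpos y hy).ne'
    have := Real.pi_ne_zero
    field_simp
  have h2 := intervalIntegral.integral_eq_sub_of_hasDerivAt h1
    (ContinuousOn.intervalIntegrable (by
      refine ContinuousOn.const_mul (ContinuousOn.div (by fun_prop) continuousOn_id fun y hy => ?_) 2
      exact (hpos y hy).ne'))
  rw [segInt_sub hs ht (differentiableOn_e_mul_symPolygamma _ _),
    ← intervalIntegral.integral_const_mul]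
  have h3 := congrArg ((↑) : ℝ → ℂ) h2
  rw [← intervalIntegral.integral_ofReal] at h3
  push_cast at h3
  rw [← h3]
  refine intervalIntegral.integral_congr fun y hy => ?_
  have hy0 := hpos y hy
  have hyC : (y : ℂ) ≠ 0 := by exact_mod_cast hy0.ne'
  have hj := symPolygamma_add_one 0 (z := y * Complex.I) (by simpa using hy0.ne')
  have he := e_mul_add_one (-n) (y * Complex.I)
  have he2 : e (((-n : ℤ) : ℂ) * (y * Complex.I)) = Complex.exp (2 * Real.pi * n * y) := by
    have := e_ofReal_mul_I (-n * y)
    push_cast at this ⊢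
    rw [← mul_assoc, this]
    congr 1
    ring
  simp only [add_comm (1 : ℂ)]
  rw [he, hj, he2]
  simp only [pow_zero, Nat.factorial_zero, Nat.cast_one, one_mul, zero_add, pow_one]
  field_simp
  simp

/-- The exponential factor is at most e^(-2πt) for n ≤ -1, against growth of order e^(πt) for the
digamma function. -/
theorem tendsto_segInt_e_mul_symPolygamma {n : ℤ} (hn : n < 0) :
    Tendsto (fun t => segInt t (fun z => e (((-n : ℤ) : ℂ) * z) * symPolygamma 0 z)) atTop
      (𝓝 0) := by
  obtain ⟨C, hC0, hC⟩ := exists_norm_digamma_le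
  have hlim : Tendsto (fun t : ℝ => 2 * C * Real.exp (-(Real.pi * t))) atTop (𝓝 (2 * C * 0)) :=
    (Real.tendsto_exp_neg_atTop_nhds_zero.comp
      (tendsto_id.const_mul_atTop Real.pi_pos)).const_mul _
  rw [mul_zero] at hlim
  refine squeeze_zero_norm' ?_ hlim
  filter_upwards [eventually_ge_atTop 1] with t ht
  have hb : ∀ x ∈ uIoc (0 : ℝ) 1, ‖e (((-n : ℤ) : ℂ) * (x + t * Complex.I)) *
      symPolygamma 0 (x + t * Complex.I)‖ ≤ 2 * C * Real.exp (-(Real.pi * t)) := by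
    intro x hx
    rw [uIoc_of_le zero_le_one] at hx
    have h1 : ‖symPolygamma 0 (x + t * Complex.I)‖ ≤ 2 * (C * Real.exp (Real.pi * t)) := by
      rw [symPolygamma, polygamma_zero, pow_zero, one_mul, two_mul]
      have ht' : |t| = t := abs_of_nonneg (by linarith)
      refine (norm_add_le _ _).trans (add_le_add ?_ ?_)
      · have := hC (x + t * Complex.I) (by simpa using hx.1.le) (by simpa using hx.2)
          (by simpa [ht'] using ht)
        simpa [ht'] using this
      · have := hC (1 - (x + t * Complex.I)) (by simpa using hx.2) (by simpa using hx.1.le)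
          (by simpa [ht'] using ht)
        simpa [ht'] using this
    have h2 : ‖e (((-n : ℤ) : ℂ) * (x + t * Complex.I))‖ ≤ Real.exp (-(2 * Real.pi * t)) := by
      rw [norm_e, Real.exp_le_exp, neg_le_neg_iff]
      have h3 : (((-n : ℤ) : ℂ) * (x + t * Complex.I)).im = (-n : ℝ) * t := by
        have := Complex.im_ofReal_mul (-n : ℝ) (x + t * Complex.I)
        push_cast at this ⊢
        rw [this]
        simp
      rw [h3]
      have h4 : (1 : ℝ) ≤ -n := by exact_mod_cast (show (1 : ℤ) ≤ -n by omega)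
      have : t ≤ -n * t := le_mul_of_one_le_left (by linarith) h4
      have := Real.pi_pos
      gcongr
    rw [norm_mul]
    calc _ ≤ Real.exp (-(2 * Real.pi * t)) * (2 * (C * Real.exp (Real.pi * t))) := by gcongr
      _ = 2 * C * (Real.exp (-(2 * Real.pi * t)) * Real.exp (Real.pi * t)) := by ring
      _ = _ := by rw [← Real.exp_add]; congr 2; ring
  have := intervalIntegral.norm_integral_le_of_norm_le_const hb
  simpa [segInt] using this

theorem segInt_e_mul_symPolygamma_of_neg {n : ℤ} (hn : n < 0) {t : ℝ} (ht : 0 < t) :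
    segInt t (fun z => e (((-n : ℤ) : ℂ) * z) * symPolygamma 0 z) =
      2 * (expInt (2 * Real.pi * n * t) : ℂ) := by
  have hn' : (n : ℝ) < 0 := by exact_mod_cast hn
  have h1 : Tendsto (fun s : ℝ => 2 * (expInt (2 * Real.pi * n * s) : ℂ)) atTop (𝓝 (2 * ((0 : ℝ) : ℂ))) := by
    refine Tendsto.const_mul _ ((Complex.continuous_ofReal.tendsto _).comp
      (tendsto_expInt_atBot.comp ?_))
    refine tendsto_id.const_mul_atTop_of_neg ?_
    have := Real.pi_pos
    nlinarith
  have h2 := (tendsto_segInt_e_mul_symPolygamma hn).sub h1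
  have h3 : Tendsto (fun _ : ℝ => segInt t (fun z => e (((-n : ℤ) : ℂ) * z) * symPolygamma 0 z) -
      2 * (expInt (2 * Real.pi * n * t) : ℂ)) atTop (𝓝 (0 - 2 * ((0 : ℝ) : ℂ))) := by
    refine h2.congr' ?_
    filter_upwards [eventually_gt_atTop 0] with s hs
    linear_combination segInt_e_mul_symPolygamma_sub hn.ne ht hs
  have := tendsto_nhds_unique tendsto_const_nhds h3
  simpa [sub_eq_zero] using this

/-! The difference of the Fourier coefficients of indices `n` and `-n`. -/

/-- The function `e(-nz) - e(nz)`. -/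
noncomputable def eDiff (n : ℤ) (z : ℂ) : ℂ := e (((-n : ℤ) : ℂ) * z) - e ((n : ℂ) * z)

theorem differentiable_eDiff (n : ℤ) : Differentiable ℂ (eDiff n) := fun z =>
  ((hasDerivAt_e_mul _ z).sub (hasDerivAt_e_mul _ z)).differentiableAt

theorem eDiff_one_sub (n : ℤ) (z : ℂ) : eDiff n (1 - z) = -eDiff n z := by
  have h1 := e_mul_add_one n (-z)
  have h2 := e_mul_add_one (-n) (-z)
  rw [eDiff, eDiff, show 1 - z = -z + 1 by ring, h1, h2]
  push_cast
  rw [neg_mul_neg, neg_mul, mul_neg, neg_sub]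

theorem eDiff_zero (n : ℤ) : eDiff n 0 = 0 := by simp [eDiff]

theorem eDiff_one (n : ℤ) : eDiff n 1 = 0 := by
  have := eDiff_one_sub n 0
  rwa [sub_zero, eDiff_zero, neg_zero] at this

/-- The continuous extension of `(e(-nz) - e(nz)) (ψ(z) + ψ(1 - z))` to the real axis. -/
noncomputable def eDiffDigamma (n : ℤ) (z : ℂ) : ℂ :=
  eDiff n z * (Complex.digamma (z + 1) + Complex.digamma (2 - z)) - dslope (eDiff n) 0 z +
    dslope (eDiff n) 1 z

theorem continuous_dslope_eDiff (n : ℤ) (a : ℂ) : Continuous (dslope (eDiff n) a) := by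
  rw [continuous_iff_continuousAt]
  intro x
  rcases eq_or_ne x a with rfl | hx
  · exact continuousAt_dslope_same.2 (differentiable_eDiff n x)
  · exact (continuousAt_dslope_of_ne hx).2 (differentiable_eDiff n x).continuousAt

theorem continuousAt_eDiffDigamma (n : ℤ) {z : ℂ} (h0 : 0 ≤ z.re) (h1 : z.re ≤ 1) :
    ContinuousAt (eDiffDigamma n) z := by
  have ha : ContinuousAt (fun z : ℂ => Complex.digamma (z + 1)) z :=
    ContinuousAt.comp (f := fun z : ℂ => z + 1) (analyticAt_digamma
      (ne_neg_natCast_of_re_pos (by simp; linarith))).continuousAt (by fun_prop)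
  have hb : ContinuousAt (fun z : ℂ => Complex.digamma (2 - z)) z :=
    ContinuousAt.comp (f := fun z : ℂ => 2 - z) (analyticAt_digamma
      (ne_neg_natCast_of_re_pos (by simp; linarith))).continuousAt (by fun_prop)
  exact (((differentiable_eDiff n).continuous.continuousAt.mul (ha.add hb)).sub
    (continuous_dslope_eDiff n 0).continuousAt).add (continuous_dslope_eDiff n 1).continuousAt

/-- `eDiff` vanishes at 0 and 1, so its difference quotients there are the products of `eDiff` with
the polar parts 1/z and 1/(z - 1) split off by the functional equation. -/
theorem eDiffDigamma_of_ne (n : ℤ) {z : ℂ} (h0 : ∀ m : ℕ, z ≠ -m) (h1 : ∀ m : ℕ, 1 - z ≠ -m) :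
    eDiffDigamma n z = eDiff n z * symPolygamma 0 z := by
  have hz0 : z ≠ 0 := by simpa using h0 0
  have hz1 : z - 1 ≠ 0 := by
    intro h
    exact h1 0 (by simp; linear_combination -h)
  have e1 := Complex.digamma_apply_add_one z h0
  have e2 := Complex.digamma_apply_add_one (1 - z) h1
  rw [show 1 - z + 1 = 2 - z by ring] at e2
  rw [eDiffDigamma, e1, e2, dslope_of_ne _ hz0, dslope_of_ne _ (sub_ne_zero.1 hz1),
    slope_def_field, slope_def_field, eDiff_zero, eDiff_one, symPolygamma, polygamma_zero, sub_zero,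
    sub_zero, show (1 - z)⁻¹ = -(z - 1)⁻¹ by rw [← inv_neg, neg_sub], pow_zero]
  ring

theorem eDiffDigamma_one_sub (n : ℤ) {z : ℂ} (h0 : ∀ m : ℕ, z ≠ -m)
    (h1 : ∀ m : ℕ, 1 - z ≠ -m) : eDiffDigamma n (1 - z) = -eDiffDigamma n z := by
  rw [eDiffDigamma_of_ne n h0 h1, eDiffDigamma_of_ne n h1 (by simpa using h0), eDiff_one_sub,
    symPolygamma, symPolygamma, sub_sub_cancel, pow_zero]
  ring

/-- The integrand is odd under x ↦ 1 - x. -/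
theorem integral_eDiffDigamma (n : ℤ) : ∫ x in (0 : ℝ)..1, eDiffDigamma n x = 0 := by
  have h1 := intervalIntegral.integral_comp_sub_left (a := 0) (b := 1)
    (fun x : ℝ => eDiffDigamma n x) 1
  have h2 : ∫ x in (0 : ℝ)..1, eDiffDigamma n ((1 - x : ℝ) : ℂ) =
      ∫ x in (0 : ℝ)..1, -eDiffDigamma n x := by
    rw [intervalIntegral.integral_of_le zero_le_one, intervalIntegral.integral_of_le zero_le_one,
      integral_Ioc_eq_integral_Ioo, integral_Ioc_eq_integral_Ioo]
    refine setIntegral_congr_fun measurableSet_Ioo fun x hx => ?_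
    simp only [Complex.ofReal_sub, Complex.ofReal_one]
    refine eDiffDigamma_one_sub n (ne_neg_natCast_of_re_pos (by simpa using hx.1))
      (ne_neg_natCast_of_re_pos (by simpa using hx.2))
  rw [h2, intervalIntegral.integral_neg, sub_self, sub_zero] at h1
  have : (2 : ℂ) * ∫ x in (0 : ℝ)..1, eDiffDigamma n x = 0 := by linear_combination -h1
  simpa using this

theorem tendsto_segInt_eDiffDigamma (n : ℤ) :
    Tendsto (fun t => segInt t (eDiffDigamma n)) (𝓝 0) (𝓝 0) := by
  -- Continuity of `eDiffDigamma` is available only for real parts in [0, 1]; clamping x makes the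
  -- integrand jointly continuous everywhere without changing the integral.
  let p : ℝ → ℝ := fun x => max 0 (min 1 x)
  have hp : Continuous p := by fun_prop
  have hc : Continuous (fun q : ℝ × ℝ => eDiffDigamma n (p q.2 + q.1 * Complex.I)) := by
    rw [continuous_iff_continuousAt]
    intro q
    refine ContinuousAt.comp (f := fun q : ℝ × ℝ => (p q.2 : ℂ) + q.1 * Complex.I)
      (continuousAt_eDiffDigamma n ?_ ?_) (by fun_prop)
    · rw [re_ofReal_add_mul_I]; exact le_max_left _ _
    · rw [re_ofReal_add_mul_I]; exact max_le zero_le_one (min_le_left _ _)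
  have hP : ∀ t : ℝ, segInt t (eDiffDigamma n) =
      ∫ x in (0 : ℝ)..1, eDiffDigamma n (p x + t * Complex.I) := by
    intro t
    refine intervalIntegral.integral_congr fun x hx => ?_
    rw [uIcc_of_le zero_le_one] at hx
    have : p x = x := by simp only [p]; rw [min_eq_right hx.2, max_eq_right hx.1]
    simp only [this]
  have h := (intervalIntegral.continuous_parametric_intervalIntegral_of_continuous' (μ := volume)
    (f := fun (t x : ℝ) => eDiffDigamma n (p x + t * Complex.I)) hc 0 1).tendsto 0
  simp only [← hP] at h
  have h0 : segInt 0 (eDiffDigamma n) = 0 := by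
    rw [← integral_eDiffDigamma n, segInt]
    simp
  rwa [h0] at h

/-- For n > 0 the factor e(-nz) grows with the height, so the limit at infinity gives nothing.
Subtracting the known case of index -n removes the poles at 0 and 1; at height 0 the difference
integrates to 0 by symmetry, as does the limit of Ei(u) - Ei(-u). -/
theorem segInt_e_mul_symPolygamma_zero {n : ℤ} (hn : n ≠ 0) {t : ℝ} (ht : 0 < t) :
    segInt t (fun z => e (((-n : ℤ) : ℂ) * z) * symPolygamma 0 z) =
      2 * (expInt (2 * Real.pi * n * t) : ℂ) := by
  rcases hn.lt_or_gt with hn | hn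
  · exact segInt_e_mul_symPolygamma_of_neg hn ht
  have hn' : (0 : ℝ) < n := by exact_mod_cast hn
  have hci : ∀ (m : ℤ) {s : ℝ}, 0 < s → IntervalIntegrable (fun x : ℝ =>
      e (m * (x + s * Complex.I)) * symPolygamma 0 (x + s * Complex.I)) volume 0 1 := by
    intro m s hs
    refine (continuous_comp_horizontal (f := fun z => e (m * z) * symPolygamma 0 z)
      ((ContinuousOn.mul ?_ (continuousOn_symPolygamma 0 hs.ne')))).intervalIntegrable _ _
    exact (continuous_e.comp (by fun_prop)).continuousOn
  have h1 : Tendsto (fun s : ℝ => 2 * ((expInt (2 * Real.pi * n * s) -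
      expInt (-(2 * Real.pi * n * s)) : ℝ) : ℂ)) (𝓝[>] 0) (𝓝 (2 * ((0 : ℝ) : ℂ))) := by
    refine Tendsto.const_mul _ ((Complex.continuous_ofReal.tendsto _).comp
      (tendsto_expInt_sub_expInt_neg.comp ?_))
    refine tendsto_nhdsWithin_iff.2 ⟨?_, ?_⟩
    · have : Tendsto (fun s : ℝ => 2 * Real.pi * n * s) (𝓝 0) (𝓝 (2 * Real.pi * n * 0)) :=
        tendsto_id.const_mul _
      rw [mul_zero] at this
      exact this.mono_left nhdsWithin_le_nhds
    · filter_upwards [self_mem_nhdsWithin] with s hs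
      have := Real.pi_pos
      simp only [mem_Ioi] at hs ⊢
      positivity
  have h2 := ((tendsto_segInt_eDiffDigamma n).mono_left
    (nhdsWithin_le_nhds (s := Ioi 0))).sub h1
  have h3 : Tendsto (fun _ : ℝ => segInt t (fun z => e (((-n : ℤ) : ℂ) * z) * symPolygamma 0 z) -
      2 * (expInt (2 * Real.pi * n * t) : ℂ)) (𝓝[>] (0 : ℝ)) (𝓝 (0 - 2 * ((0 : ℝ) : ℂ))) := by
    refine h2.congr' ?_
    filter_upwards [self_mem_nhdsWithin] with s hs
    have h4 : segInt s (eDiffDigamma n) =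
        segInt s (fun z => e (((-n : ℤ) : ℂ) * z) * symPolygamma 0 z) -
          segInt s (fun z => e ((n : ℂ) * z) * symPolygamma 0 z) := by
      rw [segInt, segInt, segInt, ← intervalIntegral.integral_sub (hci _ hs) (hci _ hs)]
      refine intervalIntegral.integral_congr fun x _ => ?_
      have him : ((x : ℂ) + s * Complex.I).im ≠ 0 := by
        rw [im_ofReal_add_mul_I]; exact ne_of_gt hs
      rw [eDiffDigamma_of_ne n (ne_neg_natCast_of_im_ne_zero him)
        (ne_neg_natCast_of_im_ne_zero (by simpa using him)), eDiff, sub_mul]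
    have h5 := segInt_e_mul_symPolygamma_of_neg (n := -n) (by omega) hs
    rw [neg_neg] at h5
    rw [h4, h5]
    have h6 := segInt_e_mul_symPolygamma_sub hn.ne' ht hs
    have h7 : 2 * Real.pi * ((-n : ℤ) : ℝ) * s = -(2 * Real.pi * n * s) := by push_cast; ring
    rw [h7]
    push_cast
    push_cast at h6
    linear_combination h6
  have := tendsto_nhds_unique tendsto_const_nhds h3
  simpa [sub_eq_zero] using this

/-! ### Fourier coefficients of symmetrized polygamma functions -/

theorem e_neg_mul_mul_I (n : ℤ) (t : ℝ) :
    e (((-n : ℤ) : ℂ) * (t * Complex.I)) = (Real.exp (2 * Real.pi * n * t) : ℝ) := by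
  have := e_ofReal_mul_I (-n * t)
  push_cast at this ⊢
  rw [← mul_assoc, this]
  congr 1
  ring

theorem e_mul_mul_I (n : ℤ) (t : ℝ) :
    e ((n : ℂ) * (t * Complex.I)) = (Real.exp (-(2 * Real.pi * n * t)) : ℝ) := by
  have := e_neg_mul_mul_I (-n) t
  rw [neg_neg] at this
  rw [this]
  push_cast
  congr 1
  ring

/-- Repeated integration by parts from the digamma case: each step multiplies by 2πin, and the jump
of `symPolygamma k` contributes the next inverse power in the sum. -/
theorem segInt_e_mul_symPolygamma (k : ℕ) {n : ℤ} (hn : n ≠ 0) {t : ℝ} (ht : 0 < t) :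
    segInt t (fun z => e (((-n : ℤ) : ℂ) * z) * symPolygamma k z) =
      (2 * Real.pi * Complex.I * n) ^ k * (2 * (expInt (2 * Real.pi * n * t) -
        Real.exp (2 * Real.pi * n * t) * ∑ j ∈ Finset.range k,
          ((2 * Real.pi * n * t) ^ (j + 1))⁻¹ * j.factorial : ℝ)) := by
  induction k with
  | zero =>
    rw [segInt_e_mul_symPolygamma_zero hn ht]
    simp
  | succ k ih =>
    set c : ℂ := 2 * Real.pi * Complex.I * n with hc
    set E : ℂ → ℂ := fun z => e (((-n : ℤ) : ℂ) * z) with hE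
    have hEc : Continuous E := continuous_e.comp (by fun_prop)
    have hS : ∀ j, ContinuousOn (fun z => E z * symPolygamma j z) {z | z.im = t} := fun j =>
      hEc.continuousOn.mul (continuousOn_symPolygamma j ht.ne')
    have hd : ∀ z : ℂ, z.im = t → HasDerivAt (fun z => E z * symPolygamma k z)
        (-c * (E z * symPolygamma k z) + E z * symPolygamma (k + 1) z) z := by
      intro z hz
      refine ((hasDerivAt_e_mul ((-n : ℤ) : ℂ) z).mul
        (hasDerivAt_symPolygamma k (by rw [hz]; exact ht.ne'))).congr_deriv ?_
      simp only [hE, hc]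
      push_cast
      ring
    have h := segInt_of_hasDerivAt hd ((continuousOn_const.mul (hS k)).add (hS (k + 1)))
    have hsplit : segInt t (fun z => -c * (E z * symPolygamma k z) + E z * symPolygamma (k + 1) z) =
        -c * segInt t (fun z => E z * symPolygamma k z) +
          segInt t (fun z => E z * symPolygamma (k + 1) z) := by
      rw [← segInt_const_mul]
      exact intervalIntegral.integral_add
        ((continuous_comp_horizontal (continuousOn_const.mul (hS k))).intervalIntegrable _ _)
        ((continuous_comp_horizontal (hS (k + 1))).intervalIntegrable _ _)
    rw [hsplit, ih] at h
    have hj := symPolygamma_add_one k (z := t * Complex.I) (by simpa using ht.ne')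
    have he : E (t * Complex.I + 1) = E (t * Complex.I) := e_mul_add_one (-n) (t * Complex.I)
    have he2 : E (t * Complex.I) = (Real.exp (2 * Real.pi * n * t) : ℝ) := e_neg_mul_mul_I n t
    rw [add_comm 1, hj, he, he2] at h
    have hnC : (n : ℂ) ≠ 0 := by exact_mod_cast hn
    have htC : (t : ℂ) ≠ 0 := by exact_mod_cast ht.ne'
    have hpi : (Real.pi : ℂ) ≠ 0 := by exact_mod_cast Real.pi_ne_zero
    have hu : ((t : ℂ) * Complex.I) ^ (k + 1) * c ^ (k + 1) =
        (-1) ^ (k + 1) * (2 * Real.pi * n * t) ^ (k + 1) := by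
      rw [← mul_pow, ← mul_pow]
      congr 1
      rw [hc]
      linear_combination (2 * Real.pi * n * t : ℂ) * Complex.I_mul_I
    have hu' : ((-1 : ℂ) ^ k * (((t : ℂ) * Complex.I) ^ (k + 1))⁻¹) =
        -(c ^ (k + 1) * ((2 * Real.pi * n * t : ℂ) ^ (k + 1))⁻¹) := by
      have hc0 : c ≠ 0 := by
        rw [hc]
        exact mul_ne_zero (mul_ne_zero (mul_ne_zero two_ne_zero hpi) Complex.I_ne_zero) hnC
      have h1 : ((t : ℂ) * Complex.I) ^ (k + 1) ≠ 0 :=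
        pow_ne_zero _ (mul_ne_zero htC Complex.I_ne_zero)
      have h2 : (2 * Real.pi * n * t : ℂ) ^ (k + 1) ≠ 0 :=
        pow_ne_zero _ (mul_ne_zero (mul_ne_zero (mul_ne_zero two_ne_zero hpi) hnC) htC)
      have h3 : ((-1 : ℂ) ^ k) * (-1) ^ k = 1 := by rw [← mul_pow]; simp
      rw [mul_inv_eq_iff_eq_mul₀ h1, neg_mul, mul_right_comm, mul_comm (c ^ (k + 1)), hu, pow_succ]
      field_simp
    rw [Finset.sum_range_succ]
    simp only [hE] at h
    push_cast at h ⊢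
    linear_combination h + 2 * Complex.exp (2 * Real.pi * n * t) * k.factorial * hu'

/-! ### Bernoulli polynomials -/

theorem hasDerivAt_bernoulliPoly (m : ℕ) (z : ℂ) :
    HasDerivAt (bernoulliPoly (m + 1)) ((m + 1) * bernoulliPoly m z) z := by
  have h := (Polynomial.bernoulli (m + 1)).hasDerivAt_aeval z
  rw [Polynomial.derivative_bernoulli_add_one] at h
  show HasDerivAt (fun z => Polynomial.aeval z (Polynomial.bernoulli (m + 1))) _ z
  simpa [bernoulliPoly] using h

theorem continuous_bernoulliPoly (m : ℕ) : Continuous (bernoulliPoly m) :=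
  Polynomial.continuous_aeval _

theorem bernoulliPoly_one_add (m : ℕ) (z : ℂ) :
    bernoulliPoly m (1 + z) = bernoulliPoly m z + m * z ^ (m - 1) := by
  have h := congrArg (Polynomial.aeval z) (Polynomial.bernoulli_comp_one_add_X m)
  rw [Polynomial.aeval_comp] at h
  simpa [bernoulliPoly] using h

/-- This is the difference equation of the next Bernoulli polynomial; it later produces the term
with `T ^ (k + 1) / (k + 1)` from the zeroth coefficient. -/
theorem segInt_bernoulliPoly (m : ℕ) (t : ℝ) :
    segInt t (bernoulliPoly m) = (t * Complex.I) ^ m := by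
  have hm : (m + 1 : ℂ) ≠ 0 := by exact_mod_cast m.succ_ne_zero
  have h := segInt_of_hasDerivAt (t := t)
    (fun z _ => (hasDerivAt_bernoulliPoly m z).const_mul (m + 1 : ℂ)⁻¹)
    (continuousOn_const.mul (continuousOn_const.mul (continuous_bernoulliPoly m).continuousOn))
  simp only [inv_mul_cancel_left₀ hm] at h
  rw [h, bernoulliPoly_one_add]
  push_cast
  field_simp
  ring

theorem incGamma_add_two (s : ℕ) (u : ℝ) :
    incGamma (s + 2) u = (s + 1) * incGamma (s + 1) u + Real.exp (-u) * u ^ (s + 1) := by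
  rw [incGamma_succ_eq, incGamma_succ_eq, Finset.sum_range_succ _ (s + 1), Nat.factorial_succ]
  push_cast
  have : (s.factorial : ℝ) ≠ 0 := by positivity
  field_simp

theorem segInt_e_mul_bernoulliPoly_succ (m : ℕ) {n : ℤ} (hn : n ≠ 0) (t : ℝ) :
    segInt t (fun z => e (n * z) * bernoulliPoly (m + 1) z) =
      (m + 1) / (2 * Real.pi * Complex.I * n) *
        (Real.exp (-(2 * Real.pi * n * t)) * (t * Complex.I) ^ m -
          segInt t (fun z => e (n * z) * bernoulliPoly m z)) := by
  set c : ℂ := 2 * Real.pi * Complex.I * n with hc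
  have hEc : Continuous fun z : ℂ => e (n * z) := continuous_e.comp (by fun_prop)
  have hS : ∀ j, Continuous (fun z => e (n * z) * bernoulliPoly j z) := fun j =>
    hEc.mul (continuous_bernoulliPoly j)
  have hc0 : c ≠ 0 := by
    have hnC : (n : ℂ) ≠ 0 := by exact_mod_cast hn
    have hpi : (Real.pi : ℂ) ≠ 0 := by exact_mod_cast Real.pi_ne_zero
    exact mul_ne_zero (mul_ne_zero (mul_ne_zero two_ne_zero hpi) Complex.I_ne_zero) hnC
  have hd : ∀ z : ℂ, z.im = t → HasDerivAt (fun z => e (n * z) * bernoulliPoly (m + 1) z)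
      (c * (e (n * z) * bernoulliPoly (m + 1) z) + (m + 1) * (e (n * z) * bernoulliPoly m z)) z := by
    intro z _
    refine ((hasDerivAt_e_mul (n : ℂ) z).mul (hasDerivAt_bernoulliPoly m z)).congr_deriv ?_
    ring
  have h := segInt_of_hasDerivAt hd ((continuous_const.mul (hS (m + 1))).add
    (continuous_const.mul (hS m))).continuousOn
  have hsplit : segInt t (fun z => c * (e (n * z) * bernoulliPoly (m + 1) z) +
        (m + 1) * (e (n * z) * bernoulliPoly m z)) =
      c * segInt t (fun z => e (n * z) * bernoulliPoly (m + 1) z) +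
        (m + 1) * segInt t (fun z => e (n * z) * bernoulliPoly m z) := by
    rw [← segInt_const_mul, ← segInt_const_mul]
    exact intervalIntegral.integral_add
      ((continuous_comp_horizontal (continuous_const.mul (hS _)).continuousOn).intervalIntegrable _ _)
      ((continuous_comp_horizontal (continuous_const.mul (hS _)).continuousOn).intervalIntegrable _ _)
  rw [hsplit, bernoulliPoly_one_add, add_comm 1, e_mul_add_one, e_mul_mul_I] at h
  push_cast at h
  rw [div_mul_eq_mul_div, eq_div_iff hc0]
  push_cast
  linear_combination h

/-- Integration by parts on the left and the recursion `incGamma_add_two` on the right are the same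
recursion in k. -/
theorem segInt_e_mul_bernoulliPoly (k : ℕ) {n : ℤ} (hn : n ≠ 0) (t : ℝ) :
    segInt t (fun z => e (n * z) * bernoulliPoly (k + 1) z) =
      (k + 1) * (-1) ^ k * (Complex.I ^ (k + 1))⁻¹ *
        (incGamma (k + 1) (2 * Real.pi * n * t) / (2 * Real.pi * n) ^ (k + 1) : ℝ) := by
  have hnC : (n : ℂ) ≠ 0 := by exact_mod_cast hn
  have hpi : (Real.pi : ℂ) ≠ 0 := by exact_mod_cast Real.pi_ne_zero
  induction k with
  | zero =>
    have h0 : segInt t (fun z => e (n * z) * bernoulliPoly 0 z) = 0 := by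
      have h := segInt_of_hasDerivAt (t := t) (fun z _ => hasDerivAt_e_mul (n : ℂ) z)
        ((continuous_const.mul (continuous_e.comp (by fun_prop : Continuous fun z : ℂ =>
          (n : ℂ) * z))).continuousOn)
      rw [segInt_const_mul, add_comm 1, e_mul_add_one, sub_self] at h
      have hc : (2 * Real.pi * Complex.I * n : ℂ) ≠ 0 :=
        mul_ne_zero (mul_ne_zero (mul_ne_zero two_ne_zero hpi) Complex.I_ne_zero) hnC
      have := (mul_eq_zero.1 h).resolve_left hc
      simpa [bernoulliPoly] using this
    rw [segInt_e_mul_bernoulliPoly_succ 0 hn, h0, incGamma_succ_eq]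
    have := Complex.I_ne_zero
    simp
    field_simp
  | succ k ih =>
    rw [segInt_e_mul_bernoulliPoly_succ (k + 1) hn, ih, incGamma_add_two]
    have hI : Complex.I ^ (k + 1) * Complex.I ^ (k + 1) = (-1) ^ (k + 1) := by
      rw [← mul_pow, Complex.I_mul_I]
    have hI0 : Complex.I ^ (k + 1) ≠ 0 := pow_ne_zero _ Complex.I_ne_zero
    have hI' : Complex.I ^ (k + 1) = (-1) ^ (k + 1) * (Complex.I ^ (k + 1))⁻¹ := by
      rw [← hI, mul_inv_cancel_right₀ hI0]
    rw [pow_succ Complex.I (k + 1), mul_inv, mul_pow (t : ℂ)]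
    generalize (Complex.I ^ (k + 1))⁻¹ = J at hI' ⊢
    rw [hI']
    have := Complex.I_ne_zero
    push_cast
    field_simp
    ring

/-- The height is constant along the segment and the Bernoulli polynomial sees only x, so everything
reduces to the previous evaluation at height 0, where the incomplete Gamma function is a factorial.
-/
theorem segInt_e_mul_bernoulliPoly_re (k d : ℕ) {n : ℤ} (hn : n ≠ 0) (t : ℝ) :
    segInt t (fun z => e (((-n : ℤ) : ℂ) * z) * bernoulliPoly (d + 1) z.re *
        ((-Complex.I * z.im) ^ (k + d + 1))⁻¹) =
      -(Real.exp (2 * Real.pi * n * t) * ((-Complex.I * t) ^ (k + d + 1))⁻¹ *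
        ((d + 1).factorial / (2 * Real.pi * Complex.I * n) ^ (d + 1))) := by
  have h1 : segInt t (fun z => e (((-n : ℤ) : ℂ) * z) * bernoulliPoly (d + 1) z.re *
        ((-Complex.I * z.im) ^ (k + d + 1))⁻¹) =
      Real.exp (2 * Real.pi * n * t) * ((-Complex.I * t) ^ (k + d + 1))⁻¹ *
        segInt 0 (fun z => e (((-n : ℤ) : ℂ) * z) * bernoulliPoly (d + 1) z) := by
    rw [segInt, segInt, ← intervalIntegral.integral_const_mul]
    refine intervalIntegral.integral_congr fun x _ => ?_
    simp only [re_ofReal_add_mul_I, im_ofReal_add_mul_I]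
    rw [mul_add, e_add, e_neg_mul_mul_I]
    simp only [Complex.ofReal_zero, zero_mul, add_zero]
    ring
  have hnC : (n : ℂ) ≠ 0 := by exact_mod_cast hn
  have hpi : (Real.pi : ℂ) ≠ 0 := by exact_mod_cast Real.pi_ne_zero
  have hI := Complex.I_ne_zero
  rw [h1, segInt_e_mul_bernoulliPoly d (neg_ne_zero.2 hn), incGamma_succ_eq]
  simp only [mul_zero, neg_zero, Real.exp_zero, Finset.sum_range_succ', Nat.factorial_zero]
  rw [neg_mul_eq_mul_neg]
  congr 1
  have h2 : ∑ j ∈ Finset.range d, (0 : ℝ) ^ (j + 1) / (j + 1).factorial = 0 :=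
    Finset.sum_eq_zero fun j _ => by simp
  rw [h2, Nat.factorial_succ, mul_pow (2 * Real.pi * Complex.I : ℂ), mul_pow (2 * Real.pi : ℂ)]
  push_cast
  rw [mul_neg, neg_pow (2 * Real.pi * n : ℂ), mul_pow (2 * Real.pi : ℂ) (n : ℂ)]
  have h3 : ((-1 : ℂ) ^ (d + 1)) = -(-1) ^ d := by ring
  have h4 : ((-1 : ℂ) ^ d) ≠ 0 := by simp
  rw [h3]
  field_simp
  simp

/-! ### The finite identity for the functions `𝓔_κ` -/

/-- Since j ≤ k, every inner range contains `range k`; the remaining indices are k + d with j + d ≤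
k, and the order of summation is exchanged on this triangle. -/
theorem sum_range_sub_comm {M : Type*} [AddCommMonoid M] [Module ℝ M] (k : ℕ) (C : ℕ → ℝ)
    (g : ℕ → M) :
    ∑ j ∈ Finset.range (k + 1), C j • ∑ i ∈ Finset.range (2 * k + 1 - j), g i =
      (∑ j ∈ Finset.range (k + 1), C j) • ∑ i ∈ Finset.range k, g i +
        ∑ d ∈ Finset.range (k + 1), (∑ j ∈ Finset.range (k - d + 1), C j) • g (k + d) := by
  have h1 : ∀ j ∈ Finset.range (k + 1), C j • ∑ i ∈ Finset.range (2 * k + 1 - j), g i =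
      C j • ∑ i ∈ Finset.range k, g i +
        ∑ d ∈ Finset.range (k + 1), if j + d ≤ k then C j • g (k + d) else 0 := by
    intro j hj
    have hj' : j ≤ k := by simpa [Nat.lt_succ_iff] using hj
    rw [show 2 * k + 1 - j = k + (k + 1 - j) by omega, Finset.sum_range_add, smul_add,
      ← Finset.sum_filter, Finset.smul_sum (s := Finset.range (k + 1 - j))]
    congr 1
    refine Finset.sum_congr ?_ fun _ _ => rfl
    ext d
    simp only [Finset.mem_range, Finset.mem_filter]
    omega
  rw [Finset.sum_congr rfl h1, Finset.sum_add_distrib, ← Finset.sum_smul, Finset.sum_comm]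
  congr 1
  refine Finset.sum_congr rfl fun d hd => ?_
  rw [← Finset.sum_filter, Finset.sum_smul]
  refine Finset.sum_congr ?_ fun _ _ => rfl
  ext j
  simp only [Finset.mem_range, Finset.mem_filter] at hd ⊢
  omega

/-- The factorials combine to binomial coefficients of 2k + 1, and the first half of that row sums
to 4^k. The split at inverse power k separates what the polygamma integral supplies from what the
Bernoulli integrals in x supply. -/
theorem sum_calE_eq (k : ℕ) (u : ℝ) :
    ∑ j ∈ Finset.range (k + 1), (-1) ^ j / j.factorial * calE (2 * k + 2 - j) u =
      (4 ^ k * (expInt u - Real.exp u * ∑ j ∈ Finset.range k, (u ^ (j + 1))⁻¹ * j.factorial) -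
        Real.exp u * ∑ d ∈ Finset.range (k + 1), (d + k).factorial *
          (∑ j ∈ Finset.range (k - d + 1), ((2 * k + 1).choose j : ℝ)) *
            (u ^ (k + d + 1))⁻¹) / (2 * k + 1).factorial := by
  have hF : ((2 * k + 1).factorial : ℝ) ≠ 0 := by positivity
  have h1 : ∀ j ∈ Finset.range (k + 1), (-1) ^ j / j.factorial * calE (2 * k + 2 - j) u =
      (((2 * k + 1).choose j : ℝ) * expInt u - Real.exp u * (((2 * k + 1).choose j : ℝ) •
        ∑ i ∈ Finset.range (2 * k + 1 - j), (u ^ (i + 1))⁻¹ * i.factorial)) /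
          (2 * k + 1).factorial := by
    intro j hj
    have hj' : j ≤ k := by simpa [Nat.lt_succ_iff] using hj
    have hch : ((2 * k + 1).choose j : ℝ) * (j.factorial * (2 * k + 1 - j).factorial) =
        (2 * k + 1).factorial := by
      rw [← mul_assoc]
      exact_mod_cast Nat.choose_mul_factorial_mul_factorial (show j ≤ 2 * k + 1 by omega)
    have hs : (-1 : ℝ) ^ j * (-1) ^ (2 * k + 2 - j + 1) = -1 := by
      rw [← pow_add, show j + (2 * k + 2 - j + 1) = 2 * (k + 1) + 1 by omega, pow_succ, pow_mul]
      simp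
    have hj0 : (j.factorial : ℝ) ≠ 0 := by positivity
    have hj1 : ((2 * k + 1 - j).factorial : ℝ) ≠ 0 := by positivity
    have hch0 : ((2 * k + 1).choose j : ℝ) ≠ 0 := by
      intro h; rw [h, zero_mul] at hch; exact hF hch.symm
    rw [calE, show 2 * k + 2 - j - 1 = 2 * k + 1 - j by omega, ← hch, smul_eq_mul]
    set S := ∑ i ∈ Finset.range (2 * k + 1 - j), (u ^ (i + 1))⁻¹ * (i.factorial : ℝ)
    rw [eq_div_iff (by positivity)]
    field_simp
    linear_combination (Real.exp u * S - expInt u) * hs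
  rw [Finset.sum_congr rfl h1, ← Finset.sum_div, Finset.sum_sub_distrib, ← Finset.sum_mul,
    ← Finset.mul_sum, sum_range_sub_comm]
  have h4 : ∑ j ∈ Finset.range (k + 1), ((2 * k + 1).choose j : ℝ) = 4 ^ k := by
    exact_mod_cast Nat.sum_range_choose_halfway k
  rw [h4]
  congr 1
  rw [smul_eq_mul, mul_add, mul_sub, sub_sub]
  congr 2
  · ring
  · congr 1
    refine Finset.sum_congr rfl fun d _ => ?_
    rw [smul_eq_mul, add_comm k d]
    ring

/-! ### Termwise integration of Fourier series -/

theorem norm_e_intCast_mul (n : ℤ) (z : ℂ) :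
    ‖e (n * z)‖ = Real.exp (-(2 * Real.pi * n * z.im)) := by
  rw [norm_e]
  have : ((n : ℂ) * z).im = n * z.im := by
    simp
  rw [this, mul_assoc]
  congr 1
  ring

/-- The frequencies are real, so the norm of each term is constant along the line; absolute
convergence at one point dominates the series on the whole segment. -/
theorem hasSum_segInt {ι : Type*} [Countable ι] {t : ℝ} {c : ι → ℂ} {ν : ι → ℤ} {F φ : ℂ → ℂ}
    (hF : ∀ z : ℂ, z.im = t → HasSum (fun i => c i * e (ν i * z)) (F z))
    (hφ : ContinuousOn φ {z | z.im = t}) :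
    HasSum (fun i => c i * segInt t fun z => e (ν i * z) * φ z) (segInt t fun z => F z * φ z) := by
  have hφc := continuous_comp_horizontal hφ
  obtain ⟨M, hM⟩ := isCompact_Icc.exists_bound_of_continuousOn (s := Icc (0 : ℝ) 1)
    hφc.continuousOn
  have hM0 : 0 ≤ M := (norm_nonneg _).trans (hM 0 ⟨le_rfl, zero_le_one⟩)
  have hnorm : ∀ i (x : ℝ), ‖c i * e (ν i * (x + t * Complex.I))‖ =
      ‖c i * e (ν i * (t * Complex.I))‖ := by
    intro i x
    rw [norm_mul, norm_mul, norm_e_intCast_mul, norm_e_intCast_mul]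
    simp
  have hs : Summable fun i => ‖c i * e (ν i * (t * Complex.I))‖ :=
    (hF (t * Complex.I) (by simp)).summable.norm
  have h := intervalIntegral.hasSum_integral_of_dominated_convergence (a := 0) (b := 1)
    (μ := volume)
    (F := fun i (x : ℝ) => c i * (e (ν i * (x + t * Complex.I)) * φ (x + t * Complex.I)))
    (f := fun x : ℝ => F (x + t * Complex.I) * φ (x + t * Complex.I))
    (fun i _ => ‖c i * e (ν i * (t * Complex.I))‖ * M) ?_ ?_ ?_ ?_ ?_
  · simpa only [segInt, ← intervalIntegral.integral_const_mul] using h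
  · intro i
    refine Continuous.aestronglyMeasurable ?_
    exact continuous_const.mul ((continuous_e.comp (by fun_prop)).mul hφc)
  · intro i
    refine Eventually.of_forall fun x hx => ?_
    rw [uIoc_of_le zero_le_one] at hx
    rw [← mul_assoc, norm_mul, hnorm]
    gcongr
    exact hM x ⟨hx.1.le, hx.2⟩
  · exact Eventually.of_forall fun x _ => hs.mul_right M
  · exact intervalIntegrable_const
  · refine Eventually.of_forall fun x _ => ?_
    have := (hF (x + t * Complex.I) (im_ofReal_add_mul_I x t)).mul_right
      (φ (x + t * Complex.I))
    simpa only [mul_assoc] using this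

/-- Outside a finite window `u` is either zero or the entire summand. This separates the a⁺ part of
an expansion from the a⁻ part. -/
theorem summable_of_add_of_eq_zero {u v : ℤ → ℂ} (h : Summable fun n => u n + v n)
    (hu : ∃ M : ℤ, ∀ n < M, u n = 0) (hv : ∃ M : ℤ, ∀ n > M, v n = 0) : Summable u := by
  obtain ⟨M, hM⟩ := hu
  obtain ⟨M', hM'⟩ := hv
  refine (h.indicator (Ioi M')).congr_cofinite ?_
  rw [EventuallyEq, eventually_cofinite]
  refine (finite_Icc M M').subset fun n hn => ?_
  by_contra hn'
  refine hn ?_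
  rw [mem_Icc, not_and_or, not_le, not_le] at hn'
  by_cases h1 : M' < n
  · rw [indicator_of_mem (mem_Ioi.2 h1), hM' n h1, add_zero]
  · rw [indicator_of_notMem (by simpa using h1), hM n (hn'.resolve_right h1)]

/-! ### The contribution of a single frequency -/

/-- The function multiplying `a⁻(n) e(nr)` in the part of the regularization which is not already
accounted for by Bernoulli polynomials; `w` is `2πn`. -/
noncomputable def regTail (k : ℕ) (w T : ℝ) : ℝ :=
  k.factorial / (2 ^ (2 * k + 1) * w ^ (k + 1)) *
    ∑ j ∈ Finset.range (k + 1), (-1) ^ j / j.factorial * calE (2 * k + 2 - j) (w * T)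

theorem conj_segInt_e_mul_symPolygamma (k : ℕ) {n : ℤ} (hn : n ≠ 0) {t : ℝ} (ht : 0 < t) :
    (starRingEnd ℂ) (segInt t (fun z => e (((-n : ℤ) : ℂ) * z) * symPolygamma k z)) =
      (-1) ^ k * Complex.I ^ k * ((2 * Real.pi * n) ^ k * (2 * (expInt (2 * Real.pi * n * t) -
        Real.exp (2 * Real.pi * n * t) * ∑ j ∈ Finset.range k,
          ((2 * Real.pi * n * t) ^ (j + 1))⁻¹ * j.factorial)) : ℝ) := by
  rw [segInt_e_mul_symPolygamma k hn ht]
  simp only [map_mul, map_pow, Complex.conj_ofReal, Complex.conj_I, map_ofNat, map_intCast]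
  push_cast
  rw [show (2 * Real.pi * -Complex.I * n : ℂ) = (-1) * Complex.I * (2 * Real.pi * n) by ring,
    mul_pow, mul_pow]
  ring

theorem conj_segInt_e_mul_bernoulliPoly_re (k d : ℕ) {n : ℤ} (hn : n ≠ 0) {t : ℝ} (ht : 0 < t) :
    (starRingEnd ℂ) (segInt t (fun z => e (((-n : ℤ) : ℂ) * z) * (bernoulliPoly (d + 1) z.re *
        ((-Complex.I * z.im) ^ (k + d + 1))⁻¹))) =
      -(-1) ^ k * Complex.I ^ k * ((2 * Real.pi * n) ^ k * (Real.exp (2 * Real.pi * n * t) *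
        ((2 * Real.pi * n * t) ^ (k + d + 1))⁻¹ * (d + 1).factorial) : ℝ) := by
  have hnC : (n : ℂ) ≠ 0 := by exact_mod_cast hn
  have hpi : (Real.pi : ℂ) ≠ 0 := by exact_mod_cast Real.pi_ne_zero
  have htC : (t : ℂ) ≠ 0 := by exact_mod_cast ht.ne'
  have hI := Complex.I_ne_zero
  have h0 := segInt_e_mul_bernoulliPoly_re k d hn t
  simp only [mul_assoc (e _)] at h0
  rw [h0]
  simp only [map_neg, map_mul, map_pow, map_inv₀, map_div₀, Complex.conj_ofReal, Complex.conj_I,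
    map_ofNat, map_intCast, map_natCast, neg_neg]
  have h1 : (Complex.I * t) ^ (k + d + 1) =
      Complex.I ^ k * (Complex.I ^ (d + 1) * t ^ (k + d + 1)) := by ring
  have h2 : (2 * Real.pi * -Complex.I * n : ℂ) ^ (d + 1) =
      (-1) ^ (d + 1) * (Complex.I ^ (d + 1) * (2 * Real.pi * n) ^ (d + 1)) := by
    rw [← mul_pow, ← mul_pow]; congr 1; ring
  have h3 : Complex.I ^ (d + 1) * Complex.I ^ (d + 1) = (-1) ^ (d + 1) := by
    rw [← mul_pow, Complex.I_mul_I]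
  have h4 : Complex.I ^ k * Complex.I ^ k = (-1) ^ k := by
    rw [← mul_pow, Complex.I_mul_I]
  have h5 : (2 * Real.pi * n * t : ℂ) ^ (k + d + 1) =
      (2 * Real.pi * n) ^ k * (2 * Real.pi * n) ^ (d + 1) * t ^ (k + d + 1) := by
    rw [← pow_add, ← add_assoc, mul_pow]
  have h6 : (-1 : ℂ) ^ (d + 1) * (-1) ^ (d + 1) = 1 := by rw [← mul_pow]; simp
  have h7 : (-1 : ℂ) ^ k * (-1) ^ k = 1 := by rw [← mul_pow]; simp
  rw [h1, h2]
  push_cast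
  rw [h5]
  have h8 : (2 * Real.pi * n : ℂ) ≠ 0 := mul_ne_zero (mul_ne_zero two_ne_zero hpi) hnC
  have g1 : (Complex.I ^ k)⁻¹ = (-1) ^ k * Complex.I ^ k := by
    rw [inv_eq_iff_eq_inv, eq_comm, inv_eq_iff_eq_inv, eq_comm]
    refine inv_eq_of_mul_eq_one_right ?_
    linear_combination (-1 : ℂ) ^ k * h4 + h7
  have g2 : (Complex.I ^ (d + 1))⁻¹ * ((-1) ^ (d + 1) * Complex.I ^ (d + 1))⁻¹ = 1 := by
    rw [← mul_inv, mul_left_comm, h3, h6, inv_one]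
  have g3 : (Complex.I ^ k * (Complex.I ^ (d + 1) * (t : ℂ) ^ (k + d + 1)))⁻¹ *
      ((d + 1).factorial / ((-1) ^ (d + 1) * (Complex.I ^ (d + 1) * (2 * Real.pi * n) ^ (d + 1)))) =
      ((Complex.I ^ k)⁻¹ * ((Complex.I ^ (d + 1))⁻¹ * ((-1) ^ (d + 1) * Complex.I ^ (d + 1))⁻¹)) *
        (((t : ℂ) ^ (k + d + 1))⁻¹ * ((d + 1).factorial / (2 * Real.pi * n) ^ (d + 1))) := by
    rw [div_eq_mul_inv, div_eq_mul_inv]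
    simp only [mul_inv]
    ring
  rw [mul_assoc, g3, g1, g2]
  field_simp

/-- The polygamma and Bernoulli integrals which appear for the frequency `n` add up to the tail of
the regularization. -/
theorem regTail_eq (k : ℕ) {α : ℝ} (hα : 0 < α) {n : ℤ} (hn : n ≠ 0) {T : ℝ} (hT : 0 < T) :
    (-1) ^ k * ((Complex.I * α) ^ k)⁻¹ *
        ((2 : ℂ) ^ (2 * (k : ℤ) - 1) * k.factorial / (2 * k + 1).factorial) *
        (starRingEnd ℂ) (segInt (T / α) (fun z => e (((-n : ℤ) : ℂ) * z) * symPolygamma k z)) +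
      (-1) ^ k * ((Complex.I * α) ^ k)⁻¹ * ((k.factorial : ℂ) / (2 * k + 1).factorial) *
        ∑ d ∈ Finset.range (k + 1), ((d + k).factorial : ℂ) / (d + 1).factorial *
          (∑ j ∈ Finset.range (k - d + 1), ((2 * k + 1).choose j : ℂ)) *
          (starRingEnd ℂ) (segInt (T / α) (fun z => e (((-n : ℤ) : ℂ) * z) *
            (bernoulliPoly (d + 1) z.re * ((-Complex.I * z.im) ^ (k + d + 1))⁻¹))) =
      ((4 * Real.pi * (n / α)) ^ (2 * k + 1) * regTail k (2 * Real.pi * (n / α)) T : ℝ) := by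
  have ht : 0 < T / α := div_pos hT hα
  have hI : ((-1) ^ k : ℂ) * ((Complex.I * α) ^ k)⁻¹ * ((-1) ^ k * Complex.I ^ k) =
      ((α : ℂ) ^ k)⁻¹ := by
    have h7 : (-1 : ℂ) ^ k * (-1) ^ k = 1 := by rw [← mul_pow]; simp
    have h8 : Complex.I ^ k ≠ 0 := pow_ne_zero _ Complex.I_ne_zero
    rw [mul_pow, mul_inv]
    linear_combination ((-1 : ℂ) ^ k * (-1) ^ k * ((α : ℂ) ^ k)⁻¹) * mul_inv_cancel₀ h8 +
      ((α : ℂ) ^ k)⁻¹ * h7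
  have hnR : (n : ℝ) ≠ 0 := by exact_mod_cast hn
  have hpi := Real.pi_ne_zero
  have hu : 2 * Real.pi * n * (T / α) = 2 * Real.pi * (n / α) * T := by ring
  rw [conj_segInt_e_mul_symPolygamma k hn ht]
  simp only [conj_segInt_e_mul_bernoulliPoly_re k _ hn ht]
  -- An integer power, since the exponent is -1 for k = 0; with the factor 2 of the polygamma
  -- integral it becomes the 4^k of `sum_calE_eq`.
  have h2 : (2 : ℂ) ^ (2 * (k : ℤ) - 1) = ((4 ^ k / 2 : ℝ) : ℂ) := by
    rw [zpow_sub₀ two_ne_zero, zpow_mul, zpow_natCast, zpow_ofNat, zpow_one]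
    push_cast
    norm_num
  rw [h2, regTail, sum_calE_eq, hu]
  set u := 2 * Real.pi * (n / α) * T with hu_def
  set L := expInt u - Real.exp u * ∑ j ∈ Finset.range k, (u ^ (j + 1))⁻¹ * j.factorial
  have hsum : ∑ d ∈ Finset.range (k + 1), ((d + k).factorial : ℂ) / (d + 1).factorial *
          (∑ j ∈ Finset.range (k - d + 1), ((2 * k + 1).choose j : ℂ)) *
          (-(-1) ^ k * Complex.I ^ k * ((2 * Real.pi * n) ^ k * (Real.exp u *
        (u ^ (k + d + 1))⁻¹ * (d + 1).factorial) : ℝ)) =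
      -((-1) ^ k * Complex.I ^ k) * ((2 * Real.pi * n) ^ k * (Real.exp u *
        ∑ d ∈ Finset.range (k + 1), (d + k).factorial *
          (∑ j ∈ Finset.range (k - d + 1), ((2 * k + 1).choose j : ℝ)) *
            (u ^ (k + d + 1))⁻¹) : ℝ) := by
    push_cast
    simp only [Finset.mul_sum (s := Finset.range (k + 1))]
    refine Finset.sum_congr rfl fun d _ => ?_
    have : ((d + 1).factorial : ℂ) ≠ 0 := by exact_mod_cast (d + 1).factorial_ne_zero
    field_simp
  rw [hsum]
  set B := Real.exp u * ∑ d ∈ Finset.range (k + 1), (d + k).factorial *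
          (∑ j ∈ Finset.range (k - d + 1), ((2 * k + 1).choose j : ℝ)) * (u ^ (k + d + 1))⁻¹
  have hF : ((2 * k + 1).factorial : ℝ) ≠ 0 := by positivity
  have hreal : (α ^ k)⁻¹ * (2 * Real.pi * n) ^ k * (4 ^ k * L - B) * k.factorial /
        (2 * k + 1).factorial =
      (4 * Real.pi * (n / α)) ^ (2 * k + 1) * (k.factorial /
        (2 ^ (2 * k + 1) * (2 * Real.pi * (n / α)) ^ (k + 1)) *
          ((4 ^ k * L - B) / (2 * k + 1).factorial)) := by
    have h1 : (4 * Real.pi * (n / α)) ^ (2 * k + 1) =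
        2 ^ (2 * k + 1) * (2 * Real.pi * (n / α)) ^ (k + 1) * (2 * Real.pi * (n / α)) ^ k := by
      rw [show 4 * Real.pi * (n / α) = 2 * (2 * Real.pi * (n / α)) by ring, mul_pow]
      ring
    have h3 : (α ^ k)⁻¹ * (2 * Real.pi * n) ^ k = (2 * Real.pi * (n / α)) ^ k := by
      rw [← mul_div_assoc, div_pow]; ring
    rw [h1, h3]
    have : (2 * Real.pi * (n / α)) ^ (k + 1) ≠ 0 := by positivity
    field_simp
  rw [← hreal]
  push_cast
  linear_combination ((2 * Real.pi * n : ℂ) ^ k * (4 ^ k * L - B) * k.factorial /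
        (2 * k + 1).factorial) * hI

theorem hasSum_ne_zero {f : ℤ → ℂ} {s : ℂ} (h : HasSum f s) :
    HasSum (fun n : {n : ℤ // n ≠ 0} => f n) (s - f 0) := by
  have h1 := h.sub (hasSum_ite_eq (0 : ℤ) (f 0))
  have h2 : Function.support (fun n : ℤ => f n - if n = 0 then f 0 else 0) ⊆ {n | n ≠ 0} := by
    intro n hn h0
    exact hn (by simp only [h0]; simp)
  refine ((hasSum_subtype_iff_of_support_subset h2).2 h1).congr_fun fun n => ?_
  simp [show (n : ℤ) ≠ 0 from n.2]

theorem summable_int_iff_ne_zero {f : ℤ → ℂ} :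
    Summable f ↔ Summable (fun n : {n : ℤ // n ≠ 0} => f n) := by
  have : ({0}ᶜ : Set ℤ) = {n | n ≠ 0} := rfl
  exact ((Set.finite_singleton (0 : ℤ)).summable_compl_iff (f := f)).symm

/-! ### The expansion of `ξ_{2k+2} G` -/

/-- The coefficients of the expansion of `ξ_{2k+2} G` without its constant term. -/
noncomputable def xiCoeff (k α : ℕ) (b : ℤ → ℂ) (n : ℤ) : ℂ :=
  if n = 0 then 0 else
    (((4 * Real.pi * (n / α)) ^ (2 * k + 1))⁻¹ : ℝ) * (starRingEnd ℂ) (b n)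

/-- `F` has the expansion `ξa₀ + ∑ (4πn/α)^{-1-2k} conj(a⁻(n)) e(-nz/α)`. -/
def IsXiExpansion (k α : ℕ) (b : ℤ → ℂ) (ξa₀ : ℂ) (F : ℍ → ℂ) : Prop :=
  ∀ z : ℍ, HasSum (fun n : ℤ => xiCoeff k α b n * e (-(n / α * z))) (F z - ξa₀)

theorem ext_of_im_pos (F : ℍ → ℂ) {z : ℂ} (hz : 0 < z.im) : ext F z = F ⟨z, hz⟩ := by
  rw [ext, UpperHalfPlane.ofComplex_apply_of_im_pos hz]

theorem im_add_natCast_mul {α : ℕ} (hα : 0 < α) (r T : ℝ) {z : ℂ} (hz : z.im = T / α) :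
    ((r : ℂ) + α * z).im = T := by
  have hα' : (α : ℝ) ≠ 0 := by exact_mod_cast hα.ne'
  have : ((α : ℂ) * z).im = α * z.im := by simp
  rw [Complex.add_im, this, hz, Complex.ofReal_im, zero_add, mul_div_cancel₀ _ hα']

theorem IsXiExpansion.hasSum_segment {k α : ℕ} (hα : 0 < α) {b : ℤ → ℂ} {ξa₀ : ℂ} {F : ℍ → ℂ}
    (h : IsXiExpansion k α b ξa₀ F) (r : ℝ) {T : ℝ} (hT : 0 < T) (z : ℂ) (hz : z.im = T / α) :
    HasSum (fun n : ℤ => xiCoeff k α b n * e (-(n / α * r)) * e (((-n : ℤ) : ℂ) * z))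
      (ext F (r + α * z) - ξa₀) := by
  have hαC : (α : ℂ) ≠ 0 := by exact_mod_cast hα.ne'
  have him : 0 < ((r : ℂ) + α * z).im := by rwa [im_add_natCast_mul hα r T hz]
  rw [ext_of_im_pos F him]
  refine (h ⟨_, him⟩).congr_fun fun n => ?_
  rw [mul_assoc, ← e_add]
  congr 2
  simp only
  push_cast
  field_simp
  ring

/-- Conjugation turns the coefficients of `F` back into a⁻(n) e(nr/α), divided by (4πn/α)^(2k+1);
`regTail_eq` restores precisely this factor, frequency by frequency. -/
theorem IsXiExpansion.hasSum_regTail {k α : ℕ} (hα : 0 < α) {b : ℤ → ℂ} {ξa₀ : ℂ} {F : ℍ → ℂ}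
    (h : IsXiExpansion k α b ξa₀ F) (r : ℝ) {T : ℝ} (hT : 0 < T) :
    HasSum (fun n : {n : ℤ // n ≠ 0} => b n * e ((n : ℤ) / α * r) *
        (regTail k (2 * Real.pi * ((n : ℤ) / α)) T : ℝ))
      ((-1) ^ k * ((Complex.I * α) ^ k)⁻¹ *
        ((2 : ℂ) ^ (2 * (k : ℤ) - 1) * k.factorial / (2 * k + 1).factorial) *
        (starRingEnd ℂ) (segInt (T / α) (fun z =>
          (ext F (r + α * z) - ξa₀) * (polygamma k z + (-1) ^ k * polygamma k (1 - z)))) +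
      (-1) ^ k * ((Complex.I * α) ^ k)⁻¹ * ((k.factorial : ℂ) / (2 * k + 1).factorial) *
        ∑ d ∈ Finset.range (k + 1), ((d + k).factorial : ℂ) / (d + 1).factorial *
          (∑ j ∈ Finset.range (k - d + 1), ((2 * k + 1).choose j : ℂ)) *
          (starRingEnd ℂ) (segInt (T / α) (fun z =>
            (ext F (r + α * z) - ξa₀) * bernoulliPoly (d + 1) z.re *
              ((-Complex.I * z.im) ^ (k + d + 1))⁻¹))) := by
  have hαR : (0 : ℝ) < α := by exact_mod_cast hα
  have ht : 0 < T / α := div_pos hT hαR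
  have hF := h.hasSum_segment hα r hT
  have h1 := hasSum_segInt hF (continuousOn_symPolygamma k ht.ne')
  have h2 : ∀ d, HasSum _ _ := fun d => hasSum_segInt (F := fun z => ext F (r + α * z) - ξa₀) hF
    (φ := fun z : ℂ => bernoulliPoly (d + 1) z.re * ((-Complex.I * z.im) ^ (k + d + 1))⁻¹) (by
      refine ContinuousOn.mul ?_ (ContinuousOn.inv₀ (by fun_prop) fun z hz => ?_)
      · exact ((continuous_bernoulliPoly _).comp
          (Complex.continuous_ofReal.comp Complex.continuous_re)).continuousOn
      · rw [show z.im = T / α from hz]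
        refine pow_ne_zero _ (mul_ne_zero (neg_ne_zero.2 Complex.I_ne_zero) ?_)
        exact_mod_cast ht.ne')
  have h1' := ((Complex.hasSum_conj'.2 h1).mul_left ((-1) ^ k * ((Complex.I * α) ^ k)⁻¹ *
    ((2 : ℂ) ^ (2 * (k : ℤ) - 1) * k.factorial / (2 * k + 1).factorial)))
  have h2' := (hasSum_sum fun d (_ : d ∈ Finset.range (k + 1)) =>
    (Complex.hasSum_conj'.2 (h2 d)).mul_left (((d + k).factorial : ℂ) / (d + 1).factorial *
          (∑ j ∈ Finset.range (k - d + 1), ((2 * k + 1).choose j : ℂ)))).mul_left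
    ((-1) ^ k * ((Complex.I * α) ^ k)⁻¹ * ((k.factorial : ℂ) / (2 * k + 1).factorial))
  have h3 := hasSum_ne_zero (h1'.add h2')
  have h0 : xiCoeff k α b 0 = 0 := by simp [xiCoeff]
  simp only [h0, zero_mul, map_zero, mul_zero, Finset.sum_const_zero, add_zero, sub_zero] at h3
  have hassoc : ∀ d (z : ℂ), (ext F (r + α * z) - ξa₀) * bernoulliPoly (d + 1) z.re *
      ((-Complex.I * z.im) ^ (k + d + 1))⁻¹ = (ext F (r + α * z) - ξa₀) *
        (bernoulliPoly (d + 1) z.re * ((-Complex.I * z.im) ^ (k + d + 1))⁻¹) :=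
    fun d z => mul_assoc _ _ _
  simp only [hassoc]
  refine h3.congr_fun fun n => ?_
  have hn : (n : ℤ) ≠ 0 := n.2
  have hnR : ((n : ℤ) : ℝ) ≠ 0 := by exact_mod_cast hn
  have hp : (4 * Real.pi * (((n : ℤ) : ℝ) / α)) ^ (2 * k + 1) ≠ 0 := by
    have := Real.pi_pos
    positivity
  have hconj : (starRingEnd ℂ) (xiCoeff k α b n * e (-((n : ℤ) / α * r))) =
      (((4 * Real.pi * (((n : ℤ) : ℝ) / α)) ^ (2 * k + 1))⁻¹ : ℝ) * (b n * e ((n : ℤ) / α * r)) := by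
    rw [map_mul, xiCoeff, if_neg hn, map_mul, Complex.conj_ofReal, Complex.conj_conj, conj_e,
      mul_assoc]
    simp
  simp only [map_mul (starRingEnd ℂ) (xiCoeff k α b n * e (-((n : ℤ) / α * r))), hconj]
  have h5 := regTail_eq k hαR hn hT
  have h6 : (b n * e ((n : ℤ) / α * r)) * (regTail k (2 * Real.pi * ((n : ℤ) / α)) T : ℝ) =
      (((4 * Real.pi * (((n : ℤ) : ℝ) / α)) ^ (2 * k + 1))⁻¹ : ℝ) * (b n * e ((n : ℤ) / α * r)) *
        ((4 * Real.pi * (((n : ℤ) : ℝ) / α)) ^ (2 * k + 1) *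
          regTail k (2 * Real.pi * ((n : ℤ) / α)) T : ℝ) := by
    generalize (4 * Real.pi * (((n : ℤ) : ℝ) / α)) ^ (2 * k + 1) = P at hp
    have hp' : (P : ℂ) ≠ 0 := by exact_mod_cast hp
    push_cast
    linear_combination -(b n * e ((n : ℤ) / α * r) *
      (regTail k (2 * Real.pi * ((n : ℤ) / α)) T : ℂ)) * inv_mul_cancel₀ hp'
  rw [h6, ← h5]
  simp only [Complex.ofReal_natCast]
  rw [mul_add, Finset.mul_sum, Finset.mul_sum, Finset.mul_sum]
  congr 1
  · ring
  · refine Finset.sum_congr rfl fun d _ => ?_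
    ring

/-! ### The Bernoulli part -/

theorem IsFourierExpansion.hasSum_ext {k α : ℕ} {g : ℍ → ℂ} {a b : ℤ → ℂ}
    (h : IsFourierExpansion k α g a b) {z : ℂ} (hz : 0 < z.im) :
    HasSum (fun n : {n : ℤ // n ≠ 0} =>
      (a n + b n * (calE (2 * k + 2) (4 * Real.pi * ((n : ℤ) / α) * z.im) : ℝ)) *
        e ((n : ℤ) / α * z)) (ext g z - (a 0 + b 0 * ((z.im ^ (2 * k + 1))⁻¹ : ℝ))) := by
  have h1 := hasSum_ne_zero (h.hasSum ⟨z, hz⟩)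
  rw [ext_of_im_pos g hz]
  simp only [if_true, Int.cast_zero, zero_div, zero_mul, e_zero, mul_one] at h1
  refine h1.congr_fun fun n => ?_
  simp only [if_neg n.2]
  rfl

/-- After subtraction of the a⁻(0) term, the zeroth coefficient on the line is a⁺(0), which
`segInt_bernoulliPoly` converts into the correction on the right. The other frequencies give
incomplete Gamma functions, and α^(k+1) rescales n to n/α. -/
theorem IsFourierExpansion.hasSum_bernoulli {k α : ℕ} (hα : 0 < α) {g : ℍ → ℂ} {a b : ℤ → ℂ}
    (h : IsFourierExpansion k α g a b) (r : ℝ) {T : ℝ} (hT : 0 < T) :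
    HasSum (fun n : {n : ℤ // n ≠ 0} =>
        (a n + b n * (calE (2 * k + 2) (2 * (2 * Real.pi * ((n : ℤ) / α) * T)) : ℝ)) *
          e ((n : ℤ) / α * r) *
        (incGamma (k + 1) (2 * Real.pi * ((n : ℤ) / α) * T) /
          (2 * Real.pi * ((n : ℤ) / α)) ^ (k + 1) : ℝ))
      ((-1) ^ k * ((Complex.I * α) ^ (k + 1) / (k + 1)) *
        segInt (T / α) (fun z =>
          (ext g (r + α * z) - b 0 * (((α * z.im) ^ (2 * k + 1))⁻¹ : ℝ)) *
            bernoulliPoly (k + 1) z) + a 0 * (T ^ (k + 1) / (k + 1) : ℝ)) := by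
  have hαR : (α : ℝ) ≠ 0 := by exact_mod_cast hα.ne'
  have hαC : (α : ℂ) ≠ 0 := by exact_mod_cast hα.ne'
  have hk : (k + 1 : ℂ) ≠ 0 := by exact_mod_cast k.succ_ne_zero
  have hF : ∀ z : ℂ, z.im = T / α → HasSum (fun n : ℤ =>
      (a n + b n * (if n = 0 then 0 else
        calE (2 * k + 2) (2 * (2 * Real.pi * (n / α) * T)) : ℝ)) *
          e (n / α * r) * e (n * z))
      (ext g (r + α * z) - b 0 * (((α * z.im) ^ (2 * k + 1))⁻¹ : ℝ)) := by
    intro z hz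
    have him := im_add_natCast_mul hα r T hz
    have him0 : 0 < ((r : ℂ) + α * z).im := by rwa [him]
    have h1 := (h.hasSum ⟨_, him0⟩).sub
      (hasSum_ite_eq (0 : ℤ) (b 0 * (((α * z.im) ^ (2 * k + 1))⁻¹ : ℝ)))
    rw [ext_of_im_pos g him0]
    refine h1.congr_fun fun n => ?_
    have hT' : UpperHalfPlane.im ⟨_, him0⟩ = T := him
    have he : e (n / α * ((r : ℂ) + α * z)) = e (n / α * r) * e (n * z) := by
      rw [← e_add]; congr 1; field_simp
    rw [hT', hz, mul_div_cancel₀ _ hαR]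
    change _ = _ * e (n / α * ((r : ℂ) + α * z)) - _
    rw [he, show 2 * (2 * Real.pi * (n / α) * T) = 4 * Real.pi * (n / α) * T by ring]
    by_cases hn : n = 0
    · subst hn
      simp [e_zero]
    · simp only [if_neg hn]
      ring
  have h1 := hasSum_ne_zero ((hasSum_segInt hF
    (continuous_bernoulliPoly (k + 1)).continuousOn).mul_left
    ((-1) ^ k * ((Complex.I * α) ^ (k + 1) / (k + 1))))
  have hneg : ((-1) ^ k : ℂ) * (Complex.I ^ (k + 1) * Complex.I ^ (k + 1)) = -1 := by
    rw [← mul_pow, Complex.I_mul_I, pow_succ, ← mul_assoc, ← mul_pow]; simp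
  have hone : ((-1) ^ k : ℂ) * (-1) ^ k = 1 := by rw [← mul_pow]; simp
  have h0 : (-1) ^ k * ((Complex.I * α) ^ (k + 1) / (k + 1)) *
      ((a 0 + b 0 * (if (0 : ℤ) = 0 then 0 else
        calE (2 * k + 2) (2 * (2 * Real.pi * ((0 : ℤ) / α) * T)) : ℝ)) *
          e (((0 : ℤ) : ℂ) / α * r) *
        segInt (T / α) fun z => e (((0 : ℤ) : ℂ) * z) * bernoulliPoly (k + 1) z) =
      -(a 0 * (T ^ (k + 1) / (k + 1) : ℝ)) := by
    simp only [Int.cast_zero, zero_mul, zero_div, e_zero, one_mul, if_true, segInt_bernoulliPoly]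
    rw [mul_pow, mul_pow]
    push_cast
    rw [div_pow]
    field_simp
    linear_combination a 0 * (T : ℂ) ^ (k + 1) * hneg
  rw [h0, sub_neg_eq_add] at h1
  refine h1.congr_fun fun n => ?_
  have hn : (n : ℤ) ≠ 0 := n.2
  have hnC : ((n : ℤ) : ℂ) ≠ 0 := by exact_mod_cast hn
  have hpi : (Real.pi : ℂ) ≠ 0 := by exact_mod_cast Real.pi_ne_zero
  have hI0 : Complex.I ^ (k + 1) ≠ 0 := pow_ne_zero _ Complex.I_ne_zero
  rw [segInt_e_mul_bernoulliPoly k hn, if_neg hn,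
    show 2 * Real.pi * ((n : ℤ) : ℝ) * (T / α) = 2 * Real.pi * ((n : ℤ) / α) * T by ring,
    mul_pow Complex.I]
  have h2 : (incGamma (k + 1) (2 * Real.pi * ((n : ℤ) / α) * T) /
      (2 * Real.pi * ((n : ℤ) / α)) ^ (k + 1) : ℝ) = (α : ℝ) ^ (k + 1) *
      (incGamma (k + 1) (2 * Real.pi * ((n : ℤ) / α) * T) / (2 * Real.pi * (n : ℤ)) ^ (k + 1)) := by
    rw [← mul_div_assoc (2 * Real.pi), div_pow]
    field_simp
  rw [h2]
  generalize a n + b n *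
    (calE (2 * k + 2) (2 * (2 * Real.pi * ((n : ℤ) / α) * T)) : ℂ) = A
  generalize e ((n : ℤ) / α * r) = E
  generalize incGamma (k + 1) (2 * Real.pi * ((n : ℤ) / α) * T) = Y
  push_cast
  field_simp
  linear_combination (-(A * E * Y)) * hone

/-! ### Independence of the truncation height -/

/-- The contribution of the frequency `n / α` to the regularization. -/
noncomputable def regTerm (k α : ℕ) (a b : ℤ → ℂ) (r : ℝ) (n : ℤ) (T : ℝ) : ℂ :=
  a n * e (n / α * r) *
      (incGamma (k + 1) (2 * Real.pi * (n / α) * T) / (2 * Real.pi * (n / α)) ^ (k + 1) : ℝ) +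
    b n * e (n / α * r) *
      (calE (2 * k + 2) (2 * (2 * Real.pi * (n / α) * T)) *
        (incGamma (k + 1) (2 * Real.pi * (n / α) * T) / (2 * Real.pi * (n / α)) ^ (k + 1)) -
          regTail k (2 * Real.pi * (n / α)) T : ℝ)

/-- The regularization contains two separate series, whereas termwise integration yields only the
combined one; the one-sided supports allow it to be split. -/
theorem IsFourierExpansion.summable_plus {k α : ℕ} (hα : 0 < α) {g : ℍ → ℂ} {a b : ℤ → ℂ}
    (h : IsFourierExpansion k α g a b) (r : ℝ) {T : ℝ} (hT : 0 < T) :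
    Summable (fun n : {n : ℤ // n ≠ 0} => a n * e ((n : ℤ) / α * r) *
      (incGamma (k + 1) (2 * Real.pi * ((n : ℤ) / α) * T) /
        (2 * Real.pi * ((n : ℤ) / α)) ^ (k + 1) : ℝ)) := by
  have h1 := (h.hasSum_bernoulli hα r hT).summable
  have h2 := (summable_int_iff_ne_zero (f := fun n : ℤ =>
        (a n + b n * (calE (2 * k + 2) (2 * (2 * Real.pi * (n / α) * T)) : ℝ)) *
          e (n / α * r) * (incGamma (k + 1) (2 * Real.pi * (n / α) * T) /
          (2 * Real.pi * (n / α)) ^ (k + 1) : ℝ))).2 h1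
  simp only [add_mul] at h2
  refine (summable_int_iff_ne_zero (f := fun n : ℤ => a n * e (n / α * r) *
      (incGamma (k + 1) (2 * Real.pi * (n / α) * T) /
        (2 * Real.pi * (n / α)) ^ (k + 1) : ℝ))).1 (summable_of_add_of_eq_zero h2 ?_ ?_)
  · obtain ⟨M, hM⟩ := h.plus_eq_zero
    exact ⟨M, fun n hn => by rw [hM n hn]; simp⟩
  · obtain ⟨M, hM⟩ := h.minus_eq_zero
    exact ⟨M, fun n hn => by rw [hM n hn]; simp⟩

theorem hasSum_regTerm {k α : ℕ} (hα : 0 < α) {g F : ℍ → ℂ} {a b : ℤ → ℂ} {ξa₀ : ℂ}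
    (h : IsFourierExpansion k α g a b) (hξ : IsXiExpansion k α b ξa₀ F)
    (r : ℝ) {T : ℝ} (hT : 0 < T) :
    HasSum (fun n : {n : ℤ // n ≠ 0} => regTerm k α a b r n T)
      ((-1) ^ k * ((Complex.I * α) ^ (k + 1) / (k + 1)) *
        segInt (T / α) (fun z =>
          (ext g (r + α * z) - b 0 * (((α * z.im) ^ (2 * k + 1))⁻¹ : ℝ)) *
            bernoulliPoly (k + 1) z) + a 0 * (T ^ (k + 1) / (k + 1) : ℝ) -
      ((-1) ^ k * ((Complex.I * α) ^ k)⁻¹ *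
        ((2 : ℂ) ^ (2 * (k : ℤ) - 1) * k.factorial / (2 * k + 1).factorial) *
        (starRingEnd ℂ) (segInt (T / α) (fun z =>
          (ext F (r + α * z) - ξa₀) * (polygamma k z + (-1) ^ k * polygamma k (1 - z)))) +
      (-1) ^ k * ((Complex.I * α) ^ k)⁻¹ * ((k.factorial : ℂ) / (2 * k + 1).factorial) *
        ∑ d ∈ Finset.range (k + 1), ((d + k).factorial : ℂ) / (d + 1).factorial *
          (∑ j ∈ Finset.range (k - d + 1), ((2 * k + 1).choose j : ℂ)) *
          (starRingEnd ℂ) (segInt (T / α) (fun z =>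
            (ext F (r + α * z) - ξa₀) * bernoulliPoly (d + 1) z.re *
              ((-Complex.I * z.im) ^ (k + d + 1))⁻¹)))) := by
  refine ((h.hasSum_bernoulli hα r hT).sub (hξ.hasSum_regTail hα r hT)).congr_fun fun n => ?_
  rw [regTerm]
  push_cast
  ring

theorem tsum_add_tsum_eq_tsum_regTerm {k α : ℕ} (hα : 0 < α) {g F : ℍ → ℂ} {a b : ℤ → ℂ}
    {ξa₀ : ℂ} (h : IsFourierExpansion k α g a b) (hξ : IsXiExpansion k α b ξa₀ F)
    (r : ℝ) {T : ℝ} (hT : 0 < T) :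
    (∑' n : {n : ℤ // n ≠ 0}, a n * e ((n : ℤ) / α * r) *
        (incGamma (k + 1) (2 * Real.pi * ((n : ℤ) / α) * T) /
          (2 * Real.pi * ((n : ℤ) / α)) ^ (k + 1) : ℝ)) +
      ∑' n : {n : ℤ // n ≠ 0}, b n * e ((n : ℤ) / α * r) *
      (calE (2 * k + 2) (2 * (2 * Real.pi * ((n : ℤ) / α) * T)) *
        (incGamma (k + 1) (2 * Real.pi * ((n : ℤ) / α) * T) /
          (2 * Real.pi * ((n : ℤ) / α)) ^ (k + 1)) -
          regTail k (2 * Real.pi * ((n : ℤ) / α)) T : ℝ) =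
      ∑' n : {n : ℤ // n ≠ 0}, regTerm k α a b r n T := by
  have h1 := h.summable_plus hα r hT
  have h2 := (hasSum_regTerm hα h hξ r hT).summable
  rw [← Summable.tsum_add h1]
  · rfl
  · refine (h2.sub h1).congr fun n => ?_
    rw [regTerm]
    ring

/-! ### Normal convergence on vertical segments and differentiation in the height -/

theorem calE_bounds (m : ℕ) {y : ℝ} (hy : y < 0) :
    0 ≤ calE (2 * m + 2) y ∧ calE (2 * m + 2) y ≤ Real.exp y * (y ^ (2 * m + 2))⁻¹ := by
  have hev : Even (2 * m + 2) := ⟨m + 1, by ring⟩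
  have hd : ∀ x : ℝ, x < 0 → HasDerivAt (calE (2 * m + 2))
      (Real.exp x * (x ^ (2 * m + 2))⁻¹) x := by
    intro x hx
    refine (hasDerivAt_calE (by omega) hx.ne).congr_deriv ?_
    rw [hev.neg_one_pow, one_mul]
  -- A function increasing from the limit 0 at -∞ is nonnegative; this is applied to `calE` and to
  -- the gap between the two sides of the upper bound.
  have hmono : ∀ {f f' : ℝ → ℝ}, (∀ x, x < 0 → HasDerivAt f (f' x) x) → (∀ x, x < 0 → 0 ≤ f' x) →
      Tendsto f atBot (𝓝 0) → 0 ≤ f y := by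
    intro f f' hf hf' hlim
    have hm : MonotoneOn f (Iio 0) := by
      refine monotoneOn_of_hasDerivWithinAt_nonneg (f' := f') (convex_Iio 0)
        (fun x hx => (hf x hx).continuousAt.continuousWithinAt)
        (fun x hx => (hf x (mem_Iio.1 (interior_subset hx))).hasDerivWithinAt) fun x hx =>
          hf' x (mem_Iio.1 (interior_subset hx))
    refine le_of_tendsto hlim ?_
    filter_upwards [Iic_mem_atBot y] with x hx
    exact hm (lt_of_le_of_lt hx hy) hy hx
  refine ⟨hmono hd (fun x _ => mul_nonneg (Real.exp_pos x).le
    (inv_nonneg.2 (hev.pow_nonneg x))) (tendsto_calE_atBot _), ?_⟩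
  rw [← sub_nonneg]
  have hodd : Odd (2 * m + 2 + 1) := hev.add_one
  refine hmono (f := fun x => Real.exp x * (x ^ (2 * m + 2))⁻¹ - calE (2 * m + 2) x)
    (f' := fun x => -((2 * m + 2 : ℕ) * Real.exp x * (x ^ (2 * m + 2 + 1))⁻¹)) ?_ ?_ ?_
  · intro x hx
    have h1 := ((Real.hasDerivAt_exp x).mul
      ((hasDerivAt_pow (2 * m + 2) x).inv (pow_ne_zero _ hx.ne))).sub (hd x hx)
    refine h1.congr_deriv ?_
    rw [show 2 * m + 2 - 1 = 2 * m + 1 by omega]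
    have := hx.ne
    simp only [Pi.inv_apply]
    field_simp
    ring
  · intro x hx
    have h1 : x ^ (2 * m + 2 + 1) < 0 := hodd.pow_neg hx
    have h2 : (x ^ (2 * m + 2 + 1))⁻¹ < 0 := inv_lt_zero.2 h1
    have : 0 ≤ ((2 * m + 2 : ℕ) : ℝ) * Real.exp x := by positivity
    simp only [Left.nonneg_neg_iff]
    exact mul_nonpos_of_nonneg_of_nonpos this h2.le
  · have h1 : Tendsto (fun x : ℝ => Real.exp x * (x⁻¹) ^ (2 * m + 2)) atBot
        (𝓝 (0 * 0 ^ (2 * m + 2))) :=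
      Real.tendsto_exp_atBot.mul (tendsto_inv_atBot_zero.pow _)
    have h2 := h1.sub (tendsto_calE_atBot (2 * m + 2))
    simpa using h2

/-- The value at height `y` of the summand with frequency `n / α` in a Fourier expansion. -/
noncomputable def verticalTerm (k α : ℕ) (a b : ℤ → ℂ) (r : ℝ) (n : ℤ) (y : ℝ) : ℂ :=
  (a n + b n * (calE (2 * k + 2) (2 * (2 * Real.pi * (n / α) * y)) : ℝ)) * e (n / α * r) *
    (Real.exp (-(2 * Real.pi * (n / α) * y)) : ℝ)

theorem e_mul_add_mul_I (α : ℕ) (n : ℤ) (r y : ℝ) :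
    e (n / α * (r + y * Complex.I)) =
      e (n / α * r) * (Real.exp (-(2 * Real.pi * (n / α) * y)) : ℝ) := by
  rw [mul_add, e_add]
  congr 1
  have := e_ofReal_mul_I (n / α * y)
  push_cast at this ⊢
  rw [← mul_assoc, this]
  congr 1
  ring

theorem IsFourierExpansion.hasSum_verticalTerm {k α : ℕ} {g : ℍ → ℂ} {a b : ℤ → ℂ}
    (h : IsFourierExpansion k α g a b) (r : ℝ) {y : ℝ} (hy : 0 < y) :
    HasSum (fun n : {n : ℤ // n ≠ 0} => verticalTerm k α a b r n y)
      (ext g (r + y * Complex.I) - (a 0 + b 0 * ((y ^ (2 * k + 1))⁻¹ : ℝ))) := by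
  have h1 := h.hasSum_ext (z := r + y * Complex.I) (by rwa [im_ofReal_add_mul_I])
  rw [im_ofReal_add_mul_I] at h1
  refine h1.congr_fun fun n => ?_
  rw [e_mul_add_mul_I, verticalTerm, ← mul_assoc (_ + _),
    show 2 * (2 * Real.pi * (((n : ℤ) : ℝ) / α) * y) = 4 * Real.pi * ((n : ℤ) / α) * y by ring]

/-- In the product rule, the term where 𝓔 is differentiated is exactly the derivative of `regTail`
and cancels; differentiating the incomplete Gamma function leaves the Fourier term times y^k. -/
theorem hasDerivAt_regTerm {k α : ℕ} (hα : 0 < α) (a b : ℤ → ℂ) (r : ℝ) {n : ℤ} (hn : n ≠ 0)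
    {y : ℝ} (hy : 0 < y) :
    HasDerivAt (regTerm k α a b r n) (-(verticalTerm k α a b r n y * (y : ℂ) ^ k)) y := by
  have hnR : (n : ℝ) ≠ 0 := by exact_mod_cast hn
  have hαR : (α : ℝ) ≠ 0 := by exact_mod_cast hα.ne'
  set w : ℝ := 2 * Real.pi * (n / α) with hw
  have hw0 : w ≠ 0 := by
    have := Real.pi_ne_zero
    positivity
  have hwy : w * y ≠ 0 := mul_ne_zero hw0 hy.ne'
  have hlin : HasDerivAt (fun y : ℝ => w * y) w y := by
    simpa using (hasDerivAt_id y).const_mul w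
  have hlin2 : HasDerivAt (fun y : ℝ => 2 * (w * y)) (2 * w) y := hlin.const_mul 2
  have hG : HasDerivAt (fun y : ℝ => incGamma (k + 1) (w * y) / w ^ (k + 1))
      (-(Real.exp (-(w * y)) * y ^ k)) y := by
    refine (((hasDerivAt_incGamma_succ k (w * y)).comp y hlin).div_const _).congr_deriv ?_
    rw [mul_pow]
    field_simp
    ring
  have hE : HasDerivAt (fun y : ℝ => calE (2 * k + 2) (2 * (w * y)))
      (Real.exp (2 * (w * y)) * ((2 * (w * y)) ^ (2 * k + 2))⁻¹ * (2 * w)) y := by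
    refine ((hasDerivAt_calE (κ := 2 * k + 2) (by omega)
      (mul_ne_zero two_ne_zero hwy)).comp y hlin2).congr_deriv ?_
    rw [Even.neg_one_pow ⟨k + 1, by ring⟩, one_mul]
  -- The derivatives for different j differ only by (wy)^j / j!, so they add up to the truncated
  -- exponential series in the closed form of `incGamma (k + 1)`.
  have hR : HasDerivAt (fun y : ℝ => regTail k w y)
      (Real.exp (2 * (w * y)) * ((2 * (w * y)) ^ (2 * k + 2))⁻¹ * (2 * w) *
        (incGamma (k + 1) (w * y) / w ^ (k + 1))) y := by
    have h1 : HasDerivAt (fun y : ℝ => ∑ j ∈ Finset.range (k + 1),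
        (-1) ^ j / j.factorial * calE (2 * k + 2 - j) (w * y))
        (∑ j ∈ Finset.range (k + 1), (-1) ^ j / j.factorial *
          ((-1) ^ (2 * k + 2 - j) * Real.exp (w * y) * ((w * y) ^ (2 * k + 2 - j))⁻¹ * w)) y := by
      refine HasDerivAt.fun_sum fun j hj => HasDerivAt.const_mul _ ?_
      have hj' : j < k + 1 := by simpa using hj
      exact (hasDerivAt_calE (κ := 2 * k + 2 - j) (by omega) hwy).comp y hlin
    refine (h1.const_mul (k.factorial / (2 ^ (2 * k + 1) * w ^ (k + 1)) : ℝ)).congr_deriv ?_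
    have h2 : ∀ j ∈ Finset.range (k + 1), (-1) ^ j / (j.factorial : ℝ) *
          ((-1) ^ (2 * k + 2 - j) * Real.exp (w * y) * ((w * y) ^ (2 * k + 2 - j))⁻¹ * w) =
        Real.exp (w * y) * ((w * y) ^ (2 * k + 2))⁻¹ * w * ((w * y) ^ j / j.factorial) := by
      intro j hj
      have hj' : j ≤ k := by simpa [Nat.lt_succ_iff] using hj
      have hs : (-1 : ℝ) ^ j * (-1) ^ (2 * k + 2 - j) = 1 := by
        rw [← pow_add, show j + (2 * k + 2 - j) = 2 * (k + 1) by omega, pow_mul]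
        simp
      have hp : (w * y) ^ (2 * k + 2) = (w * y) ^ j * (w * y) ^ (2 * k + 2 - j) := by
        rw [← pow_add]; congr 1; omega
      have hj0 : (w * y) ^ j ≠ 0 := pow_ne_zero _ hwy
      have hj1 : (w * y) ^ (2 * k + 2 - j) ≠ 0 := pow_ne_zero _ hwy
      rw [hp]
      generalize (w * y) ^ j = P at *
      generalize (w * y) ^ (2 * k + 2 - j) = R at *
      field_simp
      linear_combination hs
    rw [Finset.sum_congr rfl h2, ← Finset.mul_sum, incGamma_succ_eq]
    generalize ∑ j ∈ Finset.range (k + 1), (w * y) ^ j / (j.factorial : ℝ) = Z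
    have h3 : Real.exp (2 * (w * y)) * Real.exp (-(w * y)) = Real.exp (w * y) := by
      rw [← Real.exp_add]; congr 1; ring
    have h4 : (2 * (w * y)) ^ (2 * k + 2) = 2 * 2 ^ (2 * k + 1) * (w * y) ^ (2 * k + 2) := by
      rw [mul_pow]; ring
    rw [h4, ← h3]
    have h5 : (w * y) ^ (2 * k + 2) ≠ 0 := pow_ne_zero _ hwy
    generalize (w * y) ^ (2 * k + 2) = P at *
    field_simp
  have h1 := (hG.ofReal_comp.const_mul (a n * e (n / α * r))).add
    (((hE.mul hG).sub hR).ofReal_comp.const_mul (b n * e (n / α * r)))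
  refine (h1.congr_deriv ?_)
  rw [verticalTerm, ← hw]
  push_cast
  ring

theorem continuousOn_verticalTerm {k α : ℕ} (hα : 0 < α) (a b : ℤ → ℂ) (r : ℝ) {n : ℤ}
    (hn : n ≠ 0) : ContinuousOn (verticalTerm k α a b r n) (Ioi 0) := by
  intro y hy
  have hnR : (n : ℝ) ≠ 0 := by exact_mod_cast hn
  have hαR : (α : ℝ) ≠ 0 := by exact_mod_cast hα.ne'
  have hy' : (0 : ℝ) < y := hy
  have hne : 2 * (2 * Real.pi * (n / α) * y) ≠ 0 := by
    have := Real.pi_ne_zero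
    have := hy'.ne'
    positivity
  have hE : ContinuousAt (fun y : ℝ => calE (2 * k + 2) (2 * (2 * Real.pi * (n / α) * y))) y :=
    ContinuousAt.comp (f := fun y : ℝ => 2 * (2 * Real.pi * (n / α) * y))
      (hasDerivAt_calE (by omega) hne).continuousAt (by fun_prop)
  refine ContinuousAt.continuousWithinAt ?_
  refine ((continuousAt_const.add (continuousAt_const.mul
    (Complex.continuous_ofReal.continuousAt.comp hE))).mul continuousAt_const).mul ?_
  exact Continuous.continuousAt (by fun_prop)

/-- On a compact interval of heights, the Fourier expansion converges normally. -/
theorem exists_summable_bound_verticalTerm {k α : ℕ} (hα : 0 < α) {g F : ℍ → ℂ} {a b : ℤ → ℂ}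
    {ξa₀ : ℂ} (h : IsFourierExpansion k α g a b) (hξ : IsXiExpansion k α b ξa₀ F) (r : ℝ)
    {y₁ y₂ : ℝ} (hy₁ : 0 < y₁) (hy : y₁ ≤ y₂) :
    ∃ B : {n : ℤ // n ≠ 0} → ℝ, Summable B ∧
      ∀ n : {n : ℤ // n ≠ 0}, ∀ y ∈ Icc y₁ y₂, ‖verticalTerm k α a b r n y‖ ≤ B n := by
  have hy₂ : 0 < y₂ := hy₁.trans_le hy
  have hαR : (0 : ℝ) < α := by exact_mod_cast hα
  have hA : ∀ {y : ℝ}, 0 < y → Summable fun n : {n : ℤ // n ≠ 0} =>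
      ‖a n * e ((n : ℤ) / α * r)‖ * Real.exp (-(2 * Real.pi * ((n : ℤ) / α) * y)) := by
    intro y hy
    have h1 := (summable_int_iff_ne_zero (f := fun n : ℤ => verticalTerm k α a b r n y)).2
      (h.hasSum_verticalTerm r hy).summable
    simp only [verticalTerm, add_mul] at h1
    have h2 := (summable_of_add_of_eq_zero h1 ?_ ?_).norm
    · simp only [norm_mul _ ((Real.exp _ : ℝ) : ℂ), Complex.norm_real,
        Real.norm_of_nonneg (Real.exp_pos _).le] at h2
      exact h2.comp_injective Subtype.val_injective
    · obtain ⟨M, hM⟩ := h.plus_eq_zero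
      exact ⟨M, fun n hn => by rw [hM n hn]; simp⟩
    · obtain ⟨M, hM⟩ := h.minus_eq_zero
      exact ⟨M, fun n hn => by rw [hM n hn]; simp⟩
  -- The constant absorbs the one power of |2w| by which `calE_bounds` exceeds the coefficients of
  -- the ξ-expansion, using |n| ≥ 1, as well as the power of the height.
  set C : ℝ := α / (4 * Real.pi) * (y₁ ^ (2 * k + 2))⁻¹ with hC
  have hC0 : 0 ≤ C := by have := Real.pi_pos; positivity
  set X : {n : ℤ // n ≠ 0} → ℝ := fun n =>
    ‖xiCoeff k α b n * e (-((n : ℤ) / α * (r + y₁ * Complex.I)))‖ * C with hX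
  have hXs : Summable X := by
    have h1 := (hξ ⟨r + y₁ * Complex.I, by rwa [im_ofReal_add_mul_I]⟩).summable.norm
    exact (h1.comp_injective Subtype.val_injective).mul_right C
  -- Negative frequencies are dominated by the absolutely convergent expansion of `F` at height y₁.
  -- Only finitely many positive ones have a nonzero coefficient, so compactness bounds suffice
  -- there.
  have hK : ∀ n : {n : ℤ // n ≠ 0}, ∃ K : ℝ,
      (∀ y ∈ Icc y₁ y₂, ‖b n * (calE (2 * k + 2) (2 * (2 * Real.pi * ((n : ℤ) / α) * y)) : ℝ) *
        e ((n : ℤ) / α * r) * (Real.exp (-(2 * Real.pi * ((n : ℤ) / α) * y)) : ℝ)‖ ≤ K) ∧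
      ((n : ℤ) < 0 → K = X n) ∧ (0 < (n : ℤ) → b n = 0 → K = 0) := by
    intro n
    rcases lt_or_gt_of_ne n.2 with hn | hn
    · refine ⟨X n, fun y hy => ?_, fun _ => rfl, fun h0 => absurd h0 (by omega)⟩
      have hy0 : 0 < y := hy₁.trans_le hy.1
      have hnR : ((n : ℤ) : ℝ) ≤ -1 := by exact_mod_cast (show (n : ℤ) ≤ -1 by omega)
      set w : ℝ := 2 * Real.pi * ((n : ℤ) / α) with hw
      have hdiv : ((n : ℤ) : ℝ) / α < 0 := div_neg_of_neg_of_pos (by linarith) hαR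
      have hw0 : w < 0 := mul_neg_of_pos_of_neg (by have := Real.pi_pos; positivity) hdiv
      have hwy : 2 * (w * y) < 0 := by nlinarith
      obtain ⟨hE0, hE1⟩ := calE_bounds k hwy
      have hne : ‖e ((n : ℤ) / α * r)‖ = 1 := by
        rw [norm_e]
        have : (((n : ℤ) : ℂ) / α * r).im = 0 := by
          rw [show ((n : ℤ) : ℂ) / α * r = (((n : ℤ) / α * r : ℝ) : ℂ) by push_cast; rfl]
          exact Complex.ofReal_im _
        rw [this]
        simp
      have hxe : ‖e (-((n : ℤ) / α * (r + y₁ * Complex.I)))‖ = Real.exp (w * y₁) := by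
        rw [norm_e]
        have : (-(((n : ℤ) : ℂ) / α * (r + y₁ * Complex.I))).im = -((n : ℤ) / α * y₁) := by
          rw [show (((n : ℤ) : ℂ) / α * (r + y₁ * Complex.I)) =
            (((n : ℤ) / α * r : ℝ) : ℂ) + (((n : ℤ) / α * y₁ : ℝ) : ℂ) * Complex.I by
              push_cast; ring, Complex.neg_im, im_ofReal_add_mul_I]
        rw [this, hw]
        congr 1
        ring
      have hxc : ‖xiCoeff k α b n‖ = (|2 * w| ^ (2 * k + 1))⁻¹ * ‖b n‖ := by
        rw [xiCoeff, if_neg n.2, norm_mul, Complex.norm_real, RCLike.norm_conj, norm_inv, norm_pow,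
          Real.norm_eq_abs, show 4 * Real.pi * (((n : ℤ) : ℝ) / α) = 2 * w by rw [hw]; ring]
      have key : calE (2 * k + 2) (2 * (w * y)) * Real.exp (-(w * y)) ≤
          (|2 * w| ^ (2 * k + 1))⁻¹ * (Real.exp (w * y₁) * C) := by
        calc calE (2 * k + 2) (2 * (w * y)) * Real.exp (-(w * y))
            ≤ Real.exp (2 * (w * y)) * ((2 * (w * y)) ^ (2 * k + 2))⁻¹ * Real.exp (-(w * y)) := by
              gcongr
          _ = ((2 * (w * y)) ^ (2 * k + 2))⁻¹ * Real.exp (w * y) := by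
              rw [mul_right_comm, ← Real.exp_add, mul_comm]
              congr 2
              ring
          _ = ((|2 * w| * y) ^ (2 * k + 2))⁻¹ * Real.exp (w * y) := by
              have hev : Even (2 * k + 2) := ⟨k + 1, by ring⟩
              rw [← hev.pow_abs (2 * (w * y)), ← mul_assoc, abs_mul, abs_of_pos hy0]
          _ ≤ ((|2 * w| * y₁) ^ (2 * k + 2))⁻¹ * Real.exp (w * y₁) := by
              have h1 : 0 < |2 * w| := abs_pos.2 (by linarith)
              have h2 : w * y ≤ w * y₁ := mul_le_mul_of_nonpos_left hy.1 hw0.le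
              have h3 := hy.1
              gcongr
          _ = (|2 * w| ^ (2 * k + 1))⁻¹ * (Real.exp (w * y₁) * (|2 * w|⁻¹ *
                (y₁ ^ (2 * k + 2))⁻¹)) := by
              rw [mul_pow, pow_succ |2 * w|, mul_inv, mul_inv]
              ring
          _ ≤ (|2 * w| ^ (2 * k + 1))⁻¹ * (Real.exp (w * y₁) * C) := by
              have h1 : 4 * Real.pi / α ≤ |2 * w| := by
                rw [abs_of_neg (by linarith), hw]
                have : -(2 * (2 * Real.pi * (((n : ℤ) : ℝ) / α))) =
                  4 * Real.pi / α * (-((n : ℤ) : ℝ)) := by ring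
                rw [this]
                exact le_mul_of_one_le_right (by have := Real.pi_pos; positivity) (by linarith)
              have h2 : |2 * w|⁻¹ ≤ α / (4 * Real.pi) := by
                rw [← inv_div]
                exact inv_anti₀ (by have := Real.pi_pos; positivity) h1
              rw [hC]
              gcongr
      change ‖b n * (calE (2 * k + 2) (2 * (w * y)) : ℝ) * e ((n : ℤ) / α * r) *
        (Real.exp (-(w * y)) : ℝ)‖ ≤ X n
      rw [norm_mul, norm_mul, norm_mul, hne, mul_one, Complex.norm_real, Complex.norm_real,
        Real.norm_of_nonneg hE0, Real.norm_of_nonneg (Real.exp_pos _).le]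
      calc _ = ‖b n‖ * (calE (2 * k + 2) (2 * (w * y)) * Real.exp (-(w * y))) := by ring
        _ ≤ ‖b n‖ * ((|2 * w| ^ (2 * k + 1))⁻¹ * (Real.exp (w * y₁) * C)) := by gcongr
        _ = X n := by
          simp only [hX]
          rw [norm_mul, hxe, hxc]
          ring
    · by_cases hb : b n = 0
      · exact ⟨0, fun y _ => by simp [hb], fun h0 => absurd h0 (by omega), fun _ _ => rfl⟩
      · have hc : ContinuousOn (fun y => verticalTerm k α 0 b r n y) (Icc y₁ y₂) :=
          (continuousOn_verticalTerm hα 0 b r n.2).mono fun y hy => hy₁.trans_le hy.1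
        obtain ⟨K, hK⟩ := isCompact_Icc.exists_bound_of_continuousOn hc
        refine ⟨K, fun y hy => ?_, fun h0 => absurd h0 (by omega), fun _ h0 => absurd h0 hb⟩
        have := hK y hy
        rwa [verticalTerm, Pi.zero_apply, zero_add] at this
  choose K hK1 hK2 hK3 using hK
  have hK0 : ∀ n, 0 ≤ K n := fun n => (norm_nonneg _).trans (hK1 n y₁ ⟨le_rfl, hy⟩)
  have hKs : Summable K := by
    refine Summable.of_norm_bounded_eventually hXs ?_
    obtain ⟨M, hM⟩ := h.minus_eq_zero
    have hfin : {n : {n : ℤ // n ≠ 0} | (n : ℤ) ∈ Icc 0 M}.Finite :=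
      (finite_Icc 0 M).preimage Subtype.val_injective.injOn
    rw [eventually_cofinite]
    refine hfin.subset fun n hn => ?_
    by_contra hn'
    refine hn ?_
    have hn'' : ¬((n : ℤ) ∈ Icc 0 M) := hn'
    rw [mem_Icc, not_and_or, not_le, not_le] at hn''
    rw [Real.norm_of_nonneg (hK0 n)]
    rcases lt_or_gt_of_ne n.2 with h0 | h0
    · rw [hK2 n h0]
    · rw [hK3 n h0 (hM n (hn''.resolve_left (by omega)))]
      exact mul_nonneg (norm_nonneg _) hC0
  -- For the a⁺ part the exponential is monotone in y, hence at most the sum of its endpoint values,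
  -- whatever the sign of n.
  refine ⟨_, ((hA hy₁).add (hA hy₂)).add hKs, fun n y hy => ?_⟩
  rw [verticalTerm, add_mul, add_mul]
  refine (norm_add_le _ _).trans (add_le_add ?_ (hK1 n y hy))
  rw [norm_mul _ ((Real.exp _ : ℝ) : ℂ), Complex.norm_real,
    Real.norm_of_nonneg (Real.exp_pos _).le, ← mul_add]
  refine mul_le_mul_of_nonneg_left ?_ (norm_nonneg _)
  set w : ℝ := 2 * Real.pi * ((n : ℤ) / α)
  rcases le_total 0 w with hw | hw
  · have h1 : Real.exp (-(w * y)) ≤ Real.exp (-(w * y₁)) := by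
      have := hy.1
      gcongr
    have := Real.exp_pos (-(w * y₂))
    linarith
  · have h1 : Real.exp (-(w * y)) ≤ Real.exp (-(w * y₂)) := by
      have := mul_le_mul_of_nonpos_left hy.2 hw
      gcongr
    have := Real.exp_pos (-(w * y₁))
    linarith

theorem hasSum_regTerm_sub {k α : ℕ} (hα : 0 < α) {g F : ℍ → ℂ} {a b : ℤ → ℂ} {ξa₀ : ℂ}
    (h : IsFourierExpansion k α g a b) (hξ : IsXiExpansion k α b ξa₀ F) (r : ℝ)
    {S T : ℝ} (hS : 0 < S) (hT : 0 < T) :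
    HasSum (fun n : {n : ℤ // n ≠ 0} => regTerm k α a b r n T - regTerm k α a b r n S)
      (∫ y in T..S, (ext g (r + y * Complex.I) - (a 0 + b 0 * ((y ^ (2 * k + 1))⁻¹ : ℝ))) *
        (y : ℂ) ^ k) := by
  have hpos : ∀ y ∈ uIcc T S, 0 < y := fun y hy => (lt_min hT hS).trans_le hy.1
  have hint : ∀ n : {n : ℤ // n ≠ 0}, IntervalIntegrable
      (fun y : ℝ => verticalTerm k α a b r n y * (y : ℂ) ^ k) volume T S := fun n =>
    ContinuousOn.intervalIntegrable (((continuousOn_verticalTerm hα a b r n.2).mono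
      fun y hy => hpos y hy).mul (by fun_prop))
  have hterm : ∀ n : {n : ℤ // n ≠ 0}, regTerm k α a b r n T - regTerm k α a b r n S =
      ∫ y in T..S, verticalTerm k α a b r n y * (y : ℂ) ^ k := by
    intro n
    have h1 := intervalIntegral.integral_eq_sub_of_hasDerivAt
      (fun y hy => hasDerivAt_regTerm hα a b r n.2 (hpos y hy)) (hint n).neg
    rw [intervalIntegral.integral_neg] at h1
    linear_combination h1
  simp only [hterm]
  obtain ⟨B, hB, hBn⟩ := exists_summable_bound_verticalTerm hα h hξ r (lt_min hT hS)
    (min_le_max (a := T) (b := S))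
  refine intervalIntegral.hasSum_integral_of_dominated_convergence
    (fun n _ => B n * (max T S) ^ k) ?_ ?_ ?_ ?_ ?_
  · exact fun n => ((intervalIntegrable_iff.1 (hint n)).aestronglyMeasurable)
  · intro n
    refine Eventually.of_forall fun y hy => ?_
    have hy' : y ∈ Icc (min T S) (max T S) := Ioc_subset_Icc_self hy
    have hy0 : 0 < y := (lt_min hT hS).trans_le hy'.1
    rw [norm_mul, norm_pow, Complex.norm_real, Real.norm_of_nonneg hy0.le]
    have := hBn n y hy'
    have h0 := (norm_nonneg _).trans this
    have := hy'.2
    gcongr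
  · exact Eventually.of_forall fun y _ => hB.mul_right _
  · exact intervalIntegrable_const
  · refine Eventually.of_forall fun y hy => ?_
    exact (h.hasSum_verticalTerm r (hpos y (Ioc_subset_Icc_self hy))).mul_right _

theorem hasDerivAt_constGrowth (k : ℕ) {y : ℝ} (hy : 0 < y) :
    HasDerivAt (constGrowth k) (-(y ^ (k + 1))⁻¹) y := by
  rcases Nat.eq_zero_or_pos k with rfl | hk
  · have h : constGrowth 0 = fun y => -Real.log y := by funext y; simp [constGrowth]
    rw [h]
    exact ((Real.hasDerivAt_log hy.ne').neg).congr_deriv (by simp)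
  · have h : constGrowth k = fun y : ℝ => (y ^ k)⁻¹ / k := by
      funext y; rw [constGrowth, if_neg hk.ne']
    rw [h]
    have hkR : (k : ℝ) ≠ 0 := by exact_mod_cast hk.ne'
    refine (((hasDerivAt_pow k y).inv (pow_ne_zero _ hy.ne')).div_const _).congr_deriv ?_
    obtain ⟨m, rfl⟩ : ∃ m, k = m + 1 := ⟨k - 1, by omega⟩
    have := hy.ne'
    rw [Nat.add_sub_cancel]
    field_simp
    ring

theorem integral_const_terms (k : ℕ) (a₀ b₀ : ℂ) {S T : ℝ} (hS : 0 < S) (hT : 0 < T) :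
    IntervalIntegrable (fun y : ℝ => (a₀ + b₀ * ((y ^ (2 * k + 1))⁻¹ : ℝ)) * (y : ℂ) ^ k)
      volume T S ∧
    ∫ y in T..S, (a₀ + b₀ * ((y ^ (2 * k + 1))⁻¹ : ℝ)) * (y : ℂ) ^ k =
      (a₀ * (S ^ (k + 1) / (k + 1) : ℝ) - b₀ * constGrowth k S) -
        (a₀ * (T ^ (k + 1) / (k + 1) : ℝ) - b₀ * constGrowth k T) := by
  have hpos : ∀ y ∈ uIcc T S, 0 < y := fun y hy => (lt_min hT hS).trans_le hy.1
  have hint : IntervalIntegrable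
      (fun y : ℝ => (a₀ + b₀ * ((y ^ (2 * k + 1))⁻¹ : ℝ)) * (y : ℂ) ^ k) volume T S := by
    refine ContinuousOn.intervalIntegrable ?_
    refine ContinuousOn.mul (continuousOn_const.add (continuousOn_const.mul ?_)) (by fun_prop)
    refine Complex.continuous_ofReal.comp_continuousOn (ContinuousOn.inv₀ (by fun_prop) ?_)
    exact fun y hy => pow_ne_zero _ (hpos y hy).ne'
  refine ⟨hint, intervalIntegral.integral_eq_sub_of_hasDerivAt (f := fun y : ℝ =>
    a₀ * (y ^ (k + 1) / (k + 1) : ℝ) - b₀ * constGrowth k y) (fun y hy => ?_) hint⟩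
  have hy := hpos y hy
  have h1 : HasDerivAt (fun y : ℝ => y ^ (k + 1) / ((k : ℝ) + 1)) (y ^ k) y := by
    refine ((hasDerivAt_pow (k + 1) y).div_const _).congr_deriv ?_
    have : (k : ℝ) + 1 ≠ 0 := by positivity
    push_cast
    field_simp
  refine ((h1.ofReal_comp.const_mul a₀).sub
    ((hasDerivAt_constGrowth k hy).ofReal_comp.const_mul b₀)).congr_deriv ?_
  have hyC : (y : ℂ) ≠ 0 := by exact_mod_cast hy.ne'
  push_cast
  field_simp
  ring

/-- The regularization at a cusp does not depend on the truncation height and is computed by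
integrals over horizontal segments. -/
theorem regHalf_eq_altHalf {Γ : Subgroup SL(2, ℤ)} {k : ℕ} {G : ℍ → ℂ} {σ : SL(2, ℤ)}
    (hα : 0 < cuspWidth Γ σ)
    (hexp : IsFourierExpansion k (cuspWidth Γ σ) (G ∣[(2 * k + 2 : ℤ)] σ)
      (fourierCoeffs k (cuspWidth Γ σ) (G ∣[(2 * k + 2 : ℤ)] σ)).1
      (fourierCoeffs k (cuspWidth Γ σ) (G ∣[(2 * k + 2 : ℤ)] σ)).2)
    (hξ : IsXiExpansion k (cuspWidth Γ σ)
      (fourierCoeffs k (cuspWidth Γ σ) (G ∣[(2 * k + 2 : ℤ)] σ)).2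
      (constCoeff (cuspWidth Γ σ) ((xi (2 * k + 2) G) ∣[(-(2 * k) : ℤ)] σ))
      (xi (2 * k + 2) (G ∣[(2 * k + 2 : ℤ)] σ)))
    (hc : ContinuousOn (ext (G ∣[(2 * k + 2 : ℤ)] σ)) {z | 0 < z.im})
    (r : ℝ) {c S T : ℝ} (hc0 : 0 < c) (hS : 0 < S) (hT : 0 < T) :
    regHalf Γ k G σ r c S = altHalf Γ k G σ r c T := by
  have hS1 := tsum_add_tsum_eq_tsum_regTerm hα hexp hξ r hS
  have hsub := (hasSum_regTerm_sub hα hexp hξ r hS hT).tsum_eq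
  have hT1 := hasSum_regTerm hα hexp hξ r hT
  rw [Summable.tsum_sub hT1.summable (hasSum_regTerm hα hexp hξ r hS).summable, hT1.tsum_eq]
    at hsub
  have hcont : ∀ {x y : ℝ}, 0 < x → 0 < y → IntervalIntegrable (fun y : ℝ =>
      ext (G ∣[(2 * k + 2 : ℤ)] σ) (r + y * Complex.I) * (y : ℂ) ^ k) volume x y := by
    intro x y hx hy
    refine ContinuousOn.intervalIntegrable (ContinuousOn.mul (hc.comp (by fun_prop) ?_)
      (by fun_prop))
    intro t ht
    simp only [mem_ofPred_eq, im_ofReal_add_mul_I]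
    exact (lt_min hx hy).trans_le ht.1
  -- The vertical integral up to S is cut at T; the piece from T to S is the change in the constant
  -- terms plus the change in the sum of the `regTerm`.
  have hadd := intervalIntegral.integral_add_adjacent_intervals (hcont hc0 hT) (hcont hT hS)
  obtain ⟨hci, hcv⟩ := integral_const_terms k
    ((fourierCoeffs k (cuspWidth Γ σ) (G ∣[(2 * k + 2 : ℤ)] σ)).1 0)
    ((fourierCoeffs k (cuspWidth Γ σ) (G ∣[(2 * k + 2 : ℤ)] σ)).2 0) hS hT
  have hsplit := intervalIntegral.integral_sub (hcont hT hS) hci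
  rw [hcv] at hsplit
  simp only [← sub_mul] at hsplit
  rw [hsplit] at hsub
  simp only [regHalf, altHalf]
  simp only [regTail] at hS1
  linear_combination hS1 - hadd - hsub

/-! ### Fourier expansions of periodic functions on the upper half-plane -/

theorem fourierCoeffOn_zero_one (h : ℝ → ℂ) (n : ℤ) :
    fourierCoeffOn zero_lt_one h n = ∫ x in (0 : ℝ)..1, h x * e (((-n : ℤ) : ℂ) * x) := by
  rw [fourierCoeffOn_eq_integral]
  simp only [sub_zero, div_one, one_smul]
  refine intervalIntegral.integral_congr fun x _ => ?_
  simp only [fourier_coe_apply, smul_eq_mul]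
  rw [mul_comm, e]
  congr 2
  push_cast
  ring

/-- Two integrations by parts, with boundary terms vanishing by periodicity, give coefficients of
size O(n^(-2)). -/
theorem summable_fourierCoeffOn {h : ℝ → ℂ} (hh : ContDiff ℝ 2 h) (hper : ∀ x, h (x + 1) = h x) :
    Summable (fourierCoeffOn zero_lt_one h) := by
  have hd1 : ContDiff ℝ 1 (deriv h) := (contDiff_succ_iff_deriv (n := 1)).1 hh |>.2.2
  have hd2 : Continuous (deriv (deriv h)) :=
    ((contDiff_succ_iff_deriv (n := 0)).1 hd1).2.2.continuous
  have hper1 : ∀ x, deriv h (x + 1) = deriv h x := fun x => by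
    rw [← deriv_comp_add_const]; simp only [hper]
  have h1 : ∀ x, HasDerivAt h (deriv h x) x := fun x =>
    (hh.differentiable (by norm_num) x).hasDerivAt
  have h2 : ∀ x, HasDerivAt (deriv h) (deriv (deriv h) x) x := fun x =>
    (hd1.differentiable (by norm_num) x).hasDerivAt
  obtain ⟨C, hC⟩ := (isCompact_Icc (a := (0 : ℝ)) (b := 1)).exists_bound_of_continuousOn
    hd2.continuousOn
  have hC2 : ∀ n, ‖fourierCoeffOn zero_lt_one (deriv (deriv h)) n‖ ≤ C := by
    intro n
    rw [fourierCoeffOn_zero_one]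
    have := intervalIntegral.norm_integral_le_of_norm_le_const (a := (0 : ℝ)) (b := 1) (C := C)
      (f := fun x : ℝ => deriv (deriv h) x * e (((-n : ℤ) : ℂ) * x)) (fun x hx => by
        rw [uIoc_of_le zero_le_one] at hx
        rw [norm_mul, norm_e]
        simpa using hC x ⟨hx.1.le, hx.2⟩)
    simpa using this
  have key : ∀ n : ℤ, n ≠ 0 → ‖fourierCoeffOn zero_lt_one h n‖ ≤ C * (1 / (n : ℝ) ^ 2) := by
    intro n hn
    have hpi : 1 ≤ 2 * Real.pi := by linarith [Real.pi_gt_three]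
    have hnR : 0 < |(n : ℝ)| := by positivity
    rw [fourierCoeffOn_of_hasDerivAt zero_lt_one hn (fun x _ => h1 x)
        (hd1.continuous.intervalIntegrable _ _),
      fourierCoeffOn_of_hasDerivAt zero_lt_one hn (fun x _ => h2 x) (hd2.intervalIntegrable _ _),
      show h 1 = h 0 by simpa using hper 0, show deriv h 1 = deriv h 0 by simpa using hper1 0]
    simp only [sub_self, mul_zero, zero_sub, Complex.ofReal_one, Complex.ofReal_zero, sub_zero,
      one_mul, norm_mul, norm_neg, norm_div, norm_one, Complex.norm_intCast, Complex.norm_I,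
      mul_one, Complex.norm_real, Complex.norm_ofNat, Real.norm_eq_abs, abs_of_pos Real.pi_pos]
    have hle : 1 / (2 * Real.pi * |(n : ℝ)|) ≤ 1 / |(n : ℝ)| :=
      one_div_le_one_div_of_le hnR (by nlinarith)
    have h0 : 0 ≤ 1 / (2 * Real.pi * |(n : ℝ)|) := by positivity
    calc _ ≤ 1 / |(n : ℝ)| * (1 / |(n : ℝ)| * C) := by
          gcongr
          exact hC2 n
      _ = _ := by rw [← sq_abs]; ring
  refine Summable.of_norm_bounded_eventually
    (((Real.summable_one_div_int_pow (p := 2)).2 (by norm_num)).mul_left C) ?_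
  filter_upwards [(Set.finite_singleton (0 : ℤ)).compl_mem_cofinite] with n hn
  exact key n hn

theorem hasSum_fourier_of_contDiff {h : ℝ → ℂ} (hh : ContDiff ℝ 2 h)
    (hper : ∀ x, h (x + 1) = h x) (x : ℝ) :
    HasSum (fun n : ℤ => (∫ x in (0 : ℝ)..1, h x * e (((-n : ℤ) : ℂ) * x)) * e (n * x)) (h x) := by
  have : Fact ((0 : ℝ) < 1) := ⟨zero_lt_one⟩
  have hp : Function.Periodic h 1 := hper
  let f : C(AddCircle (1 : ℝ), ℂ) := ⟨hp.lift, continuous_coinduced_dom.mpr hh.continuous⟩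
  have hcoe : ∀ n, fourierCoeff f n = fourierCoeffOn zero_lt_one h n := by
    intro n
    rw [fourierCoeff_eq_intervalIntegral _ _ 0, fourierCoeffOn_zero_one]
    simp only [zero_add, div_one, one_smul]
    refine intervalIntegral.integral_congr fun x _ => ?_
    simp only [fourier_coe_apply, smul_eq_mul, f, ContinuousMap.coe_mk,
      Function.Periodic.lift_coe]
    rw [mul_comm, e]
    congr 2
    push_cast
    ring
  have hs : Summable (fourierCoeff f) :=
    (summable_fourierCoeffOn hh hper).congr fun n => (hcoe n).symm
  have := has_pointwise_sum_fourier_series_of_summable hs (x : AddCircle (1 : ℝ))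
  have hv : f (x : AddCircle (1 : ℝ)) = h x := rfl
  rw [hv] at this
  refine this.congr_fun fun n => ?_
  rw [hcoe, fourierCoeffOn_zero_one, smul_eq_mul, fourier_coe_apply, e]
  congr 2
  push_cast
  ring

theorem isOpen_im_pos : IsOpen {z : ℂ | 0 < z.im} :=
  isOpen_lt continuous_const Complex.continuous_im

theorem hasSum_segInt_mul_e {H : ℂ → ℂ} (hH : ContDiffOn ℝ 2 H {z | 0 < z.im})
    (hper : ∀ z, 0 < z.im → H (z + 1) = H z) {z : ℂ} (hz : 0 < z.im) :
    HasSum (fun n : ℤ => segInt z.im (fun w => H w * e (((-n : ℤ) : ℂ) * w)) * e (n * z)) (H z) := by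
  have hh : ContDiff ℝ 2 (fun x : ℝ => H (x + z.im * Complex.I)) := by
    rw [← contDiffOn_univ]
    refine hH.comp ?_ fun x _ => ?_
    · exact (Complex.ofRealCLM.contDiff.add contDiff_const).contDiffOn
    · rw [mem_ofPred_eq, im_ofReal_add_mul_I]
      exact hz
  have := hasSum_fourier_of_contDiff hh (fun x => by
    rw [← hper (x + z.im * Complex.I) (by rwa [im_ofReal_add_mul_I])]
    congr 1
    push_cast
    ring) z.re
  simp only [Complex.re_add_im] at this
  refine this.congr_fun fun n => ?_
  have h1 : e (n * z) = e (n * z.re) * e (n * (z.im * Complex.I)) := by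
    rw [← e_add, ← mul_add, Complex.re_add_im]
  have h2 : ∀ x : ℝ, e (((-n : ℤ) : ℂ) * (x + z.im * Complex.I)) =
      e (((-n : ℤ) : ℂ) * x) * e (-(n * (z.im * Complex.I))) := fun x => by
    rw [← e_add]
    congr 1
    push_cast
    ring
  have h3 : e (-(n * (z.im * Complex.I))) * e (n * (z.im * Complex.I)) = 1 := by
    rw [← e_add, neg_add_cancel, e_zero]
  have h4 : segInt z.im (fun w => H w * e (((-n : ℤ) : ℂ) * w)) =
      (∫ x in (0 : ℝ)..1, H (x + z.im * Complex.I) * e (((-n : ℤ) : ℂ) * x)) *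
        e (-(n * (z.im * Complex.I))) := by
    simp only [segInt, h2, ← mul_assoc]
    exact intervalIntegral.integral_mul_const _ _
  rw [h4, h1, mul_mul_mul_comm, h3, mul_one]

/-- The Cauchy–Riemann operator `∂/∂x + i ∂/∂y`. -/
noncomputable def dbar (F : ℂ → ℂ) (z : ℂ) : ℂ := dX F z + Complex.I * dY F z

/-- Differentiation under the integral gives ∂H/∂y; since ∂H/∂x integrates to 0 over a period, this
may be replaced by -i times `dbar`. -/
theorem hasDerivAt_segInt {H : ℂ → ℂ} (hH : ContDiffOn ℝ 1 H {z | 0 < z.im})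
    (hper : ∀ z, 0 < z.im → H (z + 1) = H z) {t : ℝ} (ht : 0 < t) :
    HasDerivAt (fun t => segInt t H)
      (-Complex.I * segInt t (dbar H)) t := by
  have hcont : ContinuousOn (fderiv ℝ H) {z | 0 < z.im} :=
    hH.continuousOn_fderiv_of_isOpen isOpen_im_pos le_rfl
  have hX : ContinuousOn (dX H) {z | 0 < z.im} := hcont.clm_apply continuousOn_const
  have hY : ContinuousOn (dY H) {z | 0 < z.im} := hcont.clm_apply continuousOn_const
  have hfd : ∀ z, 0 < z.im → HasFDerivAt H (fderiv ℝ H z) z := fun z hz =>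
    ((hH.differentiableOn one_ne_zero).differentiableAt
      (isOpen_im_pos.mem_nhds hz)).hasFDerivAt
  have hdx : ∀ s x : ℝ, 0 < s → HasDerivAt (fun x : ℝ => H (x + s * Complex.I))
      (dX H (x + s * Complex.I)) x := fun s x hs => by
    refine (hfd _ (by rwa [im_ofReal_add_mul_I])).comp_hasDerivAt x ?_
    simpa using (Complex.ofRealCLM.hasDerivAt (x := x)).add_const ((s : ℂ) * Complex.I)
  have hdy : ∀ s x : ℝ, 0 < s → HasDerivAt (fun s : ℝ => H (x + s * Complex.I))
      (dY H (x + s * Complex.I)) s := fun s x hs => by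
    refine (hfd _ (by rwa [im_ofReal_add_mul_I])).comp_hasDerivAt s ?_
    simpa using ((Complex.ofRealCLM.hasDerivAt (x := s)).mul_const Complex.I).const_add (x : ℂ)
  have hcx : ∀ {f : ℂ → ℂ}, ContinuousOn f {z | 0 < z.im} → ∀ {s : ℝ}, 0 < s →
      Continuous fun x : ℝ => f (x + s * Complex.I) := fun hf s hs =>
    continuous_comp_horizontal (hf.mono fun z hz => by
      rw [mem_ofPred_eq] at hz ⊢; rwa [hz])
  have hcompact : IsCompact (uIcc (0 : ℝ) 1 ×ℂ Icc (t / 2) (2 * t)) :=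
    isCompact_uIcc.reProdIm isCompact_Icc
  obtain ⟨C, hC⟩ := hcompact.exists_bound_of_continuousOn (hY.mono fun z hz => by
    have := (Complex.mem_reProdIm.1 hz).2.1
    rw [mem_ofPred_eq]
    linarith)
  have hs : Ioo (t / 2) (2 * t) ∈ 𝓝 t := Ioo_mem_nhds (by linarith) (by linarith)
  have main := intervalIntegral.hasDerivAt_integral_of_dominated_loc_of_deriv_le
    (μ := volume) (a := (0 : ℝ)) (b := 1) (F := fun (s : ℝ) (x : ℝ) => H (x + s * Complex.I))
    (F' := fun (s : ℝ) (x : ℝ) => dY H (x + s * Complex.I)) (bound := fun _ => C) hs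
    (by
      filter_upwards [hs] with s hs
      exact (hcx hH.continuousOn (by linarith [hs.1])).aestronglyMeasurable)
    ((hcx hH.continuousOn ht).intervalIntegrable _ _)
    (hcx hY ht).aestronglyMeasurable
    (Eventually.of_forall fun x hx s hs => hC _ (Complex.mem_reProdIm.2
      ⟨by rw [re_ofReal_add_mul_I]; exact uIoc_subset_uIcc hx,
        by rw [im_ofReal_add_mul_I]; exact Ioo_subset_Icc_self hs⟩))
    intervalIntegrable_const
    (Eventually.of_forall fun x _ s hs => hdy s x (by linarith [hs.1]))
  refine main.2.congr_deriv ?_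
  have h0 : ∫ x in (0 : ℝ)..1, dX H (x + t * Complex.I) = 0 := by
    rw [intervalIntegral.integral_eq_sub_of_hasDerivAt (fun x _ => hdx t x ht)
      ((hcx hX ht).intervalIntegrable _ _)]
    have := hper ((0 : ℝ) + t * Complex.I) (by rwa [im_ofReal_add_mul_I])
    rw [sub_eq_zero, ← this]
    congr 1
    push_cast
    ring
  have h1 : segInt t (dbar H) =
      (∫ x in (0 : ℝ)..1, dX H (x + t * Complex.I)) +
        Complex.I * ∫ x in (0 : ℝ)..1, dY H (x + t * Complex.I) := by
    simp only [segInt, dbar]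
    rw [← intervalIntegral.integral_const_mul, ← intervalIntegral.integral_add]
    · exact (hcx hX ht).intervalIntegrable _ _
    · exact ((hcx hY ht).intervalIntegrable _ _).const_mul _
  rw [h1, h0]
  linear_combination (∫ x in (0 : ℝ)..1, dY H (x + t * Complex.I)) * Complex.I_sq

theorem dbar_eq_zero {F : ℂ → ℂ} {z : ℂ} (hF : DifferentiableAt ℂ F z) : dbar F z = 0 := by
  have h : fderiv ℝ F z = (fderiv ℂ F z).restrictScalars ℝ := hF.fderiv_restrictScalars ℝ
  have h1 : fderiv ℂ F z Complex.I = Complex.I * fderiv ℂ F z 1 := by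
    rw [← smul_eq_mul, ← map_smul, smul_eq_mul, mul_one]
  rw [dbar, dX, dY, h, ContinuousLinearMap.coe_restrictScalars', h1]
  linear_combination fderiv ℂ F z 1 * Complex.I_sq

theorem dbar_mul {F h : ℂ → ℂ} {z : ℂ} (hF : DifferentiableAt ℝ F z)
    (hh : DifferentiableAt ℂ h z) : dbar (fun z => F z * h z) z = dbar F z * h z := by
  have h0 := dbar_eq_zero hh
  simp only [dbar, dX, dY] at h0 ⊢
  rw [fderiv_fun_mul hF (hh.restrictScalars ℝ)]
  simp only [add_apply, smul_apply, smul_eq_mul]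
  linear_combination F z * h0

theorem dbar_comp {F m : ℂ → ℂ} {m' z : ℂ} (hF : DifferentiableAt ℝ F (m z))
    (hm : HasDerivAt m m' z) :
    dbar (fun z => F (m z)) z = (starRingEnd ℂ) m' * dbar F (m z) := by
  have h1 : fderiv ℝ (fun z => F (m z)) z =
      (fderiv ℝ F (m z)).comp ((ContinuousLinearMap.toSpanSingleton ℂ m').restrictScalars ℝ) :=
    (hF.hasFDerivAt.comp z (hm.hasFDerivAt.restrictScalars ℝ)).fderiv
  have h2 : ∀ w : ℂ, fderiv ℝ F (m z) w =
      w.re * fderiv ℝ F (m z) 1 + w.im * fderiv ℝ F (m z) Complex.I := fun w => by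
    conv_lhs => rw [← Complex.re_add_im w, map_add, ← mul_one (w.re : ℂ), ← Complex.real_smul,
      ← Complex.real_smul, map_smul, map_smul, Complex.real_smul, Complex.real_smul]
  have h3 : (starRingEnd ℂ) m' = m'.re - m'.im * Complex.I := by
    apply Complex.ext <;> simp
  simp only [dbar, dX, dY, h1, ContinuousLinearMap.comp_apply,
    ContinuousLinearMap.coe_restrictScalars', ContinuousLinearMap.toSpanSingleton_apply,
    smul_eq_mul, one_mul]
  rw [h2 m', h2 (Complex.I * m')]
  rw [h3]
  simp only [Complex.mul_re, Complex.mul_im, Complex.I_re, Complex.I_im]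
  push_cast
  linear_combination ((m'.im : ℂ) * fderiv ℝ F (m z) Complex.I) * Complex.I_sq

theorem xi_eq (κ : ℤ) (G : ℍ → ℂ) (z : ℍ) :
    xi κ G z = Complex.I * (z.im : ℂ) ^ κ * (starRingEnd ℂ) (dbar (ext G) z) := by
  rw [xi, dbar, map_div₀, Complex.conj_ofNat]
  ring

theorem segInt_conj (t : ℝ) (F : ℂ → ℂ) :
    segInt t (fun z => (starRingEnd ℂ) (F z)) = (starRingEnd ℂ) (segInt t F) :=
  intervalIntegral.intervalIntegral_conj

theorem segInt_eq_of_differentiableOn {H : ℂ → ℂ} (hH : DifferentiableOn ℂ H {z | 0 < z.im})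
    (hper : ∀ z, 0 < z.im → H (z + 1) = H z) {s t : ℝ} (hs : 0 < s) (ht : 0 < t) :
    segInt s H = segInt t H := by
  have hc : ContDiffOn ℝ 1 H {z | 0 < z.im} := (hH.contDiffOn isOpen_im_pos).restrict_scalars ℝ
  have hd : ∀ t ∈ Ioi (0 : ℝ), HasDerivAt (fun t => segInt t H) 0 t := fun t ht => by
    refine (hasDerivAt_segInt hc hper ht).congr_deriv ?_
    rw [segInt_congr (g := fun _ => 0) fun z hz => dbar_eq_zero
      (hH.differentiableAt (isOpen_im_pos.mem_nhds (show 0 < z.im by rw [hz]; exact ht)))]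
    simp [segInt]
  exact isOpen_Ioi.is_const_of_deriv_eq_zero isPreconnected_Ioi
    (fun t ht => (hd t ht).differentiableAt.differentiableWithinAt) (fun t ht => (hd t ht).deriv)
    hs ht

theorem e_neg_mul_eq_conj (n : ℤ) (z : ℂ) :
    e (((-n : ℤ) : ℂ) * z) =
      (starRingEnd ℂ) (e (n * z)) * (Real.exp (4 * Real.pi * n * z.im) : ℝ) := by
  have h1 : Real.exp (4 * Real.pi * n * z.im) = Real.exp (-(2 * Real.pi * (-(2 * n * z.im)))) := by
    congr 1; ring
  rw [h1, ← e_ofReal_mul_I, conj_e, ← e_add]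
  congr 1
  have h2 : (starRingEnd ℂ) z = z - 2 * z.im * Complex.I := by
    apply Complex.ext <;> simp
    ring
  rw [map_mul, h2, map_intCast]
  push_cast
  ring

/-- The function of the height which accompanies the coefficient `a⁻(n)`. -/
noncomputable def minusFun (k α : ℕ) (n : ℤ) (y : ℝ) : ℝ :=
  if n = 0 then (y ^ (2 * k + 1))⁻¹ else calE (2 * k + 2) (4 * Real.pi * (n / α) * y)

/-- The constant in the derivative of `minusFun`. -/
noncomputable def minusConst (k α : ℕ) (n : ℤ) : ℝ :=
  if n = 0 then -(2 * k + 1) else ((4 * Real.pi * (n / α)) ^ (2 * k + 1))⁻¹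

theorem minusConst_ne_zero {k α : ℕ} (hα : 0 < α) (n : ℤ) : minusConst k α n ≠ 0 := by
  have hαR : (0 : ℝ) < α := by exact_mod_cast hα
  have := Real.pi_pos
  rw [minusConst]
  split_ifs with h
  · have : (0 : ℝ) < 2 * k + 1 := by positivity
    linarith
  · have : (n : ℝ) ≠ 0 := by exact_mod_cast h
    positivity

theorem hasDerivAt_minusFun (k : ℕ) {α : ℕ} (hα : 0 < α) (n : ℤ) {y : ℝ} (hy : 0 < y) :
    HasDerivAt (minusFun k α n) (minusConst k α n *
      ((y ^ (2 * k + 2))⁻¹ * Real.exp (4 * Real.pi * (n / α) * y))) y := by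
  have hy' := hy.ne'
  have hαR : (α : ℝ) ≠ 0 := by exact_mod_cast hα.ne'
  by_cases h : n = 0
  · subst h
    have he : minusFun k α 0 = fun y => (y ^ (2 * k + 1))⁻¹ := by funext y; simp [minusFun]
    rw [he]
    refine ((hasDerivAt_pow (2 * k + 1) y).fun_inv (pow_ne_zero _ hy')).congr_deriv ?_
    simp only [minusConst, if_true, Int.cast_zero, zero_div, mul_zero, zero_mul, Real.exp_zero,
      Nat.add_sub_cancel]
    push_cast
    field_simp
    ring
  · have hw : 4 * Real.pi * ((n : ℝ) / α) ≠ 0 := by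
      have : (n : ℝ) ≠ 0 := by exact_mod_cast h
      have := Real.pi_pos
      positivity
    have he : minusFun k α n = fun y => calE (2 * k + 2) (4 * Real.pi * (n / α) * y) := by
      funext y; rw [minusFun, if_neg h]
    rw [he, minusConst, if_neg h]
    have h1 := (hasDerivAt_calE (κ := 2 * k + 2) (by omega) (mul_ne_zero hw hy')).comp y
      ((hasDerivAt_id y).const_mul (4 * Real.pi * ((n : ℝ) / α)))
    refine h1.congr_deriv ?_
    generalize 4 * Real.pi * ((n : ℝ) / α) = w at hw
    rw [show (-1 : ℝ) ^ (2 * k + 2) = 1 from Even.neg_one_pow ⟨k + 1, by ring⟩]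
    field_simp
    ring

/-- The holomorphic factor e(-nz) passes through `dbar` and is the conjugate of e(nz) times a
function of the height, so a conjugated Fourier coefficient of `X` appears. -/
theorem hasDerivAt_segInt_mul_e {k α : ℕ} (hα : 0 < α) {H X : ℂ → ℂ}
    (hH : ContDiffOn ℝ 1 H {z | 0 < z.im}) (hper : ∀ z, 0 < z.im → H (z + 1) = H z)
    (hX : ∀ z, 0 < z.im → dbar H z = Complex.I * α * (((α * z.im) ^ (2 * k + 2))⁻¹ : ℝ) *
      (starRingEnd ℂ) (X z)) (n : ℤ) {t : ℝ} (ht : 0 < t) :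
    HasDerivAt (fun t => segInt t fun z => H z * e (((-n : ℤ) : ℂ) * z))
      (α * (((α * t) ^ (2 * k + 2))⁻¹ * Real.exp (4 * Real.pi * (n / α) * (α * t)) : ℝ) *
        (starRingEnd ℂ) (segInt t fun z => X z * e (n * z))) t := by
  have hαR : (α : ℝ) ≠ 0 := by exact_mod_cast hα.ne'
  have he : ∀ z, HasDerivAt (fun z => e (((-n : ℤ) : ℂ) * z)) _ z := hasDerivAt_e_mul _
  have hec : ContDiff ℝ 1 (fun z => e (((-n : ℤ) : ℂ) * z)) := by
    unfold e; fun_prop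
  have h := hasDerivAt_segInt (H := fun z => H z * e (((-n : ℤ) : ℂ) * z)) (hH.mul hec.contDiffOn)
    (fun z hz => by rw [hper z hz, e_mul_add_one]) ht
  refine h.congr_deriv ?_
  rw [segInt_congr (t := t) (g := fun z => Complex.I * α *
    (((α * t) ^ (2 * k + 2))⁻¹ * Real.exp (4 * Real.pi * (n / α) * (α * t)) : ℝ) *
      (starRingEnd ℂ) (X z * e (n * z))), segInt_const_mul, segInt_conj]
  · linear_combination (-α * (((α * t) ^ (2 * k + 2))⁻¹ * Real.exp (4 * Real.pi * (n / α) * (α * t))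
      : ℝ) * (starRingEnd ℂ) (segInt t fun z => X z * e (n * z))) * Complex.I_sq
  · intro z hz
    have hz' : 0 < z.im := by rw [hz]; exact ht
    rw [dbar_mul ((hH.differentiableOn one_ne_zero).differentiableAt (isOpen_im_pos.mem_nhds hz'))
      (he z).differentiableAt, hX z hz', e_neg_mul_eq_conj, map_mul, hz,
      show 4 * Real.pi * ((n : ℝ) / α) * (α * t) = 4 * Real.pi * n * t by field_simp]
    push_cast
    ring

/-- The coefficients of the holomorphic function `X` do not depend on the height, so the
differential equation integrates to a constant plus a multiple of `minusFun`. -/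
theorem exists_segInt_eq {k α : ℕ} (hα : 0 < α) {H X : ℂ → ℂ}
    (hH : ContDiffOn ℝ 1 H {z | 0 < z.im}) (hper : ∀ z, 0 < z.im → H (z + 1) = H z)
    (hX : ∀ z, 0 < z.im → dbar H z = Complex.I * α * (((α * z.im) ^ (2 * k + 2))⁻¹ : ℝ) *
      (starRingEnd ℂ) (X z))
    (hXd : DifferentiableOn ℂ X {z | 0 < z.im}) (hXper : ∀ z, 0 < z.im → X (z + 1) = X z) (n : ℤ) :
    ∃ a b : ℂ, ∀ t, 0 < t →
      segInt t (fun z => H z * e (((-n : ℤ) : ℂ) * z)) = a + b * minusFun k α n (α * t) := by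
  have hαR : (0 : ℝ) < α := by exact_mod_cast hα
  have hq : (minusConst k α n : ℂ) ≠ 0 := by exact_mod_cast minusConst_ne_zero hα n
  set d := segInt 1 (fun z => X z * e (n * z)) with hd
  have hd' : ∀ t, 0 < t → segInt t (fun z => X z * e (n * z)) = d := fun t ht =>
    segInt_eq_of_differentiableOn (hXd.fun_mul (fun z _ =>
      (hasDerivAt_e_mul n z).differentiableAt.differentiableWithinAt))
      (fun z hz => by rw [hXper z hz, e_mul_add_one]) ht one_pos
  set b := (starRingEnd ℂ) d / minusConst k α n with hb
  set f : ℝ → ℂ := fun t => segInt t (fun z => H z * e (((-n : ℤ) : ℂ) * z)) -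
    b * minusFun k α n (α * t) with hf
  have hderiv : ∀ t ∈ Ioi (0 : ℝ), HasDerivAt f 0 t := fun t ht => by
    have ht : 0 < t := ht
    have h1 := hasDerivAt_segInt_mul_e hα hH hper hX n ht
    have h2 := ((hasDerivAt_minusFun k hα n (mul_pos hαR ht)).comp t
      ((hasDerivAt_id t).const_mul (α : ℝ))).ofReal_comp.const_mul b
    refine (h1.sub h2).congr_deriv ?_
    rw [hd' t ht, hb]
    push_cast
    field_simp
    ring
  have hconst := fun t ht => isOpen_Ioi.is_const_of_deriv_eq_zero isPreconnected_Ioi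
    (fun t ht => (hderiv t ht).differentiableAt.differentiableWithinAt)
    (fun t ht => (hderiv t ht).deriv) (x := t) (y := 1) ht (mem_Ioi.2 one_pos)
  refine ⟨f 1, b, fun t ht => ?_⟩
  rw [← hconst t ht, hf]
  ring

/-- The coefficients `a⁻(n)` are determined by the Fourier coefficients of `X`. -/
theorem mul_minusConst_eq {k α : ℕ} (hα : 0 < α) {H X : ℂ → ℂ}
    (hH : ContDiffOn ℝ 1 H {z | 0 < z.im}) (hper : ∀ z, 0 < z.im → H (z + 1) = H z)
    (hX : ∀ z, 0 < z.im → dbar H z = Complex.I * α * (((α * z.im) ^ (2 * k + 2))⁻¹ : ℝ) *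
      (starRingEnd ℂ) (X z)) {n : ℤ} {a b : ℂ}
    (h : ∀ t, 0 < t →
      segInt t (fun z => H z * e (((-n : ℤ) : ℂ) * z)) = a + b * minusFun k α n (α * t))
    {t : ℝ} (ht : 0 < t) :
    b * minusConst k α n = (starRingEnd ℂ) (segInt t (fun z => X z * e (n * z))) := by
  have hαR : (0 : ℝ) < α := by exact_mod_cast hα
  have h1 := hasDerivAt_segInt_mul_e hα hH hper hX n ht
  have h2 := (((hasDerivAt_minusFun k hα n (mul_pos hαR ht)).comp t
    ((hasDerivAt_id t).const_mul (α : ℝ))).ofReal_comp.const_mul b).const_add a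
  have h3 := h1.congr_of_eventuallyEq (f₁ := fun t => a + b * minusFun k α n (α * t)) (by
    filter_upwards [Ioi_mem_nhds ht] with s hs
    exact (h s hs).symm)
  have h4 := h2.unique h3
  have hpos : (((α * t) ^ (2 * k + 2))⁻¹ * Real.exp (4 * Real.pi * (n / α) * (α * t)) : ℝ) ≠ 0 :=
    mul_ne_zero (inv_ne_zero (pow_ne_zero _ (mul_pos hαR ht).ne')) (Real.exp_ne_zero _)
  have hpos' : ((α : ℂ) * (((α * t) ^ (2 * k + 2))⁻¹ *
      Real.exp (4 * Real.pi * (n / α) * (α * t)) : ℝ)) ≠ 0 :=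
    mul_ne_zero (by exact_mod_cast hα.ne') (by exact_mod_cast hpos)
  refine mul_left_cancel₀ hpos' ?_
  rw [← h4]
  push_cast
  ring

/-! ### Vanishing of Fourier coefficients from exponential growth bounds -/

theorem norm_segInt_le {B C α t : ℝ} {H : ℂ → ℂ}
    (hB : ∀ z : ℂ, z.im = t → ‖H z‖ ≤ B * Real.exp (C * (α * z.im))) (n : ℤ) :
    ‖segInt t (fun z => H z * e (((-n : ℤ) : ℂ) * z))‖ ≤
      B * Real.exp ((C * α + 2 * Real.pi * n) * t) := by
  refine (intervalIntegral.norm_integral_le_of_norm_le_const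
    (C := B * Real.exp ((C * α + 2 * Real.pi * n) * t)) fun x _ => ?_).trans (by simp)
  have h := hB (x + t * Complex.I) (im_ofReal_add_mul_I x t)
  rw [im_ofReal_add_mul_I] at h
  have him : (((-n : ℤ) : ℂ) * (x + t * Complex.I)).im = -(n * t) := by simp
  rw [norm_mul, norm_e, him]
  calc _ ≤ B * Real.exp (C * (α * t)) * Real.exp (-(2 * Real.pi * -(n * t))) := by gcongr
    _ = _ := by rw [mul_assoc, ← Real.exp_add]; congr 2; ring

/-- For sufficiently negative n the whole coefficient and its 𝓔 part both tend to 0 as the height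
grows, so the constant part is 0. -/
theorem plus_eq_zero_of_growth {k α : ℕ} (hα : 0 < α) {H : ℂ → ℂ} {A B C : ℝ}
    (hB : ∀ z : ℂ, A ≤ α * z.im → 0 < z.im → ‖H z‖ ≤ B * Real.exp (C * (α * z.im))) {n : ℤ}
    {a b : ℂ} (h : ∀ t, 0 < t →
      segInt t (fun z => H z * e (((-n : ℤ) : ℂ) * z)) = a + b * minusFun k α n (α * t))
    (hn : n < 0) (hnC : C * α + 2 * Real.pi * n < 0) : a = 0 := by
  have hαR : (0 : ℝ) < α := by exact_mod_cast hα
  have hnR : (n : ℝ) < 0 := by exact_mod_cast hn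
  have h1 : Tendsto (fun t : ℝ => b * minusFun k α n (α * t)) atTop (𝓝 (b * (0 : ℝ))) := by
    refine ((Complex.continuous_ofReal.tendsto 0).comp ?_).const_mul b
    have he : (fun t : ℝ => minusFun k α n (α * t)) =
        fun t => calE (2 * k + 2) (4 * Real.pi * n * t) := by
      funext t
      rw [minusFun, if_neg hn.ne]
      congr 1
      field_simp
    rw [he]
    refine (tendsto_calE_atBot _).comp (tendsto_id.const_mul_atTop_of_neg ?_)
    exact mul_neg_of_pos_of_neg (by have := Real.pi_pos; positivity) hnR
  have h2 : Tendsto (fun t : ℝ => segInt t (fun z => H z * e (((-n : ℤ) : ℂ) * z))) atTop (𝓝 0) := by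
    refine squeeze_zero_norm' (a := fun t => B * Real.exp ((C * α + 2 * Real.pi * n) * t)) ?_ ?_
    · filter_upwards [eventually_gt_atTop 0, eventually_ge_atTop (A / α)] with t ht hA
      refine norm_segInt_le (fun z hz => hB z ?_ (by rwa [hz])) n
      rw [hz, mul_comm]
      exact (div_le_iff₀ hαR).1 hA
    · rw [← mul_zero B]
      exact (Real.tendsto_exp_atBot.comp (tendsto_id.const_mul_atTop_of_neg hnC)).const_mul B
  have h3 : Tendsto (fun t : ℝ => segInt t (fun z => H z * e (((-n : ℤ) : ℂ) * z))) atTop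
      (𝓝 (a + b * (0 : ℝ))) := by
    refine (h1.const_add a).congr' ?_
    filter_upwards [eventually_gt_atTop 0] with t ht
    exact (h t ht).symm
  simpa using tendsto_nhds_unique h3 h2

/-- The coefficient is at most of order e^((Cα+2πn)t), while 𝓔(4πnt) has exponential rate 4πn.
Scaling by e^(-3πnt), that is δ = 3/4, keeps the former bounded when Cα < πn and lets the latter
tend to infinity. -/
theorem minus_eq_zero_of_growth {k α : ℕ} (hα : 0 < α) {H : ℂ → ℂ} {A B C : ℝ}
    (hB : ∀ z : ℂ, A ≤ α * z.im → 0 < z.im → ‖H z‖ ≤ B * Real.exp (C * (α * z.im))) {n : ℤ}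
    {a b : ℂ} (h : ∀ t, 0 < t →
      segInt t (fun z => H z * e (((-n : ℤ) : ℂ) * z)) = a + b * minusFun k α n (α * t))
    (hn : 0 < n) (hnC : C * α < Real.pi * n) : b = 0 := by
  have hαR : (0 : ℝ) < α := by exact_mod_cast hα
  have hnR : (0 : ℝ) < n := by exact_mod_cast hn
  have hw : 0 < 4 * Real.pi * n := by have := Real.pi_pos; positivity
  by_contra hb
  have h1 : Tendsto (fun t : ℝ => ‖b‖ * (calE (2 * k + 2) (4 * Real.pi * n * t) *
      Real.exp (-(3 / 4 * (4 * Real.pi * n * t))))) atTop atTop :=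
    ((tendsto_calE_mul_exp_atTop k (δ := 3 / 4) (by norm_num) (by norm_num)).comp
      (tendsto_id.const_mul_atTop hw)).const_mul_atTop (norm_pos_iff.2 hb)
  obtain ⟨t, h2, ht, hA⟩ := ((h1.eventually_gt_atTop (‖a‖ + |B|)).and
    ((eventually_gt_atTop 0).and (eventually_ge_atTop (A / α)))).exists
  have h3 := norm_segInt_le (t := t) (fun z hz => hB z
    (by rw [hz, mul_comm]; exact (div_le_iff₀ hαR).1 hA) (by rwa [hz])) n
  have he : minusFun k α n (α * t) = calE (2 * k + 2) (4 * Real.pi * n * t) := by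
    rw [minusFun, if_neg hn.ne']
    congr 1
    field_simp
  rw [h t ht, he] at h3
  set E := Real.exp (-(3 / 4 * (4 * Real.pi * n * t))) with hE
  have hE0 : 0 < E := Real.exp_pos _
  have hE1 : E ≤ 1 := Real.exp_le_one_iff.2 (by have := mul_pos hw ht; linarith)
  have hle : B * Real.exp ((C * α + 2 * Real.pi * n) * t) * E ≤ |B| := by
    rw [mul_assoc, hE, ← Real.exp_add]
    refine (mul_le_mul_of_nonneg_right (le_abs_self B) (Real.exp_pos _).le).trans
      (mul_le_of_le_one_right (abs_nonneg B) (Real.exp_le_one_iff.2 ?_))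
    have : (C * α - Real.pi * n) * t ≤ 0 := mul_nonpos_of_nonpos_of_nonneg (by linarith) ht.le
    linarith
  set c := calE (2 * k + 2) (4 * Real.pi * n * t)
  have h4 : ‖b‖ * c ≤ ‖a‖ + ‖a + b * (c : ℂ)‖ := by
    calc ‖b‖ * c ≤ ‖b * (c : ℂ)‖ := by
          rw [norm_mul, Complex.norm_real]
          exact mul_le_mul_of_nonneg_left (le_abs_self c) (norm_nonneg b)
      _ = ‖(a + b * (c : ℂ)) - a‖ := by rw [add_sub_cancel_left]
      _ ≤ _ := (norm_sub_le _ _).trans (add_comm _ _).le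
  have h5 : ‖b‖ * (c * E) ≤ ‖a‖ + |B| := by
    calc ‖b‖ * (c * E) = ‖b‖ * c * E := by ring
      _ ≤ (‖a‖ + B * Real.exp ((C * α + 2 * Real.pi * n) * t)) * E := by gcongr; linarith
      _ ≤ ‖a‖ + |B| := by
        rw [add_mul]
        exact add_le_add (mul_le_of_le_one_right (norm_nonneg a) hE1) hle
  linarith

theorem ext_coe (G : ℍ → ℂ) (z : ℍ) : ext G z = G z := by
  rw [ext, UpperHalfPlane.ofComplex_apply]

theorem ext_xi (κ : ℤ) (G : ℍ → ℂ) {z : ℂ} (hz : 0 < z.im) :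
    ext (xi κ G) z = Complex.I * (z.im : ℂ) ^ κ * (starRingEnd ℂ) (dbar (ext G) z) := by
  rw [ext_of_im_pos _ hz, xi_eq]
  rfl

theorem dbar_add_const {F : ℂ → ℂ} {a z : ℂ} (h : ∀ᶠ w in 𝓝 z, F (w + a) = F w) :
    dbar F (z + a) = dbar F z := by
  have h1 : fderiv ℝ F (z + a) = fderiv ℝ F z := by
    rw [← fderiv_comp_add_right]
    exact Filter.EventuallyEq.fderiv_eq h
  rw [dbar, dbar, dX, dX, dY, dY, h1]

theorem im_natCast_mul (α : ℕ) (z : ℂ) : ((α : ℂ) * z).im = α * z.im := by simp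

theorem dbar_ext_natCast_mul {k α : ℕ} (hα : 0 < α) {g : ℍ → ℂ}
    (hg : ContDiffOn ℝ ∞ (ext g) {z | 0 < z.im}) {z : ℂ} (hz : 0 < z.im) :
    dbar (fun z => ext g (α * z)) z = Complex.I * α * (((α * z.im) ^ (2 * k + 2))⁻¹ : ℝ) *
      (starRingEnd ℂ) (ext (xi (2 * k + 2) g) (α * z)) := by
  have hαR : (0 : ℝ) < α := by exact_mod_cast hα
  have hz' : 0 < ((α : ℂ) * z).im := by rw [im_natCast_mul]; positivity
  have hy : ((α : ℂ) * z.im) ≠ 0 := by exact_mod_cast (mul_pos hαR hz).ne'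
  rw [dbar_comp (m := fun z => α * z) ((hg.differentiableOn (by norm_num)).differentiableAt
      (isOpen_im_pos.mem_nhds hz')) ((hasDerivAt_id z).const_mul (α : ℂ)), ext_xi _ _ hz',
    im_natCast_mul, show (2 * (k : ℤ) + 2) = ((2 * k + 2 : ℕ) : ℤ) by push_cast; rfl, zpow_natCast]
  simp only [map_mul, mul_one, Complex.conj_natCast, Complex.conj_I, map_pow, Complex.conj_ofReal,
    Complex.conj_conj]
  push_cast
  field_simp
  linear_combination (α * dbar (ext g) (α * z)) * Complex.I_sq

theorem contDiffOn_comp_natCast_mul {α : ℕ} (hα : 0 < α) {n : WithTop ℕ∞} {F : ℂ → ℂ}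
    (hF : ContDiffOn ℝ n F {z | 0 < z.im}) :
    ContDiffOn ℝ n (fun z => F (α * z)) {z | 0 < z.im} := by
  refine hF.comp (by fun_prop) fun z hz => ?_
  have hαR : (0 : ℝ) < α := by exact_mod_cast hα
  rw [mem_ofPred_eq] at hz ⊢
  rw [im_natCast_mul]
  positivity

theorem segInt_e_mul_e (n m : ℤ) (t : ℝ) :
    segInt t (fun z => e (n * z) * e (((-m : ℤ) : ℂ) * z)) = if n = m then 1 else 0 := by
  have h : ∀ z : ℂ, e (n * z) * e (((-m : ℤ) : ℂ) * z) = e (((n - m : ℤ) : ℂ) * z) := fun z => by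
    rw [← e_add]
    congr 1
    push_cast
    ring
  simp only [h]
  split_ifs with hnm
  · simp [hnm, segInt, e_zero]
  · have h0 : (2 * Real.pi * Complex.I * ((n - m : ℤ) : ℂ)) ≠ 0 := by
      refine mul_ne_zero Complex.two_pi_I_ne_zero ?_
      exact_mod_cast sub_ne_zero.2 hnm
    have h1 := segInt_of_hasDerivAt (t := t)
      (F := fun z => e (((n - m : ℤ) : ℂ) * z) / (2 * Real.pi * Complex.I * ((n - m : ℤ) : ℂ)))
      (F' := fun z => e (((n - m : ℤ) : ℂ) * z))
      (fun z _ => ((hasDerivAt_e_mul _ z).div_const _).congr_deriv (mul_div_cancel_left₀ _ h0))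
      (continuous_e.comp (by fun_prop)).continuousOn
    rw [h1, add_comm (1 : ℂ), e_mul_add_one, sub_self]

/-- Orthogonality of exponentials identifies the coefficients of an arbitrary expansion; it is
needed because `fourierCoeffs` is defined by choice and must still be linked to ξg. -/
theorem isFourierExpansion_segInt {k α : ℕ} (hα : 0 < α) {g : ℍ → ℂ} {a b : ℤ → ℂ}
    (h : IsFourierExpansion k α g a b) (m : ℤ) {t : ℝ} (ht : 0 < t) :
    segInt t (fun z => ext g (α * z) * e (((-m : ℤ) : ℂ) * z)) = a m + b m * minusFun k α m (α * t) := by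
  have hαR : (0 : ℝ) < α := by exact_mod_cast hα
  have hαC : (α : ℂ) ≠ 0 := by exact_mod_cast hα.ne'
  have h1 := hasSum_segInt (t := t) (c := fun n => a n + b n * minusFun k α n (α * t))
    (ν := fun n : ℤ => n) (F := fun z => ext g (α * z)) (φ := fun z => e (((-m : ℤ) : ℂ) * z))
    (fun z hz => by
      have hz' : 0 < ((α : ℂ) * z).im := by rw [im_natCast_mul, hz]; positivity
      rw [ext_of_im_pos _ hz']
      refine (h.hasSum ⟨_, hz'⟩).congr_fun fun n => ?_
      have him : UpperHalfPlane.im ⟨(α : ℂ) * z, hz'⟩ = α * t := by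
        rw [← hz, ← im_natCast_mul]; rfl
      rw [him]
      simp only [minusFun]
      congr 2
      field_simp) (continuous_e.comp (by fun_prop)).continuousOn
  simp only [segInt_e_mul_e] at h1
  refine h1.unique ?_
  convert hasSum_ite_eq m (a m + b m * (minusFun k α m (α * t) : ℂ)) using 2 with n
  by_cases hnm : n = m
  · subst hnm; simp
  · simp [hnm]

/-- The Fourier expansion of a smooth periodic function `g` of moderate growth such that
`ξ_{2k+2} g` is holomorphic. -/
theorem isFourierExpansion_fourierCoeffs {k α : ℕ} (hα : 0 < α) {g : ℍ → ℂ}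
    (hg : ContDiffOn ℝ ∞ (ext g) {z | 0 < z.im})
    (hper : ∀ z, 0 < z.im → ext g (z + α) = ext g z)
    (hξ : DifferentiableOn ℂ (ext (xi (2 * k + 2) g)) {z | 0 < z.im})
    (hgrowth : ∃ A B C : ℝ, ∀ z : ℍ, A ≤ z.im → ‖g z‖ ≤ B * Real.exp (C * z.im)) :
    IsFourierExpansion k α g (fourierCoeffs k α g).1 (fourierCoeffs k α g).2 ∧
      IsXiExpansion k α (fourierCoeffs k α g).2 (constCoeff α (xi (2 * k + 2) g))
        (xi (2 * k + 2) g) := by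
  have hαR : (0 : ℝ) < α := by exact_mod_cast hα
  have hαC : (α : ℂ) ≠ 0 := by exact_mod_cast hα.ne'
  have hpos : ∀ {z : ℂ}, 0 < z.im → 0 < ((α : ℂ) * z).im := fun hz => by
    rw [im_natCast_mul]; positivity
  set H : ℂ → ℂ := fun z => ext g (α * z) with hHdef
  set X : ℂ → ℂ := fun z => ext (xi (2 * k + 2) g) (α * z) with hXdef
  have hH : ContDiffOn ℝ ∞ H {z | 0 < z.im} := contDiffOn_comp_natCast_mul hα hg
  have hH1 : ContDiffOn ℝ 1 H {z | 0 < z.im} := hH.of_le (by exact_mod_cast le_top)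
  have hHper : ∀ z, 0 < z.im → H (z + 1) = H z := fun z hz => by
    simp only [hHdef, mul_add, mul_one]
    exact hper _ (hpos hz)
  have hXd : DifferentiableOn ℂ X {z | 0 < z.im} :=
    hξ.comp (by fun_prop) fun z hz => hpos hz
  have hXper : ∀ z, 0 < z.im → X (z + 1) = X z := fun z hz => by
    have him : 0 < ((α : ℂ) * z + α).im := by simpa using hpos hz
    simp only [hXdef, mul_add, mul_one]
    rw [ext_xi _ _ him, ext_xi _ _ (hpos hz), dbar_add_const, Complex.add_im, Complex.natCast_im,
      add_zero]
    filter_upwards [isOpen_im_pos.mem_nhds (hpos hz)] with w hw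
    exact hper w hw
  have hdbar : ∀ z, 0 < z.im → dbar H z = Complex.I * α * (((α * z.im) ^ (2 * k + 2))⁻¹ : ℝ) *
      (starRingEnd ℂ) (X z) := fun z hz => dbar_ext_natCast_mul hα hg hz
  have hex : ∃ p : (ℤ → ℂ) × (ℤ → ℂ), IsFourierExpansion k α g p.1 p.2 := by
    choose a b hab using exists_segInt_eq hα hH1 hHper hdbar hXd hXper
    obtain ⟨A, B, C, hABC⟩ := hgrowth
    have hB : ∀ z : ℂ, A ≤ α * z.im → 0 < z.im → ‖H z‖ ≤ B * Real.exp (C * (α * z.im)) := by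
      intro z hA hz
      have him : UpperHalfPlane.im ⟨(α : ℂ) * z, hpos hz⟩ = α * z.im := im_natCast_mul α z
      have := hABC ⟨(α : ℂ) * z, hpos hz⟩ (by rwa [him])
      rwa [him, ← ext_of_im_pos g (hpos hz)] at this
    have hpi := Real.pi_pos
    -- The thresholds encode Cα + 2πn < 0 and Cα < πn; the bounds by 0 secure the sign of n.
    refine ⟨(a, b), ⟨⟨min 0 ⌊-(C * α) / (2 * Real.pi)⌋, fun n hn => ?_⟩,
      ⟨max 0 ⌈C * α / Real.pi⌉, fun n hn => ?_⟩, fun z => ?_⟩⟩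
    · refine plus_eq_zero_of_growth hα hB (hab n) (hn.trans_le (min_le_left _ _)) ?_
      have h1 := Int.lt_floor_iff.1 (hn.trans_le (min_le_right _ _))
      have h2 : (n : ℝ) < -(C * α) / (2 * Real.pi) := by linarith
      rw [lt_div_iff₀ (by positivity)] at h2
      linarith
    · refine minus_eq_zero_of_growth hα hB (hab n) ((le_max_left _ _).trans_lt hn) ?_
      have h1 := Int.ceil_lt_iff.1 ((le_max_right _ _).trans_lt hn)
      have h2 : C * α / Real.pi < n := by linarith
      rw [div_lt_iff₀ hpi] at h2
      linarith
    · have him : ((z : ℂ) / α).im = z.im / α := by simp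
      have hz : 0 < ((z : ℂ) / α).im := by rw [him]; exact div_pos z.im_pos hαR
      have h := hasSum_segInt_mul_e (contDiffOn_infty.1 hH 2) hHper hz
      have hv : H (z / α) = g z := by
        simp only [hHdef]
        rw [mul_div_cancel₀ _ hαC, ext_coe]
      rw [hv] at h
      refine h.congr_fun fun n => ?_
      rw [hab n _ hz, him, mul_div_cancel₀ _ hαR.ne']
      simp only [minusFun]
      congr 2
      field_simp
  have hexp : IsFourierExpansion k α g (fourierCoeffs k α g).1 (fourierCoeffs k α g).2 := by
    rw [fourierCoeffs, dif_pos hex]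
    exact hex.choose_spec
  refine ⟨hexp, fun z => ?_⟩
  set b := (fourierCoeffs k α g).2
  have hd : ∀ {t : ℝ}, 0 < t → ∀ n : ℤ, b n * minusConst k α n =
      (starRingEnd ℂ) (segInt t (fun z => X z * e (n * z))) := fun ht n =>
    mul_minusConst_eq hα hH1 hHper hdbar
      (fun t ht => isFourierExpansion_segInt hα hexp n ht) ht
  -- The line of height 1 used by `constCoeff` has height 1/α after rescaling by α.
  have hconst : constCoeff α (xi (2 * k + 2) g) =
      segInt (1 / α) (fun z => X z * e (((0 : ℤ) : ℂ) * z)) := by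
    have h1 := intervalIntegral.smul_integral_comp_mul_left (a := 0) (b := 1)
      (fun x : ℝ => ext (xi (2 * k + 2) g) (x + Complex.I)) (α : ℝ)
    rw [mul_zero, mul_one] at h1
    rw [constCoeff, ← h1, Complex.real_smul, Complex.ofReal_natCast, inv_mul_cancel_left₀ hαC]
    refine intervalIntegral.integral_congr fun x _ => ?_
    simp only [hXdef, Int.cast_zero, zero_mul, e_zero, mul_one]
    congr 1
    push_cast
    field_simp
  have him : ((z : ℂ) / α).im = z.im / α := by simp
  have hz : 0 < ((z : ℂ) / α).im := by rw [him]; exact div_pos z.im_pos hαR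
  have h := hasSum_segInt_mul_e ((hXd.contDiffOn isOpen_im_pos).restrict_scalars ℝ) hXper hz
  have hv : X (z / α) = xi (2 * k + 2) g z := by
    simp only [hXdef]
    rw [mul_div_cancel₀ _ hαC, ext_coe]
  -- The ξ-expansion is indexed by the frequency of g, which is opposite to that of ξg.
  rw [hv, ← (Equiv.neg ℤ).hasSum_iff] at h
  have h2 := h.sub (hasSum_ite_eq (0 : ℤ) (constCoeff α (xi (2 * k + 2) g)))
  refine h2.congr_fun fun n => ?_
  have hn := congrArg (starRingEnd ℂ) (hd hz n)
  rw [Complex.conj_conj] at hn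
  simp only [Function.comp_apply, Equiv.neg_apply, neg_neg]
  rw [← hn]
  by_cases h0 : n = 0
  · subst h0
    have h3 := congrArg (starRingEnd ℂ) (hd (t := 1 / α) (by positivity) 0)
    rw [Complex.conj_conj, ← hconst] at h3
    rw [h3]
    simp [xiCoeff, e_zero]
  · rw [if_neg h0, sub_zero, xiCoeff, if_neg h0, minusConst, if_neg h0, map_mul,
      Complex.conj_ofReal, mul_comm ((starRingEnd ℂ) _)]
    congr 2
    push_cast
    field_simp

/-! ### Slash operators and `ξ` -/

/-- The denominator `cw + d`. -/
noncomputable def den (σ : SL(2, ℤ)) (w : ℂ) : ℂ := σ 1 0 * w + σ 1 1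

/-- The Möbius transformation `(aw + b) / (cw + d)`. -/
noncomputable def mob (σ : SL(2, ℤ)) (w : ℂ) : ℂ := (σ 0 0 * w + σ 0 1) / den σ w

theorem coe_smul_eq_mob (σ : SL(2, ℤ)) (z : ℍ) : ((σ • z : ℍ) : ℂ) = mob σ z := by
  rw [UpperHalfPlane.coe_specialLinearGroup_apply, mob, den]
  simp

theorem denom_eq_den (σ : SL(2, ℤ)) (z : ℍ) : UpperHalfPlane.denom σ z = den σ z := by
  simp [UpperHalfPlane.denom, den]

theorem den_ne_zero (σ : SL(2, ℤ)) {w : ℂ} (hw : 0 < w.im) : den σ w ≠ 0 := by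
  have := UpperHalfPlane.denom_ne_zero σ ⟨w, hw⟩
  rwa [denom_eq_den] at this

theorem im_mob_pos (σ : SL(2, ℤ)) {w : ℂ} (hw : 0 < w.im) : 0 < (mob σ w).im := by
  rw [show mob σ w = _ from (coe_smul_eq_mob σ ⟨w, hw⟩).symm]
  exact (σ • (⟨w, hw⟩ : ℍ)).im_pos

theorem det_eq (σ : SL(2, ℤ)) : (σ 0 0 : ℂ) * σ 1 1 - σ 0 1 * σ 1 0 = 1 := by
  have := σ.2
  rw [Matrix.det_fin_two] at this
  exact_mod_cast this

theorem im_mob (σ : SL(2, ℤ)) {w : ℂ} (hw : 0 < w.im) :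
    ((mob σ w).im : ℂ) = w.im * ((den σ w)⁻¹ * (starRingEnd ℂ) (den σ w)⁻¹) := by
  have hd := den_ne_zero σ hw
  have hd' : (starRingEnd ℂ) (den σ w) ≠ 0 := (map_ne_zero _).2 hd
  have h1 : ∀ u : ℂ, (u.im : ℂ) = (u - (starRingEnd ℂ) u) / (2 * Complex.I) := fun u => by
    rw [Complex.sub_conj]
    push_cast
    field_simp
  rw [h1, h1 w, mob, map_div₀, map_inv₀]
  have := Complex.I_ne_zero
  field_simp
  rw [den]
  simp only [map_add, map_mul, map_intCast]
  linear_combination (w - (starRingEnd ℂ) w) * det_eq σ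

theorem hasDerivAt_mob (σ : SL(2, ℤ)) {w : ℂ} (hw : 0 < w.im) :
    HasDerivAt (mob σ) ((den σ w) ^ 2)⁻¹ w := by
  have h := ((((hasDerivAt_id w).const_mul (σ 0 0 : ℂ)).add_const (σ 0 1 : ℂ))).div
    (((hasDerivAt_id w).const_mul (σ 1 0 : ℂ)).add_const (σ 1 1 : ℂ)) (den_ne_zero σ hw)
  refine h.congr_deriv ?_
  have hd := den_ne_zero σ hw
  simp only [id, mul_one]
  rw [show (σ 1 0 : ℂ) * w + σ 1 1 = den σ w from rfl]
  field_simp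
  rw [den]
  linear_combination det_eq σ

theorem ext_slash (κ : ℤ) (G : ℍ → ℂ) (σ : SL(2, ℤ)) {w : ℂ} (hw : 0 < w.im) :
    ext (G ∣[κ] σ) w = ext G (mob σ w) * den σ w ^ (-κ) := by
  rw [ext_of_im_pos _ hw, ModularForm.SL_slash_apply, denom_eq_den,
    show mob σ w = _ from (coe_smul_eq_mob σ ⟨w, hw⟩).symm, ext_coe]

theorem differentiableOn_den_zpow (σ : SL(2, ℤ)) (κ : ℤ) :
    DifferentiableOn ℂ (fun w => den σ w ^ κ) {w | 0 < w.im} := by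
  refine DifferentiableOn.zpow (f := den σ) ?_ (Or.inl fun w hw => den_ne_zero σ hw)
  unfold den
  fun_prop

theorem differentiableOn_mob (σ : SL(2, ℤ)) : DifferentiableOn ℂ (mob σ) {w | 0 < w.im} :=
  fun _ hw => (hasDerivAt_mob σ hw).differentiableAt.differentiableWithinAt

theorem contDiffOn_ext_slash {κ : ℤ} {G : ℍ → ℂ} (σ : SL(2, ℤ))
    (hG : ContDiffOn ℝ ∞ (ext G) {z | 0 < z.im}) :
    ContDiffOn ℝ ∞ (ext (G ∣[κ] σ)) {z | 0 < z.im} := by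
  refine ContDiffOn.congr (f := fun w => ext G (mob σ w) * den σ w ^ (-κ)) (.mul ?_ ?_)
    fun w hw => ext_slash κ G σ hw
  · exact hG.comp (((differentiableOn_mob σ).contDiffOn isOpen_im_pos).restrict_scalars ℝ)
      fun _ hw => im_mob_pos σ hw
  · exact ((differentiableOn_den_zpow σ _).contDiffOn isOpen_im_pos).restrict_scalars ℝ

theorem differentiableOn_ext_slash {κ : ℤ} {G : ℍ → ℂ} (σ : SL(2, ℤ))
    (hG : DifferentiableOn ℂ (ext G) {z | 0 < z.im}) :
    DifferentiableOn ℂ (ext (G ∣[κ] σ)) {z | 0 < z.im} :=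
  ((hG.comp (differentiableOn_mob σ) fun _ hw => im_mob_pos σ hw).mul
    (differentiableOn_den_zpow σ _)).congr fun _ hw => ext_slash κ G σ hw

theorem dbar_congr {F H : ℂ → ℂ} {z : ℂ} (h : F =ᶠ[𝓝 z] H) : dbar F z = dbar H z := by
  rw [dbar, dbar, dX, dX, dY, dY, h.fderiv_eq]

/-- The automorphy factor is holomorphic and passes through `dbar`; the chain rule contributes a
conjugated (cz+d)^(-2), undone by the outer conjugation, and y^κ turns weight κ into 2 - κ. -/
theorem xi_slash (κ : ℤ) {G : ℍ → ℂ} (σ : SL(2, ℤ))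
    (hG : ContDiffOn ℝ ∞ (ext G) {z | 0 < z.im}) :
    xi κ (G ∣[κ] σ) = (xi κ G) ∣[2 - κ] σ := by
  funext z
  have hz : 0 < (z : ℂ).im := z.im_pos
  have hd := den_ne_zero σ hz
  have hd' : (starRingEnd ℂ) (den σ z) ≠ 0 := (map_ne_zero _).2 hd
  rw [ModularForm.SL_slash_apply, xi_eq, xi_eq, denom_eq_den, coe_smul_eq_mob,
    show ((σ • z).im : ℂ) = _ from congrArg (fun w : ℂ => (w.im : ℂ)) (coe_smul_eq_mob σ z),
    im_mob σ hz, dbar_congr (H := fun w => ext G (mob σ w) * den σ w ^ (-κ)), dbar_mul, dbar_comp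
      ((hG.differentiableOn (by norm_num)).differentiableAt
        (isOpen_im_pos.mem_nhds (im_mob_pos σ hz))) (hasDerivAt_mob σ hz)]
  · simp only [map_mul, map_inv₀, Complex.conj_conj, map_zpow₀, map_pow, UpperHalfPlane.coe_im]
    rw [mul_zpow, mul_zpow, inv_zpow, inv_zpow, zpow_neg, neg_sub, zpow_sub₀ hd]
    have h2 : (den σ z : ℂ) ^ (2 : ℤ) = den σ z ^ 2 := zpow_ofNat _ 2
    rw [h2]
    have := zpow_ne_zero κ hd
    field_simp
  · exact ((hG.differentiableOn (by norm_num)).differentiableAt (isOpen_im_pos.mem_nhds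
      (im_mob_pos σ hz))).comp _ ((hasDerivAt_mob σ hz).differentiableAt.restrictScalars ℝ)
  · exact (differentiableOn_den_zpow σ _).differentiableAt (isOpen_im_pos.mem_nhds hz)
  · filter_upwards [isOpen_im_pos.mem_nhds hz] with w hw
    exact ext_slash κ G σ hw

/-- The image of a harmonic function under `ξ` is holomorphic. -/
theorem differentiableOn_ext_xi {n : ℕ} {G : ℍ → ℂ}
    (hG : ContDiffOn ℝ ∞ (ext G) {z | 0 < z.im}) (hL : ∀ z, laplace n G z = 0) :
    DifferentiableOn ℂ (ext (xi n G)) {z | 0 < z.im} := by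
  intro z hz
  have hz : 0 < z.im := hz
  have hGat : ContDiffAt ℝ 2 (ext G) z :=
    (contDiffOn_infty.1 hG 2).contDiffAt (isOpen_im_pos.mem_nhds hz)
  set F := ext G with hF
  have hsymm : IsSymmSndFDerivAt ℝ F z := hGat.isSymmSndFDerivAt (by simp)
  have hF1 : DifferentiableAt ℝ (fderiv ℝ F) z :=
    (hGat.fderiv_right (m := 1) (by norm_num)).differentiableAt (by norm_num)
  set F2 := fderiv ℝ (fderiv ℝ F) z with hF2
  have hfv : ∀ v : ℂ, HasFDerivAt (fun w => fderiv ℝ F w v) (F2.flip v) z := fun v =>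
    (hF1.hasFDerivAt.clm_apply (hasFDerivAt_const v z)).congr_fderiv (by ext w; simp [hF2])
  have hfX : HasFDerivAt (dX F) (F2.flip 1) z := hfv 1
  have hfY : HasFDerivAt (dY F) (F2.flip Complex.I) z := hfv Complex.I
  have hfD : HasFDerivAt (dbar F) (F2.flip 1 + Complex.I • F2.flip Complex.I) z :=
    hfX.add (hfY.const_mul Complex.I)
  have hXX : dX (dX F) z = F2 1 1 := by rw [dX, hfX.fderiv]; rfl
  have hYY : dY (dY F) z = F2 Complex.I Complex.I := by rw [dY, hfY.fderiv]; rfl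
  have hLz := hL ⟨z, hz⟩
  rw [laplace, ← hF] at hLz
  change -(z.im : ℂ) ^ 2 * (dX (dX F) z + dY (dY F) z) + Complex.I * (n : ℤ) * z.im * dbar F z = 0
    at hLz
  rw [hXX, hYY, Int.cast_natCast] at hLz
  have hy : (z.im : ℂ) ≠ 0 := by exact_mod_cast hz.ne'
  have hLz' : (z.im : ℂ) * (F2 1 1 + F2 Complex.I Complex.I) = Complex.I * n * dbar F z :=
    mul_left_cancel₀ hy (by linear_combination -hLz)
  have hLc := congrArg (starRingEnd ℂ) hLz'
  simp only [map_mul, map_add, Complex.conj_ofReal, Complex.conj_I, map_natCast] at hLc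
  have hpow : (n : ℂ) * (z.im : ℂ) ^ (n - 1) * z.im = n * (z.im : ℂ) ^ n := by
    rcases n with _ | n
    · simp
    · rw [Nat.add_sub_cancel]; ring
  have hP : HasFDerivAt (fun w : ℂ => (w.im : ℂ)) (Complex.ofRealCLM.comp Complex.imCLM) z :=
    (Complex.ofRealCLM.comp Complex.imCLM).hasFDerivAt
  have hC : HasFDerivAt (fun w => (starRingEnd ℂ) (dbar F w)) _ z :=
    (Complex.conjCLE : ℂ →L[ℝ] ℂ).hasFDerivAt.comp z hfD
  have hM := ((hP.pow n).const_mul Complex.I).fun_mul hC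
  have heq : ext (xi n G) =ᶠ[𝓝 z]
      fun w => Complex.I * (w.im : ℂ) ^ n * (starRingEnd ℂ) (dbar F w) := by
    filter_upwards [isOpen_im_pos.mem_nhds hz] with w hw
    rw [ext_xi _ _ hw, zpow_natCast]
  refine (DifferentiableAt.congr_of_eventuallyEq ?_ heq).differentiableWithinAt
  -- What remains is the Cauchy–Riemann equation: mixed second derivatives cancel by symmetry, and
  -- the rest is the conjugated Laplace equation times a power of y.
  refine differentiableAt_complex_iff_differentiableAt_real.2 ⟨hM.differentiableAt, ?_⟩
  rw [hM.fderiv]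
  have hsy : F2 Complex.I 1 = F2 1 Complex.I := hsymm.eq _ _
  simp [hsy]
  refine mul_left_cancel₀ hy ?_
  linear_combination (z.im : ℂ) ^ n * hLc +
    Complex.I * (starRingEnd ℂ) (dbar F z) * hpow +
    z.im * (z.im : ℂ) ^ n * (Complex.I * (starRingEnd ℂ) (F2 1 Complex.I) -
      ((starRingEnd ℂ) (F2 1 1) + (starRingEnd ℂ) (F2 Complex.I Complex.I))) * Complex.I_sq

/-! ### Widths of cusps -/

/-- Some Γ(M) lies in `Γ`; it is normal and contains T^M, so the infimum defining the width runs
over a nonempty set and is attained. -/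
theorem cuspWidth_spec {Γ : Subgroup SL(2, ℤ)} (hΓ : CongruenceSubgroup.IsCongruenceSubgroup Γ)
    (σ : SL(2, ℤ)) : 0 < cuspWidth Γ σ ∧
      (σ * ModularGroup.T ^ cuspWidth Γ σ * σ⁻¹ ∈ Γ ∨
        -(σ * ModularGroup.T ^ cuspWidth Γ σ * σ⁻¹) ∈ Γ) := by
  obtain ⟨M, hM, hle⟩ := hΓ
  refine Nat.sInf_mem (s := {n : ℕ | 0 < n ∧ (σ * ModularGroup.T ^ n * σ⁻¹ ∈ Γ ∨
    -(σ * ModularGroup.T ^ n * σ⁻¹) ∈ Γ)}) ⟨M, Nat.pos_of_ne_zero hM, Or.inl (hle ?_)⟩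
  refine (CongruenceSubgroup.Gamma_normal M).conj_mem _ ?_ σ
  simpa using CongruenceSubgroup.ModularGroup_T_pow_mem_Gamma M M dvd_rfl

theorem den_neg (σ : SL(2, ℤ)) (w : ℂ) : den (-σ) w = -den σ w := by
  simp [den]
  ring

theorem slash_neg {κ : ℤ} (hκ : Even κ) (G : ℍ → ℂ) (γ : SL(2, ℤ)) : G ∣[κ] (-γ) = G ∣[κ] γ := by
  funext z
  rw [ModularForm.SL_slash_apply, ModularForm.SL_slash_apply, denom_eq_den, denom_eq_den, den_neg,
    ModularGroup.SL_neg_smul, hκ.neg.neg_zpow]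

/-- In even weight -1 acts trivially, so the sign ambiguity in the definition of the width does no
harm. -/
theorem ext_slash_add_cuspWidth {Γ : Subgroup SL(2, ℤ)}
    (hΓ : CongruenceSubgroup.IsCongruenceSubgroup Γ) {κ : ℤ} (hκ : Even κ) {G : ℍ → ℂ}
    (hG : ∀ γ ∈ Γ, G ∣[κ] γ = G) (σ : SL(2, ℤ)) {z : ℂ} (hz : 0 < z.im) :
    ext (G ∣[κ] σ) (z + cuspWidth Γ σ) = ext (G ∣[κ] σ) z := by
  obtain ⟨-, hmem⟩ := cuspWidth_spec hΓ σ
  have h1 : G ∣[κ] (σ * ModularGroup.T ^ cuspWidth Γ σ * σ⁻¹) = G := by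
    rcases hmem with h | h
    · exact hG _ h
    · rw [← slash_neg hκ]; exact hG _ h
  have h2 : (G ∣[κ] σ) ∣[κ] (ModularGroup.T ^ cuspWidth Γ σ) = G ∣[κ] σ := by
    rw [← SlashAction.slash_mul]
    conv_rhs => rw [← h1, ← SlashAction.slash_mul, inv_mul_cancel_right]
  have hT : (ModularGroup.T ^ cuspWidth Γ σ : SL(2, ℤ)).1 = !![1, (cuspWidth Γ σ : ℤ); 0, 1] := by
    have := ModularGroup.coe_T_zpow (cuspWidth Γ σ : ℤ)
    rwa [zpow_natCast] at this
  have h3 := ext_slash κ (G ∣[κ] σ) (ModularGroup.T ^ cuspWidth Γ σ) hz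
  rw [h2] at h3
  rw [h3, mob, den]
  simp [hT]

/-! ### The main theorem -/

/-- Smoothness passes to G|σ, and since ξ commutes with the slash action, ξ(G|σ) = (ξG)|σ is
holomorphic. The same identity matches the constant coefficient used in `altHalf` with that of the
ξ-expansion. -/
theorem IsHarmonicMaassForm.regHalf_eq_altHalf {Γ : Subgroup SL(2, ℤ)}
    (hΓ : CongruenceSubgroup.IsCongruenceSubgroup Γ) {k : ℕ} {G : ℍ → ℂ}
    (hG : IsHarmonicMaassForm Γ (2 * k + 2) G) (σ : SL(2, ℤ)) (r : ℝ) {c S T : ℝ}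
    (hc : 0 < c) (hS : 0 < S) (hT : 0 < T) : regHalf Γ k G σ r c S = altHalf Γ k G σ r c T := by
  have hα := (cuspWidth_spec hΓ σ).1
  have hs := contDiffOn_ext_slash (κ := 2 * k + 2) σ hG.smooth
  have hξ := xi_slash (2 * k + 2) σ hG.smooth
  rw [show (2 - (2 * k + 2) : ℤ) = -(2 * k) by ring] at hξ
  have hcast : (2 * k + 2 : ℤ) = ((2 * k + 2 : ℕ) : ℤ) := by push_cast; rfl
  have hhol : DifferentiableOn ℂ (ext (xi (2 * k + 2) G)) {z | 0 < z.im} := by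
    rw [hcast]
    exact differentiableOn_ext_xi hG.smooth (by rw [← hcast]; exact hG.harmonic)
  obtain ⟨h1, h2⟩ := isFourierExpansion_fourierCoeffs hα hs
    (fun z hz => ext_slash_add_cuspWidth hΓ ⟨k + 1, by ring⟩ hG.slash_eq σ hz)
    (by rw [hξ]; exact differentiableOn_ext_slash σ hhol) (hG.growth σ)
  rw [show constCoeff _ (xi (2 * k + 2) (G ∣[(2 * k + 2 : ℤ)] σ)) = _ from congrArg _ hξ] at h2
  exact ShintaniCycle.regHalf_eq_altHalf hα h1 h2 hs.continuousOn r hc hS hT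

theorem normFactor_ne_zero {N : ℕ} (hN : 0 < N) (k : ℕ) {X : Matrix (Fin 2) (Fin 2) ℚ}
    (hX : Q N X < 0) : normFactor N k X ≠ 0 := by
  have h : Real.sqrt ((|Q N X| : ℚ) * N) ≠ 0 := by
    rw [Real.sqrt_ne_zero']
    have h1 : (0 : ℝ) < (|Q N X| : ℚ) := by exact_mod_cast abs_pos.2 hX.ne
    positivity
  refine mul_ne_zero (pow_ne_zero _ (mul_ne_zero (mul_ne_zero two_ne_zero ?_) Complex.I_ne_zero))
    Complex.I_ne_zero
  exact_mod_cast h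

end ShintaniCycle

theorem mainTheorem9 (N : ℕ) (hN : 0 < N)
    (Γ : Subgroup SL(2, ℤ)) (hΓ : CongruenceSubgroup.IsCongruenceSubgroup Γ)
    (k : ℕ) (G : ℍ → ℂ) (hG : ShintaniCycle.IsHarmonicMaassForm Γ (2 * k + 2) G)
    (X : Matrix (Fin 2) (Fin 2) ℚ) (hX : X.trace = 0)
    (hneg : ShintaniCycle.Q N X < 0) (hsq : IsSquare (|ShintaniCycle.Q N X| / (4 * N)))
    (σp σm : SL(2, ℤ)) (hσ : ShintaniCycle.IsCuspPair N X σp σm)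
    (c : ℝ) (hc : 0 < c)
    -- the auxiliary numbers in the definition of the regularized cycle integral
    (Sp Sm : ℝ) (hSp : 0 < Sp) (hSm : 0 < Sm)
    -- the auxiliary numbers in the formula
    (Tp Tm : ℝ) (hTp : 0 < Tp) (hTm : 0 < Tm) :
    1 / ShintaniCycle.normFactor N k X *
        ShintaniCycle.regCycleIntegral N Γ k G X σp σm c Sp Sm
      = ShintaniCycle.altHalf Γ k G σp (ShintaniCycle.realPart N X σp) c Tp
        + (-1) ^ (k + 1) *
          ShintaniCycle.altHalf Γ k G σm (ShintaniCycle.realPart N (-X) σm)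
            (ShintaniCycle.cMinus N X σp σm c) Tm := by
  have hcm : 0 < ShintaniCycle.cMinus N X σp σm c := UpperHalfPlane.im_pos _
  rw [ShintaniCycle.regCycleIntegral, one_div,
    inv_mul_cancel_left₀ (ShintaniCycle.normFactor_ne_zero hN k hneg),
    hG.regHalf_eq_altHalf hΓ σp _ hc hSp hTp,
    hG.regHalf_eq_altHalf hΓ σm _ hcm hSm hTm]
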